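/- Let $\mathbb{k}=\mathbb{R}$ or $\mathbb{C}$, and let $(L,A)$ be a Lie pair over a smooth manifold $M$ (finite-dimensional, Hausdorff, $\sigma$-compact): $L\to M$ is a $\mathbb{k}$-Lie algebroid of finite rank and $A\subset L$ a Lie subalgebroid. Put $B=L/A$, with projection $\pi:L\to B$. **Algebra and operators.** Let $\mathcal{R}=C^\infty(L[1]\oplus B)=\Gamma(\Lambda^\bullet L^\vee\otimes \widehat{S}B^\vee)$, with the topology given by $\mathcal{I}^n=\Gamma(\Lambda^\bullet L^\vee\otimes\widehat{S}^{\ge n}B^\vee)$ (and $\mathcal{I}^n=\mathcal{R}$ for $n\le 0$). A *vertical operator* is a continuous $\Gamma(\Lambda^\bullet L^\vee)$-linear operator on $\mathcal{R}$; a *vertical automorphism* is a vertical operator that is a degree-preserving automorphism of the graded algebra $\mathcal{R}$. Let $\mathscr{E}$ be the space of vertical operators $\varphi$ for which there is $N\in\mathbb{Z}$ with $\varphi(\Gamma(\Lambda^\bullet L^\vee\otimes S^kB^\vee))\subset\mathcal{I}^{k+N}$ for all $k\ge0$. A section $s$ of $\Lambda^\bullet L^\vee\otimes\widehat{S}B^\vee\otimes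 S^qB$ defines a vertical differential operator $D_s$: for $s=\omega\otimes f\otimes(b_1\odot\cdots\odot b_q)$ it is $D_s(\omega'\otimes f')=(\omega\wedge\omega')\otimes(f\cdot\iota_{b_1}\cdots\iota_{b_q}f')$. Every $\varphi\in\mathscr{E}$ has a unique expansion $\varphi=\sum_q D_{s_q}$ with, for some $N\in\mathbb{Z}$, $s_q\in\Gamma(\Lambda^\bullet L^\vee\otimes\widehat{S}^{\ge q+N}B^\vee\otimes S^qB)$ for all $q$. All series of operators are understood to converge uniformly for the $\mathcal{I}$-adic topology. **Homotopy operators.** The Koszul vector field is $\mathsf{k}=\sum_i\xi^i\,\partial/\partial\eta^i$: $(\mathsf{k}f)(l_0,\dots,l_p)=\sum_i(-1)^i\iota_{\pi(l_i)}f(l_0,\dots,\widehat{l_i},\dots,l_p)$. A splitting $i_B:B\to L$ of $0\to A\to L\to B\to 0$ gives $L\cong A\oplus B$; let $h$ be the operator on $\mathcal{R}$ that on $\Gamma(\Lambda^{p_1}A^\vee\otimes\Lambda^{p_2}B^\vee\otimes S^qB^\vee)$ is $\frac{1}{p_2+q}\sum_i\eta^i\,\partial/\partial\xi^i$ (and $0$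 if $p_2+q=0$), where $\sum_i\eta^i\,\partial/\partial\xi^i$ sends $w$ to $(l;b_0,\dots,b_k)\mapsto\sum_j w(i_B(b_j),l;b_0,\dots,\widehat{b_j},\dots,b_k)$. For $\varphi=\sum_qD_{s_q}\in\mathscr{E}$ put $\mathsf{h}_\natural(\varphi)=\sum_q D_{(h\otimes\mathrm{id})(s_q)}$. **Fedosov vector fields.** The Fedosov homological vector field arising from a splitting and a torsion-free $L$-connection $\nabla$ on $B$ is $Q=-\mathsf{k}+d_L^\nabla+X$, where $d_L^\nabla$ is the covariant derivative on $\mathcal{R}$ and $X\in\Gamma(L^\vee\otimes\widehat{S}^{\ge2}B^\vee\otimes B)$ is determined by $\mathsf{h}_\natural(X)=0$ (for this splitting) and $Q^2=0$. **Theorem.** Let $Q_1,Q_2$ be the Fedosov homological vector fields arising from two choices of a splitting and a torsion-free $L$-connection on $B$, and let $\mathsf{h}_\natural$ be taken with respect to any splitting (for instance one of these two). There is a unique vertical automorphism $\phi$ of $\mathcal{R}$ with $\phi\circ Q_2=Q_1\circ\phi$. It lies in $\mathscr{E}$ and is the unique solution in $\mathscr{E}$ of $$\phi=1+\mathsf{h}_\natural\eth(\phi),\qquad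 \eth(\phi)=\Delta Q\circ\phi+[\mathsf{k}+Q_2,\phi],\quad \Delta Q=Q_1-Q_2,$$ where $[\cdot,\cdot]$ is the graded commutator. Moreover, $$\phi=\sum_{n=0}^\infty(\mathsf{h}_\natural\eth)^n(1)=1+\sum_{n=0}^\infty(\mathsf{h}_\natural\eth)^n\big(\mathsf{h}_\natural(\Delta Q)\big),$$ and both series converge uniformly for the $\mathcal{I}$-adic topology. -/

import Mathlib

open scoped Manifold ContDiff Topology TensorProduct

/-! ## Functions on the Fedosov manifold

`R` is the ring of functions on the base, `L` and `B` are modules of sections.  Sections of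
`Λ^p L^∨ ⊗ S^k B^∨` are the `R`-multilinear maps `L^p × B^k → R`, alternating in the arguments
from `L` and symmetric in the arguments from `B`. -/

namespace Fedosov

noncomputable section Algebra

/-- Symmetric `R`-multilinear forms in `k` arguments from `B`. -/
def symSubmodule (R B : Type*) [CommRing R] [AddCommGroup B] [Module R B] (k : ℕ) :
    Submodule R (MultilinearMap R (fun _ : Fin k => B) R) where
  carrier := {f | ∀ (σ : Equiv.Perm (Fin k)) (v : Fin k → B), f (fun i => v (σ i)) = f v}
  add_mem' := by
    intro f g hf hg σ v
    simp [hf σ v, hg σ v]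
  zero_mem' := by
    intro σ v
    simp
  smul_mem' := by
    intro c f hf σ v
    simp [hf σ v]

/-- Sections of `S^k B^∨`: symmetric `R`-multilinear forms in `k` arguments from `B`. The product
`β₁ ⊙ ⋯ ⊙ β_k` corresponds to `(b₁, …, b_k) ↦ ∑_σ ∏ ⟨b_i, β_{σ i}⟩`. -/
def SymForm (R B : Type*) [CommRing R] [AddCommGroup B] [Module R B] (k : ℕ) : Type _ :=
  symSubmodule R B k

namespace SymForm

variable {R B : Type*} [CommRing R] [AddCommGroup B] [Module R B] {k : ℕ}

instance : AddCommGroup (SymForm R B k) := inferInstanceAs (AddCommGroup (symSubmodule R B k))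

instance : Module R (SymForm R B k) := inferInstanceAs (Module R (symSubmodule R B k))

/-- The underlying multilinear form. -/
def toMulti : SymForm R B k →ₗ[R] MultilinearMap R (fun _ : Fin k => B) R :=
  (symSubmodule R B k).subtype

instance : CoeFun (SymForm R B k) (fun _ => (Fin k → B) → R) := ⟨fun f => toMulti f⟩

/-- A symmetric multilinear form as an element of `SymForm`. -/
def mk (f : MultilinearMap R (fun _ : Fin k => B) R)
    (h : ∀ (σ : Equiv.Perm (Fin k)) (v : Fin k → B), f (fun i => v (σ i)) = f v) :
    SymForm R B k := ⟨f, h⟩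

@[simp] theorem toMulti_mk (f : MultilinearMap R (fun _ : Fin k => B) R)
    (h : ∀ (σ : Equiv.Perm (Fin k)) (v : Fin k → B), f (fun i => v (σ i)) = f v) :
    toMulti (mk f h) = f := rfl

@[ext] theorem ext {f g : SymForm R B k} (h : ∀ v, f v = g v) : f = g :=
  Subtype.ext (MultilinearMap.ext h)

theorem symm (f : SymForm R B k) (σ : Equiv.Perm (Fin k)) (v : Fin k → B) :
    f (fun i => v (σ i)) = f v := f.2 σ v

end SymForm

/-- Sections of `Λ^p L^∨ ⊗ S^k B^∨`. -/
abbrev Form (R L B : Type*) [CommRing R] [AddCommGroup L] [Module R L] [AddCommGroup B]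
    [Module R B] (p k : ℕ) : Type _ :=
  L [⋀^Fin p]→ₗ[R] SymForm R B k

/-- The function algebra `Γ(Λ^• L^∨ ⊗ Ŝ B^∨)`: a function is the family of its components in
`Γ(Λ^p L^∨ ⊗ S^k B^∨)`. (For a bundle of finite rank, `Λ^p L^∨ = 0` for large `p`.) -/
abbrev FormalFun (R L B : Type*) [CommRing R] [AddCommGroup L] [Module R L] [AddCommGroup B]
    [Module R B] : Type _ :=
  ∀ p k : ℕ, Form R L B p k

variable {R L B : Type*} [CommRing R] [Algebra ℚ R]
  [AddCommGroup L] [Module R L] [AddCommGroup B] [Module R B]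

/-- The sum of a multilinear form over all permutations of its arguments. -/
def symmetrize (m : ℕ) : MultilinearMap R (fun _ : Fin m => B) R →ₗ[R] SymForm R B m where
  toFun f := SymForm.mk (∑ σ : Equiv.Perm (Fin m), f.domDomCongr σ) (by
    intro τ v
    simp only [_root_.sum_apply, MultilinearMap.domDomCongr_apply]
    exact Fintype.sum_equiv (Equiv.mulLeft τ) _ _ (fun σ => by simp))
  map_add' f g := by
    ext v
    simp [Finset.sum_add_distrib]
  map_smul' c f := by
    ext v
    simp [Finset.mul_sum]

/-- The symmetrized product `S^r B^∨ ⊗ S^j B^∨ → S^m B^∨`, `m = r + j`, applied to an element of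
`S^r B^∨ ⊗ S^j B^∨` given as an `S^j B^∨`-valued multilinear form `G` on `B^r`. Its value on
`(b₁, …, b_m)` is the sum over all `(r,j)`-shuffles of `G (b_σ(1), …, b_σ(r)) (b_σ(r+1), …)` when
`G` is symmetric. -/
def symProd {r j m : ℕ} (h : r + j = m) :
    MultilinearMap R (fun _ : Fin r => B) (SymForm R B j) →ₗ[R] SymForm R B m where
  toFun G := algebraMap ℚ R ((r.factorial * j.factorial : ℕ) : ℚ)⁻¹ • symmetrize m
    (((SymForm.toMulti.compMultilinearMap G).uncurrySum).domDomCongr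
      (finSumFinEquiv.trans (finCongr h)))
  map_add' G G' := by
    rw [← smul_add, ← map_add]
    rfl
  map_smul' c G := by
    rw [RingHom.id_apply, smul_comm, ← map_smul (symmetrize m) c]
    rfl

/-- The product `S^r B^∨ ⊗ S^j B^∨ → S^m B^∨`, `m = r + j`. -/
def symMul {r j m : ℕ} (h : r + j = m) :
    SymForm R B r →ₗ[R] SymForm R B j →ₗ[R] SymForm R B m :=
  LinearMap.mk₂ R (fun f g => symProd h ((SymForm.toMulti f).smulRight g))
    (fun f f' g => by
      rw [← map_add]
      congr 1
      ext v
      simp [add_mul])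
    (fun c f g => by
      rw [← map_smul]
      congr 1
      ext v
      simp [mul_assoc])
    (fun f g g' => by
      rw [← map_add]
      congr 1
      ext v
      simp)
    (fun c f g => by
      rw [← map_smul]
      congr 1
      ext v
      simp [mul_left_comm])

/-- Evaluation of `f ∈ S^{r+q} B^∨` on `r` arguments, with values in `S^q B^∨`. -/
def partialEval (r q : ℕ) :
    SymForm R B (r + q) →ₗ[R] MultilinearMap R (fun _ : Fin r => B) (SymForm R B q) where
  toFun f := (((SymForm.toMulti f).domDomCongr finSumFinEquiv.symm).currySum).codRestrict
      (symSubmodule R B q) (by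
    intro v σ w
    have h := f.symm (finSumFinEquiv.permCongr (Equiv.sumCongr (Equiv.refl _) σ))
      (fun i => Sum.elim v w (finSumFinEquiv.symm i))
    simp only [MultilinearMap.currySum_apply', MultilinearMap.domDomCongr_apply]
    rw [← h]
    congr 1
    ext i
    obtain ⟨i, rfl⟩ := finSumFinEquiv.surjective i
    rcases i with i | i <;> simp [Equiv.permCongr_apply])
  map_add' f g := by
    ext v
    rfl
  map_smul' c f := by
    ext v
    rfl

/-- The contraction of `u ∈ S^j B^∨ ⊗ S^q B`, viewed as a map `S^q B^∨ → S^j B^∨`, with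
`f ∈ S^{r+q} B^∨`: for `u = g ⊗ (b₁ ⊙ ⋯ ⊙ b_q)` it is `g ⊙ ι_{b₁} ⋯ ι_{b_q} f`. -/
def contract {r j m : ℕ} (q : ℕ) (h : r + j = m) :
    (SymForm R B q →ₗ[R] SymForm R B j) →ₗ[R] SymForm R B (r + q) →ₗ[R] SymForm R B m :=
  LinearMap.mk₂ R (fun u f => symProd h (u.compMultilinearMap (partialEval r q f)))
    (fun u u' f => by
      rw [← map_add]
      rfl)
    (fun c u f => by
      rw [← map_smul]
      rfl)
    (fun u f f' => by
      rw [← map_add]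
      congr 1
      ext v
      simp)
    (fun c u f => by
      rw [← map_smul]
      congr 1
      ext v
      simp)

/-- The wedge product of alternating forms (sum over shuffles), the values being multiplied by the
bilinear map `β`. -/
def wedge {N₁ N₂ N₃ : Type*} [AddCommGroup N₁] [Module R N₁] [AddCommGroup N₂] [Module R N₂]
    [AddCommGroup N₃] [Module R N₃] (β : N₁ →ₗ[R] N₂ →ₗ[R] N₃) {p p' n : ℕ} (h : p + p' = n)
    (a : L [⋀^Fin p]→ₗ[R] N₁) (b : L [⋀^Fin p']→ₗ[R] N₂) : L [⋀^Fin n]→ₗ[R] N₃ :=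
  ((TensorProduct.lift β).compAlternatingMap (a.domCoprod b)).domDomCongr
    (finSumFinEquiv.trans (finCongr h))

/-- The product of the function algebra. -/
def mul (f g : FormalFun R L B) : FormalFun R L B := fun n m =>
  ∑ x : Finset.HasAntidiagonal.antidiagonal n, ∑ y : Finset.HasAntidiagonal.antidiagonal m,
    wedge (symMul (Finset.HasAntidiagonal.mem_antidiagonal.1 y.2)) (Finset.HasAntidiagonal.mem_antidiagonal.1 x.2)
      (f x.1.1 y.1.1) (g x.1.2 y.1.2)

variable (R L B) in
/-- The unit of the function algebra: the constant function `1`. -/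
def one : FormalFun R L B
  | 0, 0 => AlternatingMap.constOfIsEmpty R L (Fin 0)
      (SymForm.mk (MultilinearMap.constOfIsEmpty R _ 1) fun _ _ => rfl)
  | _, _ => 0

variable (R L B) in
/-- The `n`-th power `Γ(Λ^• L^∨ ⊗ Ŝ^{≥ n} B^∨)` of the ideal `Γ(Λ^• L^∨ ⊗ Ŝ^{≥ 1} B^∨)`, which is
the whole algebra for `n ≤ 0`. -/
def adic (n : ℤ) : Submodule R (FormalFun R L B) where
  carrier := {f | ∀ p k : ℕ, (k : ℤ) < n → f p k = 0}
  add_mem' := by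
    intro f g hf hg p k h
    simp [hf p k h, hg p k h]
  zero_mem' := by
    intro p k _
    rfl
  smul_mem' := by
    intro c f hf p k h
    simp [hf p k h]

/-- `f` is a section of `Λ^p L^∨ ⊗ Ŝ B^∨`, that is, homogeneous of degree `p`. -/
def HasFormDegree (p : ℕ) (f : FormalFun R L B) : Prop := ∀ p' k : ℕ, p' ≠ p → f p' k = 0

/-- `f` is a section of `Λ^• L^∨ ⊗ S^k B^∨`. -/
def HasSymDegree (k : ℕ) (f : FormalFun R L B) : Prop := ∀ p k' : ℕ, k' ≠ k → f p k' = 0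

/-! ## Operators -/

variable (R L B) in
/-- Additive operators on the function algebra, with composition as multiplication. The vertical
operators and the Fedosov vector fields below are automatically linear over the base field. -/
abbrev Op : Type _ := AddMonoid.End (FormalFun R L B)

/-- Continuity for the adic topology, for which the sets `f + adic n` are a basis of
neighbourhoods of `f`. -/
def IsAdicContinuous (φ : FormalFun R L B → FormalFun R L B) : Prop :=
  ∀ (f : FormalFun R L B) (n : ℕ), ∃ m : ℕ, ∀ g : FormalFun R L B,
    g - f ∈ adic R L B m → φ g - φ f ∈ adic R L B n

/-- A vertical operator: continuous and `Γ(Λ^• L^∨)`-linear. Linearity is written for the right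
multiplication by forms, where it takes no signs; for an operator of degree `d` it says that
`φ (ω f) = (-1)^{d |ω|} ω φ(f)`. -/
def IsVertical (φ : Op R L B) : Prop :=
  IsAdicContinuous φ ∧
    ∀ f w : FormalFun R L B, HasSymDegree 0 w → φ (mul f w) = mul (φ f) w

/-- `φ` shifts the adic filtration by `N`. -/
def Shifts (N : ℤ) (φ : Op R L B) : Prop :=
  ∀ (k : ℕ) (f : FormalFun R L B), HasSymDegree k f → φ f ∈ adic R L B (k + N)

/-- The filtration-shifting vertical operators. -/
def IsFiltrationShifting (φ : Op R L B) : Prop :=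
  IsVertical φ ∧ ∃ N : ℤ, Shifts N φ

/-- A vertical automorphism of the graded algebra of functions: a vertical operator which is a
degree-preserving isomorphism of algebras. -/
structure IsVerticalAutomorphism (φ : Op R L B) : Prop where
  vertical : IsVertical φ
  bijective : Function.Bijective φ
  map_one : φ (one R L B) = one R L B
  map_mul : ∀ f g : FormalFun R L B, φ (mul f g) = mul (φ f) (φ g)
  map_degree : ∀ (p : ℕ) (f : FormalFun R L B), HasFormDegree p f → HasFormDegree p (φ f)

/-- Uniform convergence of the series of operators `∑ u i` to `φ` for the adic topology. -/
def HasUniformSum (u : ℕ → FormalFun R L B → FormalFun R L B)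
    (φ : FormalFun R L B → FormalFun R L B) : Prop :=
  ∀ n : ℕ, ∃ N₀ : ℕ, ∀ N : ℕ, N₀ ≤ N → ∀ f : FormalFun R L B,
    φ f - ∑ i ∈ Finset.range N, u i f ∈ adic R L B n

/-- The parity operator, `(-1)^p` on forms of degree `p`. -/
def parity : Op R L B where
  toFun f := fun p k => (-1 : R) ^ p • f p k
  map_zero' := by
    funext p k
    exact smul_zero _
  map_add' f g := by
    funext p k
    exact smul_add _ _ _

/-- The graded commutator `[D, φ]` with an operator `D` of degree one. If `φ` has degree `d` then
`parity * φ * parity = (-1)^d φ`, so that this is `D φ - (-1)^d φ D`. -/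
def gradedComm (D φ : Op R L B) : Op R L B :=
  D * φ - parity * φ * parity * D

/-- A linear map with values in alternating forms, as an alternating form with values in linear
maps. -/
def flipAlt {N N' : Type*} [AddCommGroup N] [Module R N] [AddCommGroup N'] [Module R N'] {p : ℕ}
    (u : N →ₗ[R] L [⋀^Fin p]→ₗ[R] N') : L [⋀^Fin p]→ₗ[R] (N →ₗ[R] N') where
  toFun l :=
    { toFun := fun x => u x l
      map_add' := fun x y => by simp
      map_smul' := fun c x => by simp }
  map_update_add' l i x y := by
    ext z
    exact (u z).map_update_add l i x y
  map_update_smul' l i c x := by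
    ext z
    exact (u z).map_update_smul l i c x
  map_eq_zero_of_eq' l i j h hij := by
    ext z
    exact (u z).map_eq_zero_of_eq l h hij

/-- The vertical differential operator defined by a section `s` of
`Λ^• L^∨ ⊗ Ŝ B^∨ ⊗ S^q B`. Such a section is given as an `R`-linear map from `Γ(S^q B^∨)` to
`Γ(Λ^• L^∨ ⊗ Ŝ B^∨)`. For `s = ω ⊗ f ⊗ (b₁ ⊙ ⋯ ⊙ b_q)`, the operator maps `ω' ⊗ f'` to
`(ω ∧ ω') ⊗ (f · ι_{b₁} ⋯ ι_{b_q} f')`. -/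
def vdo (q : ℕ) (s : SymForm R B q →ₗ[R] FormalFun R L B) (g : FormalFun R L B) :
    FormalFun R L B := fun n m =>
  ∑ x : Finset.HasAntidiagonal.antidiagonal n, ∑ y : Finset.HasAntidiagonal.antidiagonal m,
    wedge (contract q (Finset.HasAntidiagonal.mem_antidiagonal.1 y.2)) (Finset.HasAntidiagonal.mem_antidiagonal.1 x.2)
      (flipAlt ((LinearMap.proj y.1.2).comp ((LinearMap.proj x.1.1).comp s)))
      (g x.1.2 (y.1.1 + q))

/-- The contraction `ι_b` on `S^{k+1} B^∨`, as a linear map in `b`. -/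
def insertB (k : ℕ) : B →ₗ[R] SymForm R B (k + 1) →ₗ[R] SymForm R B k :=
  LinearMap.mk₂ R
    (fun b f => SymForm.mk ((SymForm.toMulti f).curryLeft b) (by
      intro σ v
      have h := f.symm (Equiv.Perm.decomposeFin.symm (0, σ)) (Fin.cons b v)
      simp only [MultilinearMap.curryLeft_apply]
      rw [← h]
      congr 1
      ext i
      refine Fin.cases ?_ (fun i => ?_) i <;> simp))
    (fun b b' f => by ext v; simp)
    (fun c b f => by ext v; simp)
    (fun b f f' => by ext v; simp)
    (fun c b f => by ext v; simp)

/-- The Koszul vector field `∑ ξ^i ∂/∂η^i`, for the projection `π : L → B`: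
`(k f)(l₀, …, l_p) = ∑ (-1)^i ι_{π l_i} f(l₀, …, l̂_i, …, l_p)`. -/
def koszul (π : L →ₗ[R] B) : Op R L B where
  toFun f
    | 0, _ => 0
    | p + 1, k => AlternatingMap.alternatizeUncurryFin
        { toFun := fun l => (insertB k (π l)).compAlternatingMap (f p (k + 1))
          map_add' := fun l l' => by
            ext v
            simp
          map_smul' := fun c l => by
            ext v
            simp }
  map_zero' := by
    funext p k
    cases p with
    | zero => rfl
    | succ p =>
      refine AlternatingMap.ext fun v => ?_
      simp [AlternatingMap.alternatizeUncurryFin_apply]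
  map_add' f g := by
    funext p k
    cases p with
    | zero => simp
    | succ p =>
      refine AlternatingMap.ext fun v => ?_
      simp [AlternatingMap.alternatizeUncurryFin_apply, Finset.sum_add_distrib]

/-- For a splitting `ib : B → L` of `π : L → B`, so that `L = A ⊕ B` and
`Λ^n L^∨ = ⨁ Λ^{n-t} A^∨ ⊗ Λ^t B^∨`: the component of an `n`-form in `Λ^{n-t} A^∨ ⊗ Λ^t B^∨`.
It is the sum over all sets `T` of `t` arguments of the value of the form on the components in
`ib(B)` of the arguments in `T` and the components in `A = ker π` of the other ones. -/
def bidegree {N : Type*} [AddCommGroup N] [Module R N] (π : L →ₗ[R] B) (ib : B →ₗ[R] L)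
    {n : ℕ} (t : ℕ) : (L [⋀^Fin n]→ₗ[R] N) →ₗ[R] (L [⋀^Fin n]→ₗ[R] N) where
  toFun w :=
    { toMultilinearMap := ∑ T ∈ (Finset.univ : Finset (Fin n)).powersetCard t,
        (w.toMultilinearMap).compLinearMap
          (fun i => if i ∈ T then ib ∘ₗ π else LinearMap.id - ib ∘ₗ π)
      map_eq_zero_of_eq' := by
        intro v i j hv hij
        simp only [MultilinearMap.toFun_eq_coe, _root_.sum_apply,
          MultilinearMap.compLinearMap_apply, AlternatingMap.coe_multilinearMap]
        have key : ∀ T : Finset (Fin n),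
            (fun a => (if a ∈ T.map (Equiv.swap i j).toEmbedding then ib ∘ₗ π
              else LinearMap.id - ib ∘ₗ π) (v a)) =
            (fun a => (if a ∈ T then ib ∘ₗ π else LinearMap.id - ib ∘ₗ π) (v a)) ∘
              Equiv.swap i j := by
          intro T
          funext a
          have h1 : a ∈ T.map (Equiv.swap i j).toEmbedding ↔ Equiv.swap i j a ∈ T := by
            rw [Finset.mem_map_equiv, Equiv.symm_swap]
          have h2 : v (Equiv.swap i j a) = v a := by
            rcases eq_or_ne a i with rfl | hi
            · simp [hv]
            · rcases eq_or_ne a j with rfl | hj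
              · simp [hv]
              · rw [Equiv.swap_apply_of_ne_of_ne hi hj]
          simp only [h1, Function.comp_apply, h2]
        refine Finset.sum_involution (fun T _ => T.map (Equiv.swap i j).toEmbedding) ?_ ?_ ?_ ?_
        · intro T _
          rw [key T]
          exact w.map_add_swap _ hij
        · intro T _ hT hTT
          apply hT
          have h3 := key T
          rw [hTT] at h3
          refine w.map_eq_zero_of_eq _ ?_ hij
          have h4 := congrFun h3 i
          simpa using h4
        · intro T hT
          rw [Finset.mem_powersetCard] at hT ⊢
          exact ⟨Finset.subset_univ _, by rw [Finset.card_map]; exact hT.2⟩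
        · intro T _
          ext a
          simp [Finset.mem_map_equiv] }
  map_add' w w' := by
    ext v
    simp [Finset.sum_add_distrib]
  map_smul' c w := by
    ext v
    simp [Finset.smul_sum]

/-- The vector field `∑ η^i ∂/∂ξ^i` defined by a splitting `ib : B → L`:
it maps `w` to `(l; b₀, …, b_k) ↦ ∑ w(ib b_i, l; b₀, …, b̂_i, …, b_k)`. -/
def koszulDual (ib : B →ₗ[R] L) (p k : ℕ) : Form R L B (p + 1) k →ₗ[R] Form R L B p (k + 1) where
  toFun w :=
    ((symProd (Nat.add_comm 1 k)).comp
      (MultilinearMap.ofSubsingletonₗ R R B (SymForm R B k) (0 : Fin 1)).toLinearMap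
      ).compAlternatingMap (flipAlt (w.curryLeft.comp ib))
  map_add' w w' := by
    refine AlternatingMap.ext fun v => ?_
    simp only [LinearMap.compAlternatingMap_apply, AlternatingMap.add_apply, ← map_add]
    rfl
  map_smul' c w := by
    refine AlternatingMap.ext fun v => ?_
    simp only [LinearMap.compAlternatingMap_apply, AlternatingMap.smul_apply, ← map_smul]
    rfl

/-- The homotopy operator of a splitting `ib : B → L`: on sections of
`Λ^{p₁} A^∨ ⊗ Λ^{p₂} B^∨ ⊗ S^q B^∨` it is `(p₂ + q)⁻¹ ∑ η^i ∂/∂ξ^i`, and `0` if `p₂ + q = 0`. -/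
def homotopy (π : L →ₗ[R] B) (ib : B →ₗ[R] L) : FormalFun R L B →ₗ[R] FormalFun R L B where
  toFun f
    | _, 0 => 0
    | p, k + 1 => ∑ t ∈ Finset.range (p + 2),
        algebraMap ℚ R ((t + k : ℕ) : ℚ)⁻¹ • koszulDual ib p k (bidegree π ib t (f (p + 1) k))
  map_add' f g := by
    funext p k
    cases k with
    | zero => simp
    | succ k => simp [Finset.sum_add_distrib]
  map_smul' c f := by
    funext p k
    cases k with
    | zero => simp
    | succ k => simp [Finset.smul_sum, smul_comm c]

/-- The graph of the homotopy operator `h_♮` on filtration-shifting vertical operators: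
`h_♮ (∑ D_q) = ∑ h_♮ (D_q)`, where `D_q` is the vertical differential operator of a section `s q` of
`Λ^• L^∨ ⊗ Ŝ^{≥ q + N} B^∨ ⊗ S^q B`, and `h_♮ (D_q)` that of `(h ⊗ id) (s q)`. -/
def IsHomotopyNat (π : L →ₗ[R] B) (ib : B →ₗ[R] L) (φ ψ : Op R L B) : Prop :=
  ∃ (N : ℤ) (s : ∀ q : ℕ, SymForm R B q →ₗ[R] FormalFun R L B),
    (∀ (q : ℕ) (β : SymForm R B q), s q β ∈ adic R L B (q + N)) ∧
    HasUniformSum (fun q => vdo q (s q)) φ ∧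
    HasUniformSum (fun q => vdo q ((homotopy π ib).comp (s q))) ψ

open Classical in
/-- The homotopy operator `h_♮`. Every filtration-shifting vertical operator `φ` is in a unique way
a sum `∑ D_q` as in `IsHomotopyNat`, and `h_♮ φ` is the operator `∑ h_♮ (D_q)`; operators without
such an expansion are mapped to `0`. -/
def homotopyNat (π : L →ₗ[R] B) (ib : B →ₗ[R] L) (φ : Op R L B) : Op R L B :=
  if h : ∃ ψ, IsHomotopyNat π ib φ ψ then h.choose else 0

/-- `ð(φ) = ΔQ ∘ φ + [k + Q₂, φ]`, where `ΔQ = Q₁ - Q₂`. -/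
def eth (π : L →ₗ[R] B) (Q₁ Q₂ φ : Op R L B) : Op R L B :=
  (Q₁ - Q₂) * φ + gradedComm (koszul π + Q₂) φ

/-! ## Lie algebroids, connections and Fedosov vector fields -/

/-- A Lie algebroid structure on the module `L` of sections of a vector bundle. For
`R = C^∞(M, 𝕜)` the derivations of `R` are the sections of `T_M` (of `T_M ⊗ ℂ` for `𝕜 = ℂ`).
The bracket is `𝕜`-bilinear by the Leibniz rule. -/
structure LieAlgebroidStructure (𝕜 R L : Type*) [CommRing 𝕜] [CommRing R] [Algebra 𝕜 R]
    [AddCommGroup L] [Module R L] where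
  /-- the bracket of sections -/
  bracket : L → L → L
  /-- the anchor -/
  anchor : L →ₗ[R] Derivation 𝕜 R R
  bracket_add : ∀ x y z, bracket x (y + z) = bracket x y + bracket x z
  add_bracket : ∀ x y z, bracket (x + y) z = bracket x z + bracket y z
  bracket_self : ∀ x, bracket x x = 0
  jacobi : ∀ x y z,
    bracket x (bracket y z) = bracket (bracket x y) z + bracket y (bracket x z)
  leibniz : ∀ x (f : R) y, bracket x (f • y) = f • bracket x y + anchor x f • y
  anchor_bracket : ∀ x y, anchor (bracket x y) = ⁅anchor x, anchor y⁆

/-- An `L`-connection on `B`. It is `𝕜`-bilinear by the Leibniz rule. -/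
structure LConnection {𝕜 R L : Type*} [CommRing 𝕜] [CommRing R] [Algebra 𝕜 R] [AddCommGroup L]
    [Module R L] (Λ : LieAlgebroidStructure 𝕜 R L) (B : Type*) [AddCommGroup B] [Module R B] where
  /-- the covariant derivative `∇_l b` -/
  nabla : L → B → B
  add_left : ∀ l l' b, nabla (l + l') b = nabla l b + nabla l' b
  add_right : ∀ l b b', nabla l (b + b') = nabla l b + nabla l b'
  smul_left : ∀ (f : R) l b, nabla (f • l) b = f • nabla l b
  leibniz : ∀ l (f : R) b, nabla l (f • b) = Λ.anchor l f • b + f • nabla l b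

variable {𝕜 : Type*} [CommRing 𝕜] [Algebra 𝕜 R] {Λ : LieAlgebroidStructure 𝕜 R L}

/-- Vanishing of the torsion `∇_l (π l') - ∇_l' (π l) - π [l, l']`. -/
def LConnection.IsTorsionFree (D : LConnection Λ B) (π : L →ₗ[R] B) : Prop :=
  ∀ l l', D.nabla l (π l') - D.nabla l' (π l) - π (Λ.bracket l l') = 0

/-- The part `∑_{i<j} (-1)^{i+j} f([l_i, l_j], l₀, …, l̂_i, …, l̂_j, …)` of the Chevalley–Eilenberg
differential. -/
def bracketTerm (Λ : LieAlgebroidStructure 𝕜 R L) (f : FormalFun R L B) (k : ℕ) (b : Fin k → B) :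
    ∀ p : ℕ, (Fin (p + 1) → L) → R
  | 0, _ => 0
  | p + 1, l => ∑ j : Fin (p + 2), ∑ i : Fin (p + 1),
      if i.castSucc < j then
        (-1) ^ ((i : ℕ) + (j : ℕ)) *
          f (p + 1) k (Fin.cons (Λ.bracket (l i.castSucc) (l j)) (i.removeNth (j.removeNth l))) b
      else 0

/-- `d` is the covariant derivative `d_L^∇` on `Γ(Λ^• L^∨ ⊗ Ŝ B^∨)`, for the connection on `Ŝ B^∨`
that is induced by the connection `∇ = D` on `B`. -/
def IsCovariantDerivative (D : LConnection Λ B) (d : Op R L B) : Prop :=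
  ∀ (f : FormalFun R L B) (k : ℕ) (b : Fin k → B),
    (∀ l : Fin 0 → L, d f 0 k l b = 0) ∧
    ∀ (p : ℕ) (l : Fin (p + 1) → L),
      d f (p + 1) k l b =
        ∑ i : Fin (p + 1), (-1) ^ (i : ℕ) *
          (Λ.anchor (l i) (f p k (i.removeNth l) b) -
            ∑ a : Fin k, f p k (i.removeNth l) (Function.update b a (D.nabla (l i) (b a)))) +
        bracketTerm Λ f k b p l

/-- `Q = -k + d_L^∇ + X` is the Fedosov vector field of the splitting `ib` and the connection `D`:
`X` is the vertical vector field of a section `s` of `L^∨ ⊗ Ŝ^{≥ 2} B^∨ ⊗ B` with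
`h_♮(X) = (h ⊗ id) (s) = 0`, and `Q² = 0`. -/
def IsFedosov (π : L →ₗ[R] B) (ib : B →ₗ[R] L) (D : LConnection Λ B) (Q : Op R L B) : Prop :=
  ∃ (d : Op R L B) (s : SymForm R B 1 →ₗ[R] FormalFun R L B),
    IsCovariantDerivative D d ∧
    (∀ β, HasFormDegree 1 (s β) ∧ s β ∈ adic R L B 2) ∧
    (∀ β, homotopy π ib (s β) = 0) ∧
    (∀ f, Q f = -koszul π f + d f + vdo 1 s f) ∧
    Q * Q = 0

end Algebra

/-! ## Smooth functions and sections -/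

noncomputable section Geometry

open Bundle

variable (𝕜 E M : Type*) [RCLike 𝕜] [NormedAddCommGroup E] [NormedSpace ℝ E] [TopologicalSpace M]
  [ChartedSpace E M]

/-- The smooth `𝕜`-valued functions on a real manifold, as a subalgebra of all functions. -/
def smoothFunctions : Subalgebra 𝕜 (M → 𝕜) where
  carrier := {f | ContMDiff 𝓘(ℝ, E) 𝓘(ℝ, 𝕜) ∞ f}
  mul_mem' := by
    intro f g hf hg
    exact (contDiff_mul (𝕜 := ℝ) (𝔸 := 𝕜)).contMDiff.comp (hf.prodMk_space hg)
  add_mem' := by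
    intro f g hf hg
    exact hf.add hg
  algebraMap_mem' := by
    intro c
    exact contMDiff_const

/-- The algebra `C^∞(M, 𝕜)`. -/
def SmoothFun : Type _ := smoothFunctions 𝕜 E M

instance : CommRing (SmoothFun 𝕜 E M) := inferInstanceAs (CommRing (smoothFunctions 𝕜 E M))

instance : Algebra 𝕜 (SmoothFun 𝕜 E M) := inferInstanceAs (Algebra 𝕜 (smoothFunctions 𝕜 E M))

instance : Algebra ℚ (SmoothFun 𝕜 E M) := inferInstanceAs (Algebra ℚ (smoothFunctions 𝕜 E M))

variable (F : Type*) [NormedAddCommGroup F] [NormedSpace 𝕜 F] [NormedSpace ℝ F]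
  [IsScalarTower ℝ 𝕜 F] {M}
  (V : M → Type*) [TopologicalSpace (TotalSpace F V)] [∀ x, AddCommGroup (V x)]
  [∀ x, Module 𝕜 (V x)] [∀ x, Module ℝ (V x)] [∀ x, TopologicalSpace (V x)]
  [FiberBundle F V] [VectorBundle 𝕜 F V] [VectorBundle ℝ F V]

/-- The smooth sections of a vector bundle `V`, with fibre `F`, over a real manifold, as an additive
subgroup of all sections. -/
def smoothSections : AddSubgroup (∀ x, V x) where
  carrier := {s | ContMDiff 𝓘(ℝ, E) (𝓘(ℝ, E).prod 𝓘(ℝ, F)) ∞ (fun x => TotalSpace.mk' F x (s x))}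
  add_mem' := by
    intro s t hs ht
    exact hs.add_section ht
  zero_mem' := contMDiff_zeroSection ℝ V
  neg_mem' := by
    intro s hs
    exact hs.neg_section

/-- The module `Γ(V)` of smooth sections of the vector bundle `V`. -/
def SmoothSec : Type _ := smoothSections E F V

instance : AddCommGroup (SmoothSec E F V) := inferInstanceAs (AddCommGroup (smoothSections E F V))

instance : Module (SmoothFun 𝕜 E M) (SmoothSec E F V) where
  smul f s := ⟨fun x => f.1 x • s.1 x, by
    intro x₀
    have hf : ContMDiffAt 𝓘(ℝ, E) 𝓘(ℝ, 𝕜) ∞ f.1 x₀ := f.2 x₀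
    have hs : ContMDiffAt 𝓘(ℝ, E) (𝓘(ℝ, E).prod 𝓘(ℝ, F)) ∞
      (fun x => TotalSpace.mk' F x (s.1 x)) x₀ := s.2 x₀
    rw [contMDiffAt_section] at hs ⊢
    have h : ContMDiffAt 𝓘(ℝ, E) 𝓘(ℝ, F) ∞
        (fun x => f.1 x • (trivializationAt F V x₀ ⟨x, s.1 x⟩).2) x₀ :=
      ((contDiff_smul (𝕜 := ℝ) (𝕜' := 𝕜) (F := F)).contMDiff.contMDiffAt).comp x₀
        (hf.prodMk_space hs)
    refine h.congr_of_eventuallyEq ?_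
    filter_upwards [(trivializationAt F V x₀).open_baseSet.mem_nhds
      (mem_baseSet_trivializationAt F V x₀)] with x hx
    exact ((trivializationAt F V x₀).linear 𝕜 hx).map_smul (f.1 x) (s.1 x)⟩
  one_smul s := Subtype.ext (funext fun x => one_smul 𝕜 (s.1 x))
  mul_smul f g s := Subtype.ext (funext fun x => mul_smul (f.1 x) (g.1 x) (s.1 x))
  smul_zero f := Subtype.ext (funext fun x => smul_zero (f.1 x))
  smul_add f s t := Subtype.ext (funext fun x => smul_add (f.1 x) (s.1 x) (t.1 x))
  add_smul f g s := Subtype.ext (funext fun x => add_smul (f.1 x) (g.1 x) (s.1 x))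
  zero_smul s := Subtype.ext (funext fun x => zero_smul 𝕜 (s.1 x))

variable {𝕜 V}

/-- The smooth sections of `V` with values in a family `A` of subspaces of the fibres. -/
def sectionsOf (A : ∀ x, Submodule 𝕜 (V x)) :
    Submodule (SmoothFun 𝕜 E M) (SmoothSec E F V) where
  carrier := {s | ∀ x, s.1 x ∈ A x}
  add_mem' := by
    intro s t hs ht x
    exact (A x).add_mem (hs x) (ht x)
  zero_mem' := by
    intro x
    exact (A x).zero_mem
  smul_mem' := by
    intro f s hs x
    exact (A x).smul_mem (f.1 x) (hs x)

/-- `A` is a smooth subbundle of `V`: near every point it has a frame of smooth sections. -/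
def IsSmoothSubbundle (A : ∀ x, Submodule 𝕜 (V x)) : Prop :=
  ∀ x₀ : M, ∃ (r : ℕ) (s : Fin r → SmoothSec E F V), ∀ᶠ x in 𝓝 x₀,
    LinearIndependent 𝕜 (fun i => (s i).1 x) ∧
      Submodule.span 𝕜 (Set.range fun i => (s i).1 x) = A x

/-- `A` is a Lie subalgebroid of the Lie algebroid `V`: a smooth subbundle whose sections are closed
under the bracket. -/
structure IsLieSubalgebroid
    (Λ : LieAlgebroidStructure 𝕜 (SmoothFun 𝕜 E M) (SmoothSec E F V))
    (A : ∀ x, Submodule 𝕜 (V x)) : Prop where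
  smooth : IsSmoothSubbundle E F A
  bracket_mem : ∀ a ∈ sectionsOf E F A, ∀ a' ∈ sectionsOf E F A,
    Λ.bracket a a' ∈ sectionsOf E F A

/-- The module `Γ(B)` of sections of the quotient bundle `B = V / A`: every section of `B` is the
image of a section of `V`, unique up to sections of `A`. -/
def QuotSec (A : ∀ x, Submodule 𝕜 (V x)) : Type _ := SmoothSec E F V ⧸ sectionsOf E F A

instance (A : ∀ x, Submodule 𝕜 (V x)) : AddCommGroup (QuotSec E F A) :=
  inferInstanceAs (AddCommGroup (SmoothSec E F V ⧸ sectionsOf E F A))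

instance (A : ∀ x, Submodule 𝕜 (V x)) : Module (SmoothFun 𝕜 E M) (QuotSec E F A) :=
  inferInstanceAs (Module (SmoothFun 𝕜 E M) (SmoothSec E F V ⧸ sectionsOf E F A))

/-- The projection `Γ(V) → Γ(B)`, `B = V / A`. -/
def quotProj (A : ∀ x, Submodule 𝕜 (V x)) :
    SmoothSec E F V →ₗ[SmoothFun 𝕜 E M] QuotSec E F A :=
  (sectionsOf E F A).mkQ

end Geometry

end Fedosov

/-!
The proof is algebraic: `R`, `L` and `B` stand for the smooth functions and the sections of the two
bundles, and geometry enters only through the facts that `R` is reduced and that `L`, and with it its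
direct summand `B`, has local frames (`hasLocalFrames_smoothSec`). Functions on `L[1] ⊕ B` are families
of multilinear maps, so identities between operators are proved by coinduction: an identity holds if
it holds for constant terms and if contracting it with elements of `L` and `B` gives identities of the
same kind (`eq_zero_of_contractions`). In this way one obtains associativity of the product, the Leibniz
rules, the rules of the vertical differential operators, and the homotopy formula
`h k + k h = 1 - (projection onto Λ^• A^∨)` (`homotopy_koszul_add`).

Euler's identity in a local frame (`sum_oneForm_mul_iL`) shows that a vertical operator is controlled
by its restriction to `Ŝ B^∨` (`IsVertical.mem_adic`). Hence operators shifting the filtration expand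
uniquely into vertical differential operators (`IsExpansion.exists_of_isShift`, `IsExpansion.unique`),
and `h_♮` acts on the coefficients. It raises the order of operators by `1` (`IsShift.homotopyNat`),
while `ð` preserves the order (`isShift_eth`). So `φ ↦ 1 + h_♮ ð φ` is a contraction; its only fixed
point is the sum of the series of the `(h_♮ ð)^n (1)` (`exists_fixedPoint`, `eq_of_fixedPoint`).

That the fixed point has the required properties follows from the homotopy formula on operators,
`h_♮ [k, Ψ] = Ψ` if `h_♮ Ψ` and the projection of `Ψ` onto `Λ^• A^∨` vanish
(`homotopyNat_gradedComm_koszul`). It is applied to two defects, each of which turns out to be the image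
under `h_♮` of an expression in itself of the same order, so that it has arbitrarily high order and
vanishes. The first is `Q₁ φ - φ Q₂` (`intertwines_of_fixedPoint`), where `Q₁² = Q₂² = 0` is used.
The second is the failure of `φ` to be multiplicative (`map_mul_of_intertwines`). As `φ - 1` has
positive order, `φ` is inverted by a Neumann series (`bijective_of_sub_one`).

Conversely, let `ψ` be a vertical automorphism intertwining the two vector fields. By continuity, large
powers of `ψ β` for `β` in `B^∨` have no constant term; as `R` is reduced, neither has `ψ β`. So `ψ`
preserves the filtration, by Euler's identity on `B` (`IsVerticalAutomorphism.isShift`). Now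
`ð ψ = [k, ψ - 1]`, and the homotopy formula gives `h_♮ ð ψ = ψ - 1`, the equation of the fixed point
(`IsVerticalAutomorphism.fixedPoint`).
-/

namespace Fedosov
noncomputable section

/-! ### Sums over permutations -/

/-- Every permutation of `Fin (n + 1)` is in a unique way a cycle `0 → ⋯ → i` preceding a permutation
that fixes `0`. -/
theorem bijective_mul_cycleRange (n : ℕ) : Function.Bijective
    (fun x : Fin (n + 1) × Equiv.Perm (Fin n) =>
      Equiv.Perm.decomposeFin.symm (0, x.2) * x.1.cycleRange) := by
  rw [Fintype.bijective_iff_injective_and_card]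
  constructor
  · rintro ⟨i, σ⟩ ⟨j, τ⟩ h
    have h' : ∀ x, Equiv.Perm.decomposeFin.symm (0, σ) (i.cycleRange x) =
        Equiv.Perm.decomposeFin.symm (0, τ) (j.cycleRange x) := fun x => Equiv.congr_fun h x
    have hij : i = j := by
      have h1 := h' i
      rw [Fin.cycleRange_self, Equiv.Perm.decomposeFin_symm_apply_zero] at h1
      have h2 : Equiv.Perm.decomposeFin.symm (0, τ) (j.cycleRange j) = 0 := by
        rw [Fin.cycleRange_self, Equiv.Perm.decomposeFin_symm_apply_zero]
      have h3 := (Equiv.Perm.decomposeFin.symm (0, τ)).injective (h1.symm.trans h2.symm)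
      exact j.cycleRange.injective h3
    subst hij
    have h4 := mul_right_cancel h
    have h5 := Equiv.Perm.decomposeFin.symm.injective h4
    simpa using h5
  · rw [Fintype.card_congr Equiv.Perm.decomposeFin.symm]

theorem cons_comp_decomposeFin {X : Type*} {n : ℕ} (i : Fin (n + 1)) (τ : Equiv.Perm (Fin n))
    (b : X) (v : Fin n → X) :
    (fun x => (Fin.cons b v : Fin (n + 1) → X)
      ((Equiv.Perm.decomposeFin.symm (0, τ) * i.cycleRange) x)) =
      i.insertNth b (fun x => v (τ x)) := by
  rw [← Fin.cons_comp_cycleRange]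
  funext x
  simp only [Equiv.Perm.mul_apply, Function.comp_apply]
  generalize i.cycleRange x = y
  refine Fin.cases ?_ (fun y => ?_) y <;> simp

/-- The sum over all permutations of the arguments, with the sign if `e = 1` and without it if
`e = 0`, of a function that takes the first `r` and the last `j` arguments. -/
def shuffleSum (e : ℕ) {X N : Type*} [AddCommGroup N] {r j m : ℕ} (h : r + j = m)
    (K : (Fin r → X) → (Fin j → X) → N) (v : Fin m → X) : N :=
  ∑ σ : Equiv.Perm (Fin m), (Equiv.Perm.sign σ ^ e : ℤˣ) •
    K (fun i => v (σ (Fin.cast h (Fin.castAdd j i)))) (fun i => v (σ (Fin.cast h (Fin.natAdd r i))))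

theorem shuffleSum_cons (e : ℕ) {X N : Type*} [AddCommGroup N] {r j m : ℕ} (h : r + j = m + 1)
    (K : (Fin r → X) → (Fin j → X) → N) (b : X) (v : Fin m → X) :
    shuffleSum e h K (Fin.cons b v) = ∑ x : Fin (m + 1), ∑ τ : Equiv.Perm (Fin m),
      (((-1) ^ (x : ℕ)) ^ e * Equiv.Perm.sign τ ^ e : ℤˣ) •
      K (fun i => (x.insertNth b (fun y => v (τ y)) : Fin (m + 1) → X)
          (Fin.cast h (Fin.castAdd j i)))
        (fun i => (x.insertNth b (fun y => v (τ y)) : Fin (m + 1) → X)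
          (Fin.cast h (Fin.natAdd r i))) := by
  rw [← Fintype.sum_prod_type', shuffleSum]
  symm
  refine Fintype.sum_bijective _ (bijective_mul_cycleRange m) _ _ ?_
  rintro ⟨x, τ⟩
  have h1 := cons_comp_decomposeFin x τ b v
  rw [Equiv.Perm.sign_mul, Equiv.Perm.decomposeFin.symm_sign, Fin.sign_cycleRange, ← h1]
  simp [mul_pow, mul_comm]

theorem insertNth_castAdd_left {X : Type*} {r j m : ℕ} (h : r + 1 + j = m + 1) (h' : r + j = m)
    (i : Fin (r + 1)) (b : X) (w : Fin m → X) :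
    (fun k => ((Fin.cast h (Fin.castAdd j i)).insertNth b w : Fin (m + 1) → X)
      (Fin.cast h (Fin.castAdd j k))) =
      i.insertNth b (fun k => w (Fin.cast h' (Fin.castAdd j k))) := by
  rw [Fin.eq_insertNth_iff]
  refine ⟨by simp, ?_⟩
  funext k
  have : Fin.cast h (Fin.castAdd j (i.succAbove k)) =
      (Fin.cast h (Fin.castAdd j i)).succAbove (Fin.cast h' (Fin.castAdd j k)) := by
    simp only [Fin.succAbove, Fin.ext_iff, Fin.lt_def]
    split_ifs with h1 h2 h2 <;> simp_all
    omega
  simp [Fin.removeNth, this]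

theorem insertNth_castAdd_right {X : Type*} {r j m : ℕ} (h : r + 1 + j = m + 1) (h' : r + j = m)
    (i : Fin (r + 1)) (b : X) (w : Fin m → X) :
    (fun k => ((Fin.cast h (Fin.castAdd j i)).insertNth b w : Fin (m + 1) → X)
      (Fin.cast h (Fin.natAdd (r + 1) k))) =
      (fun k => w (Fin.cast h' (Fin.natAdd r k))) := by
  funext k
  have : Fin.cast h (Fin.natAdd (r + 1) k) =
      (Fin.cast h (Fin.castAdd j i)).succAbove (Fin.cast h' (Fin.natAdd r k)) := by
    simp only [Fin.succAbove, Fin.ext_iff, Fin.lt_def]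
    have := i.2
    split_ifs with h1 <;> simp_all <;> omega
  simp [this]

theorem insertNth_natAdd_left {X : Type*} {r j m : ℕ} (h : r + (j + 1) = m + 1) (h' : r + j = m)
    (i : Fin (j + 1)) (b : X) (w : Fin m → X) :
    (fun k => ((Fin.cast h (Fin.natAdd r i)).insertNth b w : Fin (m + 1) → X)
      (Fin.cast h (Fin.castAdd (j + 1) k))) =
      (fun k => w (Fin.cast h' (Fin.castAdd j k))) := by
  funext k
  have : Fin.cast h (Fin.castAdd (j + 1) k) =
      (Fin.cast h (Fin.natAdd r i)).succAbove (Fin.cast h' (Fin.castAdd j k)) := by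
    simp only [Fin.succAbove, Fin.ext_iff, Fin.lt_def]
    have := k.2
    split_ifs with h1 <;> simp_all
    omega
  simp [this]

theorem insertNth_natAdd_right {X : Type*} {r j m : ℕ} (h : r + (j + 1) = m + 1) (h' : r + j = m)
    (i : Fin (j + 1)) (b : X) (w : Fin m → X) :
    (fun k => ((Fin.cast h (Fin.natAdd r i)).insertNth b w : Fin (m + 1) → X)
      (Fin.cast h (Fin.natAdd r k))) =
      i.insertNth b (fun k => w (Fin.cast h' (Fin.natAdd r k))) := by
  rw [Fin.eq_insertNth_iff]
  refine ⟨by simp, ?_⟩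
  funext k
  have : Fin.cast h (Fin.natAdd r (i.succAbove k)) =
      (Fin.cast h (Fin.natAdd r i)).succAbove (Fin.cast h' (Fin.natAdd r k)) := by
    simp only [Fin.succAbove, Fin.ext_iff, Fin.lt_def]
    split_ifs with h1 h2 h2 <;> simp_all <;> omega
  simp [Fin.removeNth, this]

section
variable (e : ℕ) {X N : Type*} [AddCommGroup N]

theorem shuffleSum_cons_left {r j m : ℕ} (h : r + 1 + j = m + 1) (h' : r + j = m)
    (K : (Fin (r + 1) → X) → (Fin j → X) → N)
    (hK : ∀ (i : Fin (r + 1)) (b : X) u w,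
      K (i.insertNth b u) w = (((-1) ^ (i : ℕ)) ^ e : ℤˣ) • K (Fin.cons b u) w)
    (b : X) (v : Fin m → X) :
    ∑ x : Fin (r + 1), ∑ τ : Equiv.Perm (Fin m),
      (((-1) ^ ((Fin.cast h (Fin.castAdd j x) : Fin (m + 1)) : ℕ)) ^ e * Equiv.Perm.sign τ ^ e : ℤˣ) •
      K (fun i => ((Fin.cast h (Fin.castAdd j x)).insertNth b (fun y => v (τ y)) : Fin (m + 1) → X)
          (Fin.cast h (Fin.castAdd j i)))
        (fun i => ((Fin.cast h (Fin.castAdd j x)).insertNth b (fun y => v (τ y)) : Fin (m + 1) → X)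
          (Fin.cast h (Fin.natAdd (r + 1) i))) =
      (r + 1) • shuffleSum e h' (fun u w => K (Fin.cons b u) w) v := by
  have key : ∀ x : Fin (r + 1), ∑ τ : Equiv.Perm (Fin m),
      (((-1) ^ ((Fin.cast h (Fin.castAdd j x) : Fin (m + 1)) : ℕ)) ^ e * Equiv.Perm.sign τ ^ e : ℤˣ) •
      K (fun i => ((Fin.cast h (Fin.castAdd j x)).insertNth b (fun y => v (τ y)) : Fin (m + 1) → X)
          (Fin.cast h (Fin.castAdd j i)))
        (fun i => ((Fin.cast h (Fin.castAdd j x)).insertNth b (fun y => v (τ y)) : Fin (m + 1) → X)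
          (Fin.cast h (Fin.natAdd (r + 1) i))) =
      shuffleSum e h' (fun u w => K (Fin.cons b u) w) v := by
    intro x
    refine Finset.sum_congr rfl fun τ _ => ?_
    rw [insertNth_castAdd_left h h', insertNth_castAdd_right h h', hK, smul_smul]
    congr 1
    simp only [Fin.val_cast, Fin.val_castAdd]
    rw [mul_right_comm, ← mul_pow, Int.units_mul_self, one_pow, one_mul]
  rw [Finset.sum_congr rfl fun x _ => key x]
  simp

theorem shuffleSum_cons_right {r j m : ℕ} (h : r + (j + 1) = m + 1) (h' : r + j = m)
    (K : (Fin r → X) → (Fin (j + 1) → X) → N)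
    (hK : ∀ (i : Fin (j + 1)) (b : X) u w,
      K u (i.insertNth b w) = (((-1) ^ (i : ℕ)) ^ e : ℤˣ) • K u (Fin.cons b w))
    (b : X) (v : Fin m → X) :
    ∑ x : Fin (j + 1), ∑ τ : Equiv.Perm (Fin m),
      (((-1) ^ ((Fin.cast h (Fin.natAdd r x) : Fin (m + 1)) : ℕ)) ^ e * Equiv.Perm.sign τ ^ e : ℤˣ) •
      K (fun i => ((Fin.cast h (Fin.natAdd r x)).insertNth b (fun y => v (τ y)) : Fin (m + 1) → X)
          (Fin.cast h (Fin.castAdd (j + 1) i)))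
        (fun i => ((Fin.cast h (Fin.natAdd r x)).insertNth b (fun y => v (τ y)) : Fin (m + 1) → X)
          (Fin.cast h (Fin.natAdd r i))) =
      (j + 1) • (((-1) ^ r) ^ e : ℤˣ) • shuffleSum e h' (fun u w => K u (Fin.cons b w)) v := by
  have key : ∀ x : Fin (j + 1), ∑ τ : Equiv.Perm (Fin m),
      (((-1) ^ ((Fin.cast h (Fin.natAdd r x) : Fin (m + 1)) : ℕ)) ^ e * Equiv.Perm.sign τ ^ e : ℤˣ) •
      K (fun i => ((Fin.cast h (Fin.natAdd r x)).insertNth b (fun y => v (τ y)) : Fin (m + 1) → X)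
          (Fin.cast h (Fin.castAdd (j + 1) i)))
        (fun i => ((Fin.cast h (Fin.natAdd r x)).insertNth b (fun y => v (τ y)) : Fin (m + 1) → X)
          (Fin.cast h (Fin.natAdd r i))) =
      (((-1) ^ r) ^ e : ℤˣ) • shuffleSum e h' (fun u w => K u (Fin.cons b w)) v := by
    intro x
    rw [shuffleSum, Finset.smul_sum]
    refine Finset.sum_congr rfl fun τ _ => ?_
    rw [insertNth_natAdd_left h h', insertNth_natAdd_right h h', hK, smul_smul, smul_smul]
    congr 1
    simp only [Fin.val_cast, Fin.val_natAdd]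
    rw [pow_add, mul_pow, mul_right_comm, mul_assoc (((-1 : ℤˣ) ^ r) ^ e), ← mul_pow,
      Int.units_mul_self, one_pow, mul_one]
  rw [Finset.sum_congr rfl fun x _ => key x]
  simp

theorem sum_fin_cast {N : Type*} [AddCommMonoid N] {r j m : ℕ} (h : r + j = m) (F : Fin m → N) :
    ∑ x, F x = ∑ x : Fin r, F (Fin.cast h (Fin.castAdd j x)) +
      ∑ x : Fin j, F (Fin.cast h (Fin.natAdd r x)) := by
  subst h
  exact Fin.sum_univ_add F

theorem shuffleSum_cons_succ_succ {r j m : ℕ} (h : r + 1 + (j + 1) = m + 1)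
    (h₁ : r + (j + 1) = m) (h₂ : r + 1 + j = m) (K : (Fin (r + 1) → X) → (Fin (j + 1) → X) → N)
    (hK₁ : ∀ (i : Fin (r + 1)) (b : X) u w,
      K (i.insertNth b u) w = (((-1) ^ (i : ℕ)) ^ e : ℤˣ) • K (Fin.cons b u) w)
    (hK₂ : ∀ (i : Fin (j + 1)) (b : X) u w,
      K u (i.insertNth b w) = (((-1) ^ (i : ℕ)) ^ e : ℤˣ) • K u (Fin.cons b w))
    (b : X) (v : Fin m → X) :
    shuffleSum e h K (Fin.cons b v) = (r + 1) • shuffleSum e h₁ (fun u w => K (Fin.cons b u) w) v +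
      (j + 1) • (((-1) ^ (r + 1)) ^ e : ℤˣ) • shuffleSum e h₂ (fun u w => K u (Fin.cons b w)) v := by
  rw [shuffleSum_cons, sum_fin_cast h, shuffleSum_cons_left e h h₁ K hK₁,
    shuffleSum_cons_right e h h₂ K hK₂]

theorem shuffleSum_cons_succ_zero {r m : ℕ} (h : r + 1 + 0 = m + 1)
    (h₁ : r + 0 = m) (K : (Fin (r + 1) → X) → (Fin 0 → X) → N)
    (hK₁ : ∀ (i : Fin (r + 1)) (b : X) u w,
      K (i.insertNth b u) w = (((-1) ^ (i : ℕ)) ^ e : ℤˣ) • K (Fin.cons b u) w)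
    (b : X) (v : Fin m → X) :
    shuffleSum e h K (Fin.cons b v) =
      (r + 1) • shuffleSum e h₁ (fun u w => K (Fin.cons b u) w) v := by
  rw [shuffleSum_cons, sum_fin_cast h, shuffleSum_cons_left e h h₁ K hK₁, Finset.univ_eq_empty,
    Finset.sum_empty, add_zero]

theorem shuffleSum_cons_zero_succ {j m : ℕ} (h : 0 + (j + 1) = m + 1) (h₂ : 0 + j = m)
    (K : (Fin 0 → X) → (Fin (j + 1) → X) → N)
    (hK₂ : ∀ (i : Fin (j + 1)) (b : X) u w,
      K u (i.insertNth b w) = (((-1) ^ (i : ℕ)) ^ e : ℤˣ) • K u (Fin.cons b w))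
    (b : X) (v : Fin m → X) :
    shuffleSum e h K (Fin.cons b v) =
      (j + 1) • shuffleSum e h₂ (fun u w => K u (Fin.cons b w)) v := by
  rw [shuffleSum_cons, sum_fin_cast h, shuffleSum_cons_right e h h₂ K hK₂, Finset.univ_eq_empty,
    Finset.sum_empty, zero_add, pow_zero, one_pow, one_smul]

end

/-! ### The wedge product and contractions -/

section
variable {R L : Type*} [CommRing R] [Algebra ℚ R] [AddCommGroup L] [Module R L]

theorem eq_of_nsmul_eq {N : Type*} [AddCommGroup N] (R : Type*) [CommRing R] [Algebra ℚ R]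
    [Module R N] {n : ℕ} (hn : n ≠ 0) {x y : N} (h : n • x = n • y) : x = y := by
  have key : ∀ z : N, algebraMap ℚ R ((n : ℚ)⁻¹) • n • z = z := by
    intro z
    rw [← Nat.cast_smul_eq_nsmul R, smul_smul, ← map_natCast (algebraMap ℚ R), ← map_mul,
      inv_mul_cancel₀ (by exact_mod_cast hn), map_one, one_smul]
  rw [← key x, h, key y]

variable {N₁ N₂ N₃ : Type*} [AddCommGroup N₁] [Module R N₁] [AddCommGroup N₂] [Module R N₂]
  [AddCommGroup N₃] [Module R N₃]

omit [Algebra ℚ R] in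
theorem nsmul_wedge_apply (β : N₁ →ₗ[R] N₂ →ₗ[R] N₃) {p p' n : ℕ} (h : p + p' = n)
    (a : L [⋀^Fin p]→ₗ[R] N₁) (b : L [⋀^Fin p']→ₗ[R] N₂) (l : Fin n → L) :
    (p.factorial * p'.factorial) • wedge β h a b l =
      shuffleSum 1 h (fun u w => β (a u) (b w)) l := by
  have h1 := congrArg (fun F => (TensorProduct.lift β) (F (fun i => l
    ((finSumFinEquiv.trans (finCongr h)) i)))) (MultilinearMap.domCoprod_alternization_eq a b)
  simp only [Fintype.card_fin, AlternatingMap.smul_apply, map_nsmul] at h1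
  rw [wedge, AlternatingMap.domDomCongr_apply, LinearMap.compAlternatingMap_apply]
  refine h1.symm.trans ?_
  rw [MultilinearMap.alternatization_apply, map_sum, shuffleSum]
  refine Fintype.sum_equiv ((finSumFinEquiv.trans (finCongr h)).permCongr) _ _ fun σ => ?_
  rw [Equiv.Perm.sign_permCongr, pow_one, Units.smul_def, Units.smul_def, map_zsmul]
  congr 1
  simp [MultilinearMap.domCoprod_apply, Equiv.permCongr_apply, finSumFinEquiv_symm_apply_castAdd]

omit [Algebra ℚ R] in
theorem wedge_apply_zero (β : N₁ →ₗ[R] N₂ →ₗ[R] N₃) (h : 0 + 0 = 0)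
    (a : L [⋀^Fin 0]→ₗ[R] N₁) (b : L [⋀^Fin 0]→ₗ[R] N₂) (l l' l'' : Fin 0 → L) :
    wedge β h a b l = β (a l') (b l'') := by
  have := nsmul_wedge_apply β h a b l
  simp only [shuffleSum, Fintype.sum_unique, Nat.factorial_zero, mul_one, one_smul] at this
  rw [this, Subsingleton.elim l' (fun i => i.elim0), Subsingleton.elim l'' (fun i => i.elim0)]
  simp [Subsingleton.elim _ (fun i : Fin 0 => (i.elim0 : L))]

omit [Algebra ℚ R] in
theorem alternating_insertNth {N : Type*} [AddCommGroup N] [Module R N] {p : ℕ}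
    (a : L [⋀^Fin (p + 1)]→ₗ[R] N) (i : Fin (p + 1)) (x : L) (u : Fin p → L) :
    a (i.insertNth x u) = (((-1) ^ (i : ℕ)) ^ 1 : ℤˣ) • a (Fin.cons x u) := by
  rw [AlternatingMap.map_insertNth, pow_one, Units.smul_def]
  simp [Matrix.vecCons]

theorem wedge_curryLeft_succ_succ (β : N₁ →ₗ[R] N₂ →ₗ[R] N₃) {p p' n : ℕ}
    (h : p + 1 + (p' + 1) = n + 1) (h₁ : p + (p' + 1) = n) (h₂ : p + 1 + p' = n)
    (a : L [⋀^Fin (p + 1)]→ₗ[R] N₁) (b : L [⋀^Fin (p' + 1)]→ₗ[R] N₂) (x : L) :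
    (wedge β h a b).curryLeft x = wedge β h₁ (a.curryLeft x) b +
      (-1 : R) ^ (p + 1) • wedge β h₂ a (b.curryLeft x) := by
  refine AlternatingMap.ext fun v => eq_of_nsmul_eq R
    (mul_ne_zero (p + 1).factorial_ne_zero (p' + 1).factorial_ne_zero) ?_
  rw [AlternatingMap.curryLeft_apply_apply, nsmul_wedge_apply]
  change shuffleSum 1 h _ (Fin.cons x v) = _
  rw [shuffleSum_cons_succ_succ 1 h h₁ h₂]
  · rw [AlternatingMap.add_apply, smul_add]
    congr 1
    · rw [Nat.factorial_succ p, mul_assoc, mul_smul, nsmul_wedge_apply]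
      rfl
    · rw [Nat.factorial_succ p', mul_left_comm, mul_smul, AlternatingMap.smul_apply,
        smul_comm _ ((-1 : R) ^ (p + 1)), nsmul_wedge_apply, pow_one, Units.smul_def]
      congr 1
      rw [← Int.cast_smul_eq_zsmul R]
      push_cast
      rfl
  · intro i y u w
    rw [alternating_insertNth, Units.smul_def, Units.smul_def, map_zsmul, LinearMap.smul_apply]
  · intro i y u w
    rw [alternating_insertNth, Units.smul_def, Units.smul_def, map_zsmul]

theorem wedge_curryLeft_succ_zero (β : N₁ →ₗ[R] N₂ →ₗ[R] N₃) {p n : ℕ}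
    (h : p + 1 + 0 = n + 1) (h₁ : p + 0 = n)
    (a : L [⋀^Fin (p + 1)]→ₗ[R] N₁) (b : L [⋀^Fin 0]→ₗ[R] N₂) (x : L) :
    (wedge β h a b).curryLeft x = wedge β h₁ (a.curryLeft x) b := by
  refine AlternatingMap.ext fun v => eq_of_nsmul_eq R
    (mul_ne_zero (p + 1).factorial_ne_zero (0).factorial_ne_zero) ?_
  rw [AlternatingMap.curryLeft_apply_apply, nsmul_wedge_apply]
  change shuffleSum 1 h _ (Fin.cons x v) = _
  rw [shuffleSum_cons_succ_zero 1 h h₁]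
  · rw [Nat.factorial_succ p, mul_assoc, mul_smul, nsmul_wedge_apply]
    rfl
  · intro i y u w
    rw [alternating_insertNth, Units.smul_def, Units.smul_def, map_zsmul, LinearMap.smul_apply]

theorem wedge_curryLeft_zero_succ (β : N₁ →ₗ[R] N₂ →ₗ[R] N₃) {p' n : ℕ}
    (h : 0 + (p' + 1) = n + 1) (h₂ : 0 + p' = n)
    (a : L [⋀^Fin 0]→ₗ[R] N₁) (b : L [⋀^Fin (p' + 1)]→ₗ[R] N₂) (x : L) :
    (wedge β h a b).curryLeft x = wedge β h₂ a (b.curryLeft x) := by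
  refine AlternatingMap.ext fun v => eq_of_nsmul_eq R
    (mul_ne_zero (0).factorial_ne_zero (p' + 1).factorial_ne_zero) ?_
  rw [AlternatingMap.curryLeft_apply_apply, nsmul_wedge_apply]
  change shuffleSum 1 h _ (Fin.cons x v) = _
  rw [shuffleSum_cons_zero_succ 1 h h₂]
  · rw [Nat.factorial_succ p', mul_left_comm, mul_smul, nsmul_wedge_apply]
    rfl
  · intro i y u w
    rw [alternating_insertNth, Units.smul_def, Units.smul_def, map_zsmul]

theorem compAlternatingMap_wedge {N₄ : Type*} [AddCommGroup N₄] [Module R N₄]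
    (T : N₃ →ₗ[R] N₄) (β : N₁ →ₗ[R] N₂ →ₗ[R] N₃) {p p' n : ℕ} (h : p + p' = n)
    (a : L [⋀^Fin p]→ₗ[R] N₁) (b : L [⋀^Fin p']→ₗ[R] N₂) :
    T.compAlternatingMap (wedge β h a b) = wedge (β.compr₂ T) h a b := by
  refine AlternatingMap.ext fun v => eq_of_nsmul_eq R
    (mul_ne_zero p.factorial_ne_zero p'.factorial_ne_zero) ?_
  rw [nsmul_wedge_apply, LinearMap.compAlternatingMap_apply, ← map_nsmul, nsmul_wedge_apply,
    shuffleSum, shuffleSum, map_sum]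
  refine Finset.sum_congr rfl fun σ _ => ?_
  rw [Units.smul_def, Units.smul_def, map_zsmul]
  rfl

theorem wedge_add_bilin (β β' : N₁ →ₗ[R] N₂ →ₗ[R] N₃) {p p' n : ℕ} (h : p + p' = n)
    (a : L [⋀^Fin p]→ₗ[R] N₁) (b : L [⋀^Fin p']→ₗ[R] N₂) :
    wedge (β + β') h a b = wedge β h a b + wedge β' h a b := by
  refine AlternatingMap.ext fun v => eq_of_nsmul_eq R
    (mul_ne_zero p.factorial_ne_zero p'.factorial_ne_zero) ?_
  rw [AlternatingMap.add_apply, smul_add]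
  simp only [nsmul_wedge_apply, shuffleSum, ← Finset.sum_add_distrib, ← smul_add]
  rfl

theorem wedge_comp {N₁' N₂' : Type*} [AddCommGroup N₁'] [Module R N₁'] [AddCommGroup N₂']
    [Module R N₂'] (β : N₁ →ₗ[R] N₂ →ₗ[R] N₃) (S : N₁' →ₗ[R] N₁) (T : N₂' →ₗ[R] N₂) {p p' n : ℕ}
    (h : p + p' = n) (a : L [⋀^Fin p]→ₗ[R] N₁') (b : L [⋀^Fin p']→ₗ[R] N₂') :
    wedge β h (S.compAlternatingMap a) (T.compAlternatingMap b) = wedge (β.compl₁₂ S T) h a b := by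
  refine AlternatingMap.ext fun v => eq_of_nsmul_eq R
    (mul_ne_zero p.factorial_ne_zero p'.factorial_ne_zero) ?_
  rw [nsmul_wedge_apply, nsmul_wedge_apply]
  rfl

section
variable (β : N₁ →ₗ[R] N₂ →ₗ[R] N₃) {p p' n : ℕ} (h : p + p' = n)

theorem wedge_add_left (a a' : L [⋀^Fin p]→ₗ[R] N₁) (b : L [⋀^Fin p']→ₗ[R] N₂) :
    wedge β h (a + a') b = wedge β h a b + wedge β h a' b := by
  refine AlternatingMap.ext fun v => eq_of_nsmul_eq R
    (mul_ne_zero p.factorial_ne_zero p'.factorial_ne_zero) ?_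
  rw [AlternatingMap.add_apply, smul_add]
  simp only [nsmul_wedge_apply, shuffleSum, ← Finset.sum_add_distrib, ← smul_add]
  simp

theorem wedge_smul_left (c : R) (a : L [⋀^Fin p]→ₗ[R] N₁) (b : L [⋀^Fin p']→ₗ[R] N₂) :
    wedge β h (c • a) b = c • wedge β h a b := by
  refine AlternatingMap.ext fun v => eq_of_nsmul_eq R
    (mul_ne_zero p.factorial_ne_zero p'.factorial_ne_zero) ?_
  rw [AlternatingMap.smul_apply, smul_comm _ c]
  simp only [nsmul_wedge_apply, shuffleSum, Finset.smul_sum]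
  simp [smul_comm c]

theorem wedge_add_right (a : L [⋀^Fin p]→ₗ[R] N₁) (b b' : L [⋀^Fin p']→ₗ[R] N₂) :
    wedge β h a (b + b') = wedge β h a b + wedge β h a b' := by
  refine AlternatingMap.ext fun v => eq_of_nsmul_eq R
    (mul_ne_zero p.factorial_ne_zero p'.factorial_ne_zero) ?_
  rw [AlternatingMap.add_apply, smul_add]
  simp only [nsmul_wedge_apply, shuffleSum, ← Finset.sum_add_distrib, ← smul_add]
  simp

theorem wedge_smul_right (c : R) (a : L [⋀^Fin p]→ₗ[R] N₁) (b : L [⋀^Fin p']→ₗ[R] N₂) :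
    wedge β h a (c • b) = c • wedge β h a b := by
  refine AlternatingMap.ext fun v => eq_of_nsmul_eq R
    (mul_ne_zero p.factorial_ne_zero p'.factorial_ne_zero) ?_
  rw [AlternatingMap.smul_apply, smul_comm _ c]
  simp only [nsmul_wedge_apply, shuffleSum, Finset.smul_sum]
  simp [smul_comm c]

theorem wedge_zero_left (b : L [⋀^Fin p']→ₗ[R] N₂) :
    wedge β h (0 : L [⋀^Fin p]→ₗ[R] N₁) b = 0 := by
  have := wedge_smul_left β h (0 : R) (0 : L [⋀^Fin p]→ₗ[R] N₁) b
  rwa [zero_smul, zero_smul] at this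

theorem wedge_zero_right (a : L [⋀^Fin p]→ₗ[R] N₁) :
    wedge β h a (0 : L [⋀^Fin p']→ₗ[R] N₂) = 0 := by
  have := wedge_smul_right β h (0 : R) a (0 : L [⋀^Fin p']→ₗ[R] N₂)
  rwa [zero_smul, zero_smul] at this

end

end

section
variable {R B : Type*} [CommRing R] [Algebra ℚ R] [AddCommGroup B] [Module R B]

omit [Algebra ℚ R] in
theorem symmetrize_apply {m : ℕ} (f : MultilinearMap R (fun _ : Fin m => B) R) (v : Fin m → B) :
    symmetrize m f v = ∑ σ : Equiv.Perm (Fin m), f (fun i => v (σ i)) := by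
  change (∑ σ : Equiv.Perm (Fin m), f.domDomCongr σ) v = _
  rw [_root_.sum_apply]
  rfl

theorem nsmul_symProd_apply {r j m : ℕ} (h : r + j = m)
    (G : MultilinearMap R (fun _ : Fin r => B) (SymForm R B j)) (v : Fin m → B) :
    (r.factorial * j.factorial) • symProd h G v = shuffleSum 0 h (fun u w => G u w) v := by
  have h0 : ((r.factorial * j.factorial : ℕ) : ℚ) ≠ 0 := by
    exact_mod_cast mul_ne_zero r.factorial_ne_zero j.factorial_ne_zero
  have h1 : symProd h G v = algebraMap ℚ R ((r.factorial * j.factorial : ℕ) : ℚ)⁻¹ *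
    symmetrize m (((SymForm.toMulti.compMultilinearMap G).uncurrySum).domDomCongr
      (finSumFinEquiv.trans (finCongr h))) v := rfl
  rw [h1, nsmul_eq_mul, ← mul_assoc, ← map_natCast (algebraMap ℚ R), ← map_mul,
    mul_inv_cancel₀ h0, map_one, one_mul, symmetrize_apply]
  simp only [shuffleSum, pow_zero, one_smul]
  rfl

theorem symProd_zero_zero (h : 0 + 0 = 0)
    (G : MultilinearMap R (fun _ : Fin 0 => B) (SymForm R B 0)) (v v' v'' : Fin 0 → B) :
    symProd h G v = G v' v'' := by
  have := nsmul_symProd_apply h G v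
  simp only [shuffleSum, Fintype.sum_unique, Nat.factorial_zero, mul_one, one_smul, pow_zero] at this
  rw [this, Subsingleton.elim v' (fun i => i.elim0), Subsingleton.elim v'' (fun i => i.elim0)]
  simp [Subsingleton.elim _ (fun i : Fin 0 => (i.elim0 : B))]

omit [Algebra ℚ R] in
@[simp] theorem insertB_apply (k : ℕ) (b : B) (f : SymForm R B (k + 1)) (v : Fin k → B) :
    insertB k b f v = f (Fin.cons b v) := rfl

omit [Algebra ℚ R] in
theorem SymForm.insertNth {k : ℕ} (f : SymForm R B (k + 1)) (i : Fin (k + 1)) (b : B)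
    (v : Fin k → B) : f (i.insertNth b v) = f (Fin.cons b v) := by
  rw [← Fin.cons_comp_cycleRange]
  exact f.symm _ _

/-- Symmetry of a multilinear map with values in an arbitrary module. -/
def IsSymm {N : Type*} [AddCommGroup N] [Module R N] {r : ℕ}
    (G : MultilinearMap R (fun _ : Fin r => B) N) : Prop :=
  ∀ (σ : Equiv.Perm (Fin r)) (v : Fin r → B), G (fun i => v (σ i)) = G v

omit [Algebra ℚ R] in
theorem IsSymm.insertNth {N : Type*} [AddCommGroup N] [Module R N] {k : ℕ}
    {G : MultilinearMap R (fun _ : Fin (k + 1) => B) N} (hG : IsSymm G) (i : Fin (k + 1)) (b : B)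
    (v : Fin k → B) : G (i.insertNth b v) = G (Fin.cons b v) := by
  rw [← Fin.cons_comp_cycleRange]
  exact hG _ _

theorem insertB_symProd_succ_succ {r j m : ℕ} (h : r + 1 + (j + 1) = m + 1)
    (h₁ : r + (j + 1) = m) (h₂ : r + 1 + j = m)
    {G : MultilinearMap R (fun _ : Fin (r + 1) => B) (SymForm R B (j + 1))} (hG : IsSymm G) (b : B) :
    insertB m b (symProd h G) = symProd h₁ (G.curryLeft b) +
      symProd h₂ ((insertB j b).compMultilinearMap G) := by
  refine SymForm.ext fun v => eq_of_nsmul_eq R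
    (mul_ne_zero (r + 1).factorial_ne_zero (j + 1).factorial_ne_zero) ?_
  rw [insertB_apply, nsmul_symProd_apply, shuffleSum_cons_succ_succ 0 h h₁ h₂, map_add, _root_.add_apply, smul_add]
  · congr 1
    · rw [Nat.factorial_succ r, mul_assoc, mul_smul, nsmul_symProd_apply]
      rfl
    · rw [Nat.factorial_succ j, mul_left_comm, mul_smul, nsmul_symProd_apply, pow_zero, one_smul]
      rfl
  · intro i y u w
    rw [hG.insertNth, pow_zero, one_smul]
  · intro i y u w
    rw [SymForm.insertNth, pow_zero, one_smul]

theorem insertB_symProd_succ_zero {r m : ℕ} (h : r + 1 + 0 = m + 1) (h₁ : r + 0 = m)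
    {G : MultilinearMap R (fun _ : Fin (r + 1) => B) (SymForm R B 0)} (hG : IsSymm G) (b : B) :
    insertB m b (symProd h G) = symProd h₁ (G.curryLeft b) := by
  refine SymForm.ext fun v => eq_of_nsmul_eq R
    (mul_ne_zero (r + 1).factorial_ne_zero (0).factorial_ne_zero) ?_
  rw [insertB_apply, nsmul_symProd_apply, shuffleSum_cons_succ_zero 0 h h₁]
  · rw [Nat.factorial_succ r, mul_assoc, mul_smul, nsmul_symProd_apply]
    rfl
  · intro i y u w
    rw [hG.insertNth, pow_zero, one_smul]

theorem insertB_symProd_zero_succ {j m : ℕ} (h : 0 + (j + 1) = m + 1) (h₂ : 0 + j = m)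
    (G : MultilinearMap R (fun _ : Fin 0 => B) (SymForm R B (j + 1))) (b : B) :
    insertB m b (symProd h G) = symProd h₂ ((insertB j b).compMultilinearMap G) := by
  refine SymForm.ext fun v => eq_of_nsmul_eq R
    (mul_ne_zero (0).factorial_ne_zero (j + 1).factorial_ne_zero) ?_
  rw [insertB_apply, nsmul_symProd_apply, shuffleSum_cons_zero_succ 0 h h₂]
  · rw [Nat.factorial_succ j, mul_left_comm, mul_smul, nsmul_symProd_apply]
    rfl
  · intro i y u w
    rw [SymForm.insertNth, pow_zero, one_smul]

end

end
end Fedosov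

namespace Fedosov
noncomputable section

/-! ### Contractions and the coinduction principle -/

section
variable {R L B : Type*} [CommRing R] [AddCommGroup L] [Module R L] [AddCommGroup B] [Module R B]

/-- The contraction of the arguments from `L` with `l`. -/
def iL (l : L) : FormalFun R L B →ₗ[R] FormalFun R L B where
  toFun f := fun p k => (f (p + 1) k).curryLeft l
  map_add' _ _ := rfl
  map_smul' _ _ := rfl

/-- The contraction of the arguments from `B` with `b`, the partial derivative in the direction
of `b`. -/
def iB (b : B) : FormalFun R L B →ₗ[R] FormalFun R L B where
  toFun f := fun p k => (insertB k b).compAlternatingMap (f p (k + 1))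
  map_add' f g := by
    funext p k
    ext v
    simp
  map_smul' c f := by
    funext p k
    ext v
    simp

/-- The component in `Λ^0 L^∨ ⊗ S^0 B^∨ = R`. -/
def c0 : FormalFun R L B →ₗ[R] R where
  toFun f := f 0 0 ![] ![]
  map_add' _ _ := rfl
  map_smul' _ _ := rfl

theorem iL_apply (l : L) (f : FormalFun R L B) (p k : ℕ) (v : Fin p → L) :
    iL l f p k v = f (p + 1) k (Fin.cons l v) := rfl

theorem iB_apply (b : B) (f : FormalFun R L B) (p k : ℕ) (v : Fin p → L) (w : Fin k → B) :
    iB b f p k v w = f p (k + 1) v (Fin.cons b w) := rfl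

theorem c0_apply (f : FormalFun R L B) : c0 f = f 0 0 ![] ![] := rfl

theorem formalFun_ext {f g : FormalFun R L B} (h : ∀ p k v w, f p k v w = g p k v w) : f = g :=
  funext fun p => funext fun k => AlternatingMap.ext fun v => SymForm.ext fun w => h p k v w

/-- A set of functions without constant terms which is stable under all contractions, up to linear
combinations, contains only `0`. Identities between operators on the function algebra follow from
this principle and from the commutation relations of the operators with the contractions. -/
theorem eq_zero_of_contractions (S : Set (FormalFun R L B)) (h0 : ∀ x ∈ S, c0 x = 0)
    (hL : ∀ x ∈ S, ∀ l, iL l x ∈ Submodule.span R S)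
    (hB : ∀ x ∈ S, ∀ b, iB b x ∈ Submodule.span R S) : ∀ x ∈ S, x = 0 := by
  have h0' : ∀ x ∈ Submodule.span R S, c0 x = 0 := fun x hx =>
    (Submodule.span_le (p := LinearMap.ker (c0 : FormalFun R L B →ₗ[R] R))).2 h0 hx
  have hL' : ∀ l, ∀ x ∈ Submodule.span R S, iL l x ∈ Submodule.span R S := fun l x hx =>
    (Submodule.span_le (p := (Submodule.span R S).comap (iL l))).2 (fun x hx => hL x hx l) hx
  have hB' : ∀ b, ∀ x ∈ Submodule.span R S, iB b x ∈ Submodule.span R S := fun b x hx =>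
    (Submodule.span_le (p := (Submodule.span R S).comap (iB b))).2 (fun x hx => hB x hx b) hx
  have key : ∀ (p k : ℕ), ∀ x ∈ Submodule.span R S, ∀ v w, x p k v w = 0 := by
    intro p
    induction p with
    | zero =>
      intro k
      induction k with
      | zero =>
        intro x hx v w
        rw [Subsingleton.elim v ![], Subsingleton.elim w ![]]
        exact h0' x hx
      | succ k ih =>
        intro x hx v w
        rw [← Fin.cons_self_tail w, ← iB_apply]
        exact ih _ (hB' _ x hx) _ _
    | succ p ih =>
      intro k x hx v w
      rw [← Fin.cons_self_tail v, ← iL_apply]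
      exact ih k _ (hL' _ x hx) _ _
  intro x hx
  exact formalFun_ext fun p k v w => key p k x (Submodule.subset_span hx) v w

end

/-! ### Sums over antidiagonals -/

section
variable {N : Type*} [AddCommGroup N]

/-- The sum over all decompositions `n = p + p'`. -/
def adSum (n : ℕ) (Φ : ∀ p p' : ℕ, p + p' = n → N) : N :=
  ∑ x : Finset.HasAntidiagonal.antidiagonal n,
    Φ x.1.1 x.1.2 (Finset.HasAntidiagonal.mem_antidiagonal.1 x.2)

theorem adSum_eq (n : ℕ) (Φ : ∀ p p' : ℕ, p + p' = n → N) :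
    adSum n Φ = ∑ x ∈ Finset.HasAntidiagonal.antidiagonal n,
      if h : x.1 + x.2 = n then Φ x.1 x.2 h else 0 := by
  rw [← Finset.sum_coe_sort (Finset.HasAntidiagonal.antidiagonal n)]
  refine Finset.sum_congr rfl fun x _ => ?_
  rw [dif_pos (Finset.HasAntidiagonal.mem_antidiagonal.1 x.2)]

theorem adSum_congr {n : ℕ} {Φ Φ' : ∀ p p' : ℕ, p + p' = n → N}
    (h : ∀ p p' hp, Φ p p' hp = Φ' p p' hp) : adSum n Φ = adSum n Φ' :=
  Finset.sum_congr rfl fun _ _ => h _ _ _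

theorem adSum_add (n : ℕ) (Φ Φ' : ∀ p p' : ℕ, p + p' = n → N) :
    adSum n (fun p p' h => Φ p p' h + Φ' p p' h) = adSum n Φ + adSum n Φ' :=
  Finset.sum_add_distrib

theorem map_adSum {N' F : Type*} [AddCommGroup N'] [FunLike F N N'] [AddMonoidHomClass F N N']
    (T : F) (n : ℕ) (Φ : ∀ p p' : ℕ, p + p' = n → N) :
    T (adSum n Φ) = adSum n fun p p' h => T (Φ p p' h) :=
  map_sum T _ _

theorem smul_adSum {R : Type*} [CommRing R] [Module R N] (c : R) (n : ℕ)
    (Φ : ∀ p p' : ℕ, p + p' = n → N) : c • adSum n Φ = adSum n fun p p' h => c • Φ p p' h :=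
  Finset.smul_sum

theorem adSum_comm (n m : ℕ) (Φ : ∀ p p' : ℕ, p + p' = n → ∀ k k' : ℕ, k + k' = m → N) :
    adSum n (fun p p' h => adSum m (fun k k' h' => Φ p p' h k k' h')) =
      adSum m (fun k k' h' => adSum n (fun p p' h => Φ p p' h k k' h')) :=
  Finset.sum_comm

theorem adSum_eq_zero {n : ℕ} {Φ : ∀ p p' : ℕ, p + p' = n → N}
    (h : ∀ p p' hp, Φ p p' hp = 0) : adSum n Φ = 0 :=
  Finset.sum_eq_zero fun _ _ => h _ _ _

theorem adSum_zero (Φ : ∀ p p' : ℕ, p + p' = 0 → N) : adSum 0 Φ = Φ 0 0 rfl := by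
  rw [adSum_eq, Finset.Nat.antidiagonal_zero, Finset.sum_singleton]
  exact dif_pos rfl

theorem adSum_succ {n : ℕ} (Φ : ∀ p p' : ℕ, p + p' = n + 1 → N) (A B : ∀ p p' : ℕ, p + p' = n → N)
    (hss : ∀ p p' (h : p + 1 + (p' + 1) = n + 1) (h₁ : p + (p' + 1) = n) (h₂ : p + 1 + p' = n),
      Φ (p + 1) (p' + 1) h = A p (p' + 1) h₁ + B (p + 1) p' h₂)
    (hsz : ∀ p (h : p + 1 + 0 = n + 1) (h₁ : p + 0 = n), Φ (p + 1) 0 h = A p 0 h₁)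
    (hzs : ∀ p' (h : 0 + (p' + 1) = n + 1) (h₂ : 0 + p' = n), Φ 0 (p' + 1) h = B 0 p' h₂) :
    adSum (n + 1) Φ = adSum n A + adSum n B := by
  rw [adSum_eq, adSum_eq, adSum_eq]
  let A' : ℕ × ℕ → N := fun x => if x.1 = 0 then 0 else
    if h : (x.1 - 1) + x.2 = n then A (x.1 - 1) x.2 h else 0
  let B' : ℕ × ℕ → N := fun x => if x.2 = 0 then 0 else
    if h : x.1 + (x.2 - 1) = n then B x.1 (x.2 - 1) h else 0
  have h1 : ∀ x ∈ Finset.HasAntidiagonal.antidiagonal (n + 1),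
      (if h : x.1 + x.2 = n + 1 then Φ x.1 x.2 h else 0) = A' x + B' x := by
    rintro ⟨p, p'⟩ hx
    rw [Finset.HasAntidiagonal.mem_antidiagonal] at hx
    dsimp only at hx
    rw [dif_pos hx]
    rcases p with _ | p <;> rcases p' with _ | p'
    · omega
    · have h2 : 0 + p' = n := by omega
      simp only [A', B', if_true, zero_add, Nat.add_sub_cancel, Nat.succ_ne_zero, if_false]
      rw [dif_pos (by omega), hzs p' hx h2]
    · have h2 : p + 0 = n := by omega
      simp only [A', B', if_true, add_zero, Nat.add_sub_cancel, Nat.succ_ne_zero, if_false]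
      rw [dif_pos (by omega), hsz p hx h2]
    · simp only [A', B', Nat.add_sub_cancel, Nat.succ_ne_zero, if_false]
      rw [dif_pos (by omega), dif_pos (by omega), hss p p' hx (by omega) (by omega)]
  rw [Finset.sum_congr rfl h1, Finset.sum_add_distrib, Finset.Nat.sum_antidiagonal_succ,
    Finset.Nat.sum_antidiagonal_succ']
  simp [A', B']

end

/-! ### The product of the function algebra -/

section
variable {R L B : Type*} [CommRing R] [Algebra ℚ R] [AddCommGroup L] [Module R L] [AddCommGroup B]
  [Module R B]

section
variable {N₁ N₂ N₃ : Type*} [AddCommGroup N₁] [Module R N₁] [AddCommGroup N₂] [Module R N₂]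
  [AddCommGroup N₃] [Module R N₃]

omit [Algebra ℚ R] in
theorem curryLeft_adSum {n m : ℕ} (Φ : ∀ p p' : ℕ, p + p' = m → L [⋀^Fin (n + 1)]→ₗ[R] N₃) (x : L) :
    (adSum m Φ).curryLeft x = adSum m fun p p' h => (Φ p p' h).curryLeft x :=
  map_adSum ({ toFun := fun a => a.curryLeft x, map_zero' := rfl, map_add' := fun _ _ => rfl } :
    (L [⋀^Fin (n + 1)]→ₗ[R] N₃) →+ (L [⋀^Fin n]→ₗ[R] N₃)) m Φ

omit [Algebra ℚ R] in
theorem compAlternatingMap_adSum {n m : ℕ} (T : N₂ →ₗ[R] N₃)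
    (Φ : ∀ p p' : ℕ, p + p' = m → L [⋀^Fin n]→ₗ[R] N₂) :
    T.compAlternatingMap (adSum m Φ) = adSum m fun p p' h => T.compAlternatingMap (Φ p p' h) :=
  map_adSum ({ toFun := fun a => T.compAlternatingMap a
               map_zero' := by ext; simp
               map_add' := fun _ _ => by ext; simp } :
    (L [⋀^Fin n]→ₗ[R] N₂) →+ (L [⋀^Fin n]→ₗ[R] N₃)) m Φ

/-- The component of degree `n` of the wedge product of two families of forms. -/
def wedgeSum (β : N₁ →ₗ[R] N₂ →ₗ[R] N₃) (a : ∀ p, L [⋀^Fin p]→ₗ[R] N₁)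
    (b : ∀ p, L [⋀^Fin p]→ₗ[R] N₂) (n : ℕ) : L [⋀^Fin n]→ₗ[R] N₃ :=
  adSum n fun p p' h => wedge β h (a p) (b p')

theorem curryLeft_wedgeSum (β : N₁ →ₗ[R] N₂ →ₗ[R] N₃) (a : ∀ p, L [⋀^Fin p]→ₗ[R] N₁)
    (b : ∀ p, L [⋀^Fin p]→ₗ[R] N₂) (n : ℕ) (x : L) :
    (wedgeSum β a b (n + 1)).curryLeft x =
      wedgeSum β (fun p => (a (p + 1)).curryLeft x) b n +
      wedgeSum β (fun p => (-1 : R) ^ p • a p) (fun p => (b (p + 1)).curryLeft x) n := by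
  rw [wedgeSum, curryLeft_adSum]
  refine adSum_succ _ _ _ ?_ ?_ ?_
  · intro p p' h h₁ h₂
    rw [wedge_curryLeft_succ_succ β h h₁ h₂, wedge_smul_left]
  · intro p h h₁
    rw [wedge_curryLeft_succ_zero β h h₁]
  · intro p h h₁
    rw [wedge_curryLeft_zero_succ β h h₁, wedge_smul_left, pow_zero, one_smul]

end

theorem mul_eq (f g : FormalFun R L B) (n m : ℕ) : mul f g n m = adSum n fun p p' hp =>
    adSum m fun j j' hj => wedge (symMul hj) hp (f p j) (g p' j') := rfl

theorem mul_eq_wedgeSum (f g : FormalFun R L B) (n m : ℕ) : mul f g n m = adSum m fun j j' hj =>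
    wedgeSum (symMul hj) (fun p => f p j) (fun p => g p j') n := by
  rw [mul_eq, adSum_comm]
  rfl

omit [Algebra ℚ R] in
theorem parity_apply (f : FormalFun R L B) (p k : ℕ) : parity f p k = (-1 : R) ^ p • f p k := rfl

theorem iL_mul (l : L) (f g : FormalFun R L B) :
    iL l (mul f g) = mul (iL l f) g + mul (parity f) (iL l g) := by
  funext n m
  change (mul f g (n + 1) m).curryLeft l = mul (iL l f) g n m + mul (parity f) (iL l g) n m
  rw [mul_eq_wedgeSum, mul_eq_wedgeSum, mul_eq_wedgeSum, ← adSum_add]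
  rw [curryLeft_adSum]
  refine adSum_congr fun j j' hj => ?_
  exact curryLeft_wedgeSum _ _ _ _ _

theorem symMul_insertB_succ_succ {r j m : ℕ} (h : r + 1 + (j + 1) = m + 1)
    (h₁ : r + (j + 1) = m) (h₂ : r + 1 + j = m) (b : B) :
    (symMul (R := R) h).compr₂ (insertB m b) =
      (symMul h₁).compl₁₂ (insertB r b) LinearMap.id +
      (symMul h₂).compl₁₂ LinearMap.id (insertB j b) := by
  refine LinearMap.ext₂ fun f g => ?_
  refine (insertB_symProd_succ_succ h h₁ h₂ (G := (SymForm.toMulti f).smulRight g) ?_ b).trans ?_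
  · intro σ v
    simp only [MultilinearMap.smulRight_apply]
    rw [f.symm]
  · refine congrArg₂ (· + ·) rfl (congrArg (symProd h₂) ?_)
    refine MultilinearMap.ext fun v => ?_
    simp

theorem symMul_insertB_succ_zero {r m : ℕ} (h : r + 1 + 0 = m + 1) (h₁ : r + 0 = m) (b : B) :
    (symMul (R := R) h).compr₂ (insertB m b) =
      (symMul h₁).compl₁₂ (insertB r b) LinearMap.id := by
  refine LinearMap.ext₂ fun f g => ?_
  refine (insertB_symProd_succ_zero h h₁ (G := (SymForm.toMulti f).smulRight g) ?_ b).trans rfl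
  intro σ v
  simp only [MultilinearMap.smulRight_apply]
  rw [f.symm]

theorem symMul_insertB_zero_succ {j m : ℕ} (h : 0 + (j + 1) = m + 1) (h₂ : 0 + j = m) (b : B) :
    (symMul (R := R) h).compr₂ (insertB m b) =
      (symMul h₂).compl₁₂ LinearMap.id (insertB j b) := by
  refine LinearMap.ext₂ fun f g => ?_
  refine (insertB_symProd_zero_succ h h₂ ((SymForm.toMulti f).smulRight g) b).trans ?_
  refine congrArg (symProd h₂) (MultilinearMap.ext fun v => ?_)
  simp

theorem iB_mul (b : B) (f g : FormalFun R L B) :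
    iB b (mul f g) = mul (iB b f) g + mul f (iB b g) := by
  funext n m
  change (insertB m b).compAlternatingMap (mul f g n (m + 1)) =
    mul (iB b f) g n m + mul f (iB b g) n m
  rw [mul_eq, mul_eq, mul_eq, ← adSum_add]
  rw [compAlternatingMap_adSum]
  refine adSum_congr fun p p' hp => ?_
  rw [compAlternatingMap_adSum]
  refine adSum_succ _ _ _ ?_ ?_ ?_
  · intro j j' h h₁ h₂
    refine (compAlternatingMap_wedge _ _ _ _ _).trans ?_
    rw [symMul_insertB_succ_succ h h₁ h₂, wedge_add_bilin, ← wedge_comp, ← wedge_comp]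
    rfl
  · intro j h h₁
    refine (compAlternatingMap_wedge _ _ _ _ _).trans ?_
    rw [symMul_insertB_succ_zero h h₁, ← wedge_comp]
    rfl
  · intro j h h₁
    refine (compAlternatingMap_wedge _ _ _ _ _).trans ?_
    rw [symMul_insertB_zero_succ h h₁, ← wedge_comp]
    rfl

theorem c0_mul (f g : FormalFun R L B) : c0 (mul f g) = c0 f * c0 g := by
  rw [c0_apply, mul_eq, adSum_zero, adSum_zero, wedge_apply_zero _ _ _ _ _ ![] ![]]
  exact symProd_zero_zero _ _ _ ![] ![]

/-- The product of the function algebra as a bilinear map. -/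
def mulB : FormalFun R L B →ₗ[R] FormalFun R L B →ₗ[R] FormalFun R L B :=
  LinearMap.mk₂ R mul
    (fun f f' g => by
      funext n m
      change _ = mul f g n m + mul f' g n m
      simp only [mul_eq, ← adSum_add]
      refine adSum_congr fun p p' hp => adSum_congr fun j j' hj => ?_
      exact wedge_add_left _ _ _ _ _)
    (fun c f g => by
      funext n m
      change _ = c • mul f g n m
      simp only [mul_eq, smul_adSum]
      refine adSum_congr fun p p' hp => adSum_congr fun j j' hj => ?_
      exact wedge_smul_left _ _ _ _ _)
    (fun f g g' => by
      funext n m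
      change _ = mul f g n m + mul f g' n m
      simp only [mul_eq, ← adSum_add]
      refine adSum_congr fun p p' hp => adSum_congr fun j j' hj => ?_
      exact wedge_add_right _ _ _ _ _)
    (fun c f g => by
      funext n m
      change _ = c • mul f g n m
      simp only [mul_eq, smul_adSum]
      refine adSum_congr fun p p' hp => adSum_congr fun j j' hj => ?_
      exact wedge_smul_right _ _ _ _ _)

end
end
end Fedosov

namespace Fedosov
noncomputable section

/-! ### Vertical differential operators -/

section
variable {R L B : Type*} [CommRing R] [AddCommGroup L] [Module R L] [AddCommGroup B] [Module R B]

theorem partialEval_apply (r q : ℕ) (f : SymForm R B (r + q)) (v : Fin r → B) (w : Fin q → B) :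
    partialEval r q f v w = f (Fin.append v w) := by
  change f (fun i => Sum.elim v w (finSumFinEquiv.symm i)) = _
  congr 1
  funext i
  refine Fin.addCases (fun i => ?_) (fun i => ?_) i <;> simp

theorem isSymm_partialEval (r q : ℕ) (f : SymForm R B (r + q)) : IsSymm (partialEval r q f) := by
  intro σ v
  ext w
  rw [partialEval_apply, partialEval_apply]
  refine Eq.trans ?_ (f.symm (finSumFinEquiv.permCongr (Equiv.sumCongr σ (Equiv.refl _))) _)
  congr 1
  funext i
  refine Fin.addCases (fun i => ?_) (fun i => ?_) i <;> simp [Equiv.permCongr_apply]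

theorem IsSymm.comp {N N' : Type*} [AddCommGroup N] [Module R N] [AddCommGroup N'] [Module R N']
    {r : ℕ} {G : MultilinearMap R (fun _ : Fin r => B) N} (hG : IsSymm G) (u : N →ₗ[R] N') :
    IsSymm (u.compMultilinearMap G) := by
  intro σ v
  simp only [LinearMap.compMultilinearMap_apply]
  rw [hG]

/-- The identification of `S^k B^∨` and `S^k' B^∨` for `k = k'`. -/
def castSym {k k' : ℕ} (h : k = k') : SymForm R B k →ₗ[R] SymForm R B k' :=
  h ▸ LinearMap.id

theorem castSym_apply {k k' : ℕ} (h : k = k') (f : SymForm R B k) (v : Fin k' → B) :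
    castSym h f v = f (fun i => v (Fin.cast h i)) := by
  subst h
  rfl

theorem castSym_comp {k k' p : ℕ} (h : k = k') (g : FormalFun R L B) :
    (castSym h).compAlternatingMap (g p k) = g p k' := by
  subst h
  rfl

/-- The coefficient of a section of `Λ^• L^∨ ⊗ Ŝ B^∨ ⊗ S^q B` in
`Λ^p L^∨ ⊗ S^j B^∨ ⊗ S^q B`. -/
def coef {q : ℕ} (s : SymForm R B q →ₗ[R] FormalFun R L B) (p j : ℕ) :
    L [⋀^Fin p]→ₗ[R] (SymForm R B q →ₗ[R] SymForm R B j) :=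
  flipAlt ((LinearMap.proj j).comp ((LinearMap.proj p).comp s))

/-- The restriction of a function to form degree `0` and symmetric degree `q`. -/
def comp0 (q : ℕ) : FormalFun R L B →ₗ[R] SymForm R B q where
  toFun g := g 0 q ![]
  map_add' _ _ := rfl
  map_smul' _ _ := rfl

end

section
variable {R L B : Type*} [CommRing R] [Algebra ℚ R] [AddCommGroup L] [Module R L] [AddCommGroup B]
  [Module R B]

theorem vdo_eq (q : ℕ) (s : SymForm R B q →ₗ[R] FormalFun R L B) (g : FormalFun R L B) (n m : ℕ) :
    vdo q s g n m = adSum n fun p p' hp => adSum m fun r j hj =>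
      wedge (contract q hj) hp (coef s p j) (g p' (r + q)) := rfl

theorem vdo_eq_wedgeSum (q : ℕ) (s : SymForm R B q →ₗ[R] FormalFun R L B) (g : FormalFun R L B)
    (n m : ℕ) : vdo q s g n m = adSum m fun r j hj =>
      wedgeSum (contract q hj) (fun p => coef s p j) (fun p => g p (r + q)) n := by
  rw [vdo_eq, adSum_comm]
  rfl

/-- The vertical differential operators, as a bilinear map in the section and the function. -/
def vdoB (q : ℕ) :
    (SymForm R B q →ₗ[R] FormalFun R L B) →ₗ[R] FormalFun R L B →ₗ[R] FormalFun R L B :=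
  LinearMap.mk₂ R (vdo q)
    (fun s s' g => by
      funext n m
      change _ = vdo q s g n m + vdo q s' g n m
      simp only [vdo_eq, ← adSum_add]
      refine adSum_congr fun p p' hp => adSum_congr fun r j hj => ?_
      exact wedge_add_left _ hp (coef s p j) (coef s' p j) _)
    (fun c s g => by
      funext n m
      change _ = c • vdo q s g n m
      simp only [vdo_eq, smul_adSum]
      refine adSum_congr fun p p' hp => adSum_congr fun r j hj => ?_
      exact wedge_smul_left _ hp c (coef s p j) _)
    (fun s g g' => by
      funext n m
      change _ = vdo q s g n m + vdo q s g' n m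
      simp only [vdo_eq, ← adSum_add]
      refine adSum_congr fun p p' hp => adSum_congr fun r j hj => ?_
      exact wedge_add_right _ _ _ _ _)
    (fun c s g => by
      funext n m
      change _ = c • vdo q s g n m
      simp only [vdo_eq, smul_adSum]
      refine adSum_congr fun p p' hp => adSum_congr fun r j hj => ?_
      exact wedge_smul_right _ _ _ _ _)

variable (R L B) in
omit [Algebra ℚ R] in
theorem parity_smul (c : R) (f : FormalFun R L B) : parity (c • f) = c • parity f := by
  funext p k
  exact smul_comm ((-1 : R) ^ p) c (f p k)

variable (R L B) in
/-- The parity operator as a linear map. -/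
def parityL : FormalFun R L B →ₗ[R] FormalFun R L B where
  toFun f := parity f
  map_add' f g := map_add parity f g
  map_smul' c f := parity_smul R L B c f

omit [Algebra ℚ R] in
theorem parityL_apply (f : FormalFun R L B) : parityL R L B f = parity f := rfl

theorem iL_vdo (l : L) (q : ℕ) (s : SymForm R B q →ₗ[R] FormalFun R L B) (g : FormalFun R L B) :
    iL l (vdo q s g) = vdo q (iL l ∘ₗ s) g + vdo q (parityL R L B ∘ₗ s) (iL l g) := by
  funext n m
  change (vdo q s g (n + 1) m).curryLeft l =
    vdo q (iL l ∘ₗ s) g n m + vdo q (parityL R L B ∘ₗ s) (iL l g) n m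
  rw [vdo_eq_wedgeSum, vdo_eq_wedgeSum, vdo_eq_wedgeSum, ← adSum_add, curryLeft_adSum]
  refine adSum_congr fun j j' hj => ?_
  exact curryLeft_wedgeSum _ _ _ _ _

omit [Algebra ℚ R] in
theorem partialEval_curryLeft (r q : ℕ) (f : SymForm R B (r + 1 + q)) (b : B) :
    (partialEval (r + 1) q f).curryLeft b =
      partialEval r q (insertB (r + q) b (castSym (Nat.add_right_comm r 1 q) f)) := by
  refine MultilinearMap.ext fun v => SymForm.ext fun w => ?_
  rw [MultilinearMap.curryLeft_apply, partialEval_apply, partialEval_apply, insertB_apply,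
    castSym_apply, Fin.append_cons]
  rfl

theorem contract_insertB_succ_succ (q : ℕ) {r j m : ℕ} (h : r + 1 + (j + 1) = m + 1)
    (h₁ : r + (j + 1) = m) (h₂ : r + 1 + j = m) (b : B) :
    (contract (R := R) q h).compr₂ (insertB m b) =
      (contract q h₁).compl₁₂ LinearMap.id
        (insertB (r + q) b ∘ₗ castSym (Nat.add_right_comm r 1 q)) +
      (contract q h₂).compl₁₂ (LinearMap.llcomp R _ _ _ (insertB j b)) LinearMap.id := by
  refine LinearMap.ext₂ fun u f => ?_
  refine (insertB_symProd_succ_succ h h₁ h₂ (G := u.compMultilinearMap (partialEval (r + 1) q f))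
    ((isSymm_partialEval _ _ _).comp u) b).trans ?_
  refine congrArg₂ (· + ·) (congrArg (symProd h₁) ?_) (congrArg (symProd h₂) ?_)
  · change u.compMultilinearMap ((partialEval (r + 1) q f).curryLeft b) = _
    rw [partialEval_curryLeft]
    rfl
  · rfl

theorem contract_insertB_succ_zero (q : ℕ) {r m : ℕ} (h : r + 1 + 0 = m + 1) (h₁ : r + 0 = m)
    (b : B) :
    (contract (R := R) q h).compr₂ (insertB m b) =
      (contract q h₁).compl₁₂ LinearMap.id
        (insertB (r + q) b ∘ₗ castSym (Nat.add_right_comm r 1 q)) := by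
  refine LinearMap.ext₂ fun u f => ?_
  refine (insertB_symProd_succ_zero h h₁ (G := u.compMultilinearMap (partialEval (r + 1) q f))
    ((isSymm_partialEval _ _ _).comp u) b).trans ?_
  refine congrArg (symProd h₁) ?_
  change u.compMultilinearMap ((partialEval (r + 1) q f).curryLeft b) = _
  rw [partialEval_curryLeft]
  rfl

theorem contract_insertB_zero_succ (q : ℕ) {j m : ℕ} (h : 0 + (j + 1) = m + 1) (h₂ : 0 + j = m)
    (b : B) :
    (contract (R := R) q h).compr₂ (insertB m b) =
      (contract q h₂).compl₁₂ (LinearMap.llcomp R _ _ _ (insertB j b)) LinearMap.id := by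
  refine LinearMap.ext₂ fun u f => ?_
  exact insertB_symProd_zero_succ h h₂ (u.compMultilinearMap (partialEval 0 q f)) b

theorem iB_vdo (b : B) (q : ℕ) (s : SymForm R B q →ₗ[R] FormalFun R L B) (g : FormalFun R L B) :
    iB b (vdo q s g) = vdo q (iB b ∘ₗ s) g + vdo q s (iB b g) := by
  rw [add_comm]
  funext n m
  change (insertB m b).compAlternatingMap (vdo q s g n (m + 1)) =
    vdo q s (iB b g) n m + vdo q (iB b ∘ₗ s) g n m
  rw [vdo_eq, vdo_eq, vdo_eq, ← adSum_add, compAlternatingMap_adSum]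
  refine adSum_congr fun p p' hp => ?_
  rw [compAlternatingMap_adSum]
  have hg : ∀ r, (insertB (r + q) b ∘ₗ castSym (Nat.add_right_comm r 1 q)).compAlternatingMap
      (g p' (r + 1 + q)) = iB b g p' (r + q) := fun r =>
    congrArg (insertB (r + q) b).compAlternatingMap (castSym_comp (Nat.add_right_comm r 1 q) g)
  refine adSum_succ _ _ _ ?_ ?_ ?_
  · intro r j h h₁ h₂
    rw [compAlternatingMap_wedge, contract_insertB_succ_succ q h h₁ h₂, wedge_add_bilin,
      ← wedge_comp, ← wedge_comp, hg]
    rfl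
  · intro r h h₁
    rw [compAlternatingMap_wedge, contract_insertB_succ_zero q h h₁, ← wedge_comp, hg]
    rfl
  · intro j h h₁
    rw [compAlternatingMap_wedge, contract_insertB_zero_succ q h h₁, ← wedge_comp]
    rfl

theorem c0_vdo (q : ℕ) (s : SymForm R B q →ₗ[R] FormalFun R L B) (g : FormalFun R L B) :
    c0 (vdo q s g) = c0 (s (comp0 q g)) := by
  rw [c0_apply, vdo_eq, adSum_zero, adSum_zero, wedge_apply_zero _ _ _ _ _ ![] ![]]
  refine (symProd_zero_zero _ _ _ ![] ![]).trans ?_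
  rw [LinearMap.compMultilinearMap_apply]
  have h1 : partialEval 0 q (g 0 (0 + q) ![]) ![] = comp0 q g := by
    ext w
    rw [partialEval_apply]
    have h2 : ∀ k (h : k = q), g 0 k ![] (fun i => w (Fin.cast h i)) = g 0 q ![] w := by
      intro k h
      subst h
      rfl
    refine Eq.trans ?_ (h2 (0 + q) (zero_add q))
    congr 1
    funext i
    refine Fin.addCases (fun i => i.elim0) (fun i => ?_) i
    rw [Fin.append_right]
    congr 1
    ext
    simp
  rw [h1]
  rfl

/-! ### The parity operator -/

omit [Algebra ℚ R]

theorem iL_parity (l : L) (f : FormalFun R L B) : iL l (parity f) = -parity (iL l f) := by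
  refine formalFun_ext fun p k v w => ?_
  change (-1 : R) ^ (p + 1) * f (p + 1) k (Fin.cons l v) w =
    -((-1 : R) ^ p * f (p + 1) k (Fin.cons l v) w)
  ring

theorem iB_parity (b : B) (f : FormalFun R L B) : iB b (parity f) = parity (iB b f) := rfl

theorem c0_parity (f : FormalFun R L B) : c0 (parity f) = c0 f := by
  change (-1 : R) ^ 0 * _ = _
  rw [pow_zero, one_mul]
  rfl

theorem comp0_parity (q : ℕ) (f : FormalFun R L B) : comp0 q (parity f) = comp0 q f := by
  change (-1 : R) ^ 0 • (f 0 q ![]) = f 0 q ![]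
  rw [pow_zero, one_smul]

theorem parity_parity (f : FormalFun R L B) : parity (parity f) = f := by
  funext p k
  rw [parity_apply, parity_apply, smul_smul, ← mul_pow, neg_one_mul (-1 : R), neg_neg, one_pow,
    one_smul]

theorem parity_mul_parity : (parity * parity : Op R L B) = 1 :=
  AddMonoidHom.ext parity_parity

/-! ### The Koszul vector field -/

theorem c0_koszul (π : L →ₗ[R] B) (f : FormalFun R L B) : c0 (koszul π f) = 0 := rfl

theorem comp0_koszul (π : L →ₗ[R] B) (q : ℕ) (f : FormalFun R L B) : comp0 q (koszul π f) = 0 := rfl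

theorem koszul_apply (π : L →ₗ[R] B) (f : FormalFun R L B) (p k : ℕ) (v : Fin (p + 1) → L)
    (w : Fin k → B) : koszul π f (p + 1) k v w =
      ∑ i : Fin (p + 1), (-1 : R) ^ (i : ℕ) * f p (k + 1) (i.removeNth v) (Fin.cons (π (v i)) w) := by
  have h1 : koszul π f (p + 1) k v = ∑ i : Fin (p + 1), (-1) ^ (i : ℕ) •
      insertB k (π (v i)) (f p (k + 1) (i.removeNth v)) :=
    AlternatingMap.alternatizeUncurryFin_apply _ _
  rw [h1, map_sum, _root_.sum_apply]
  refine Finset.sum_congr rfl fun i _ => ?_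
  rw [map_zsmul]
  rw [_root_.smul_apply, ← Int.cast_smul_eq_zsmul R]
  push_cast
  rfl

theorem koszul_zero_form (π : L →ₗ[R] B) (f : FormalFun R L B) (k : ℕ) : koszul π f 0 k = 0 := rfl

theorem iL_koszul (π : L →ₗ[R] B) (l : L) (f : FormalFun R L B) :
    iL l (koszul π f) = iB (π l) f - koszul π (iL l f) := by
  refine formalFun_ext fun p k v w => ?_
  change koszul π f (p + 1) k (Fin.cons l v) w =
    iB (π l) f p k v w - koszul π (iL l f) p k v w
  rw [koszul_apply, Fin.sum_univ_succ, sub_eq_add_neg]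
  congr 1
  · simp [iB_apply, Fin.removeNth_zero]
  · cases p with
    | zero => simp [koszul_zero_form]
    | succ p =>
      rw [koszul_apply, ← Finset.sum_neg_distrib]
      refine Finset.sum_congr rfl fun i _ => ?_
      rw [iL_apply, Fin.val_succ, pow_succ, Fin.cons_succ]
      have : i.succ.removeNth (Fin.cons l v : Fin (p + 2) → L) =
          Fin.cons l (i.removeNth v) := by
        funext x
        refine Fin.cases ?_ (fun x => ?_) x <;> simp [Fin.removeNth]
      rw [this]
      ring

theorem iB_koszul (π : L →ₗ[R] B) (b : B) (f : FormalFun R L B) :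
    iB b (koszul π f) = koszul π (iB b f) := by
  refine formalFun_ext fun p k v w => ?_
  rw [iB_apply]
  cases p with
  | zero => rfl
  | succ p =>
    rw [koszul_apply, koszul_apply]
    refine Finset.sum_congr rfl fun i _ => ?_
    rw [iB_apply]
    congr 1
    rw [← (f p (k + 1 + 1) (i.removeNth v)).symm (Equiv.swap 0 1)]
    congr 1
    funext x
    refine Fin.cases ?_ (fun x => ?_) x
    · simp
    · refine Fin.cases ?_ (fun x => ?_) x
      · simp
      · rw [Equiv.swap_apply_of_ne_of_ne (Fin.succ_ne_zero _) (by simp [Fin.ext_iff])]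
        simp

/-- The Koszul vector field as a linear map. -/
def koszulL (π : L →ₗ[R] B) : FormalFun R L B →ₗ[R] FormalFun R L B where
  toFun f := koszul π f
  map_add' f g := map_add (koszul π) f g
  map_smul' c f := by
    refine formalFun_ext fun p k v w => ?_
    cases p with
    | zero => exact (mul_zero c).symm
    | succ p =>
      change koszul π (c • f) (p + 1) k v w = c * koszul π f (p + 1) k v w
      rw [koszul_apply, koszul_apply, Finset.mul_sum]
      refine Finset.sum_congr rfl fun i _ => ?_
      rw [mul_left_comm]
      rfl

theorem koszulL_apply (π : L →ₗ[R] B) (f : FormalFun R L B) : koszulL π f = koszul π f := rfl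

end
end
end Fedosov

namespace Fedosov
noncomputable section

/-! ### The algebra of functions -/

section
variable {R L B : Type*} [CommRing R] [AddCommGroup L] [Module R L] [AddCommGroup B] [Module R B]

/-- The principle `eq_zero_of_contractions` for a family of functions. -/
theorem family_eq_zero_of_contractions {ι : Type*} (F : ι → FormalFun R L B)
    (h0 : ∀ i, c0 (F i) = 0)
    (hL : ∀ W : Submodule R (FormalFun R L B), (∀ i, F i ∈ W) → ∀ i l, iL l (F i) ∈ W)
    (hB : ∀ W : Submodule R (FormalFun R L B), (∀ i, F i ∈ W) → ∀ i b, iB b (F i) ∈ W) (i : ι) :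
    F i = 0 :=
  have h : ∀ i, F i ∈ Submodule.span R (Set.range F) := fun i => Submodule.subset_span ⟨i, rfl⟩
  eq_zero_of_contractions (Set.range F) (by rintro _ ⟨i, rfl⟩; exact h0 i)
    (by rintro _ ⟨i, rfl⟩; exact hL _ h i) (by rintro _ ⟨i, rfl⟩; exact hB _ h i) _ ⟨i, rfl⟩

theorem HasFormDegree.iL_eq_zero {f : FormalFun R L B} (hf : HasFormDegree 0 f) (l : L) :
    iL l f = 0 := by
  refine formalFun_ext fun p k v w => ?_
  rw [iL_apply, hf (p + 1) k (Nat.succ_ne_zero p)]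
  rfl

protected theorem HasFormDegree.iL {f : FormalFun R L B} {p : ℕ} (hf : HasFormDegree (p + 1) f) (l : L) :
    HasFormDegree p (iL l f) := by
  intro p' k h
  refine AlternatingMap.ext fun v => ?_
  change f (p' + 1) k (Fin.cons l v) = 0
  rw [hf (p' + 1) k (fun h' => h (Nat.succ.inj h'))]
  rfl

protected theorem HasFormDegree.iB {f : FormalFun R L B} {p : ℕ} (hf : HasFormDegree p f) (b : B) :
    HasFormDegree p (iB b f) := by
  intro p' k h
  refine AlternatingMap.ext fun v => ?_
  change insertB k b (f p' (k + 1) v) = 0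
  rw [hf p' (k + 1) h]
  exact map_zero (insertB k b)

theorem HasFormDegree.parity_eq {f : FormalFun R L B} {p : ℕ} (hf : HasFormDegree p f) :
    parity f = (-1 : R) ^ p • f := by
  funext p' k
  rw [parity_apply]
  rcases eq_or_ne p' p with rfl | h
  · rfl
  · change _ = (-1 : R) ^ p • f p' k
    rw [hf p' k h, smul_zero, smul_zero]

theorem HasFormDegree.parity_zero {f : FormalFun R L B} (hf : HasFormDegree 0 f) :
    parity f = f := by
  rw [hf.parity_eq, pow_zero, one_smul]

theorem HasFormDegree.c0_eq_zero {f : FormalFun R L B} {p : ℕ} (hf : HasFormDegree (p + 1) f) :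
    c0 f = 0 := by
  rw [c0_apply, hf 0 0 (Nat.succ_ne_zero p).symm]
  rfl

theorem HasSymDegree.iB_eq_zero {f : FormalFun R L B} (hf : HasSymDegree 0 f) (b : B) :
    iB b f = 0 := by
  refine formalFun_ext fun p k v w => ?_
  rw [iB_apply, hf p (k + 1) (Nat.succ_ne_zero k)]
  rfl

protected theorem HasSymDegree.iL {f : FormalFun R L B} {k : ℕ} (hf : HasSymDegree k f) (l : L) :
    HasSymDegree k (iL l f) := by
  intro p k' h
  refine AlternatingMap.ext fun v => ?_
  change f (p + 1) k' (Fin.cons l v) = 0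
  rw [hf (p + 1) k' h]
  rfl

protected theorem HasSymDegree.parity {f : FormalFun R L B} {k : ℕ} (hf : HasSymDegree k f) :
    HasSymDegree k (parity f) := by
  intro p k' h
  rw [parity_apply, hf p k' h, smul_zero]

theorem koszul_parity (π : L →ₗ[R] B) (f : FormalFun R L B) :
    koszul π (parity f) = -parity (koszul π f) := by
  rw [← sub_eq_zero, sub_neg_eq_add]
  refine family_eq_zero_of_contractions
    (fun f : FormalFun R L B => koszul π (parity f) + parity (koszul π f)) ?_ ?_ ?_ f
  · intro f
    rw [map_add, c0_koszul, c0_parity, c0_koszul, add_zero]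
  · intro W hW f l
    have : iL l (koszul π (parity f) + parity (koszul π f)) =
        koszul π (parity (iL l f)) + parity (koszul π (iL l f)) := by
      simp only [map_add, iL_koszul, iL_parity, iB_parity, map_neg, map_sub]
      abel
    rw [this]
    exact hW (iL l f)
  · intro W hW f b
    have : iB b (koszul π (parity f) + parity (koszul π f)) =
        koszul π (parity (iB b f)) + parity (koszul π (iB b f)) := by
      simp only [map_add, iB_koszul, iB_parity]
    rw [this]
    exact hW (iB b f)

end

section
variable {R L B : Type*} [CommRing R] [Algebra ℚ R] [AddCommGroup L] [Module R L] [AddCommGroup B]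
  [Module R B]

section
variable (f f' g g' : FormalFun R L B)

theorem mul_add_right : mul f (g + g') = mul f g + mul f g' := map_add (mulB f) g g'
theorem mul_sub_right : mul f (g - g') = mul f g - mul f g' := map_sub (mulB f) g g'
theorem mul_neg_right : mul f (-g) = -mul f g := map_neg (mulB f) g
theorem mul_zero_right : mul f 0 = 0 := map_zero (mulB f)
theorem mul_smul_right (c : R) : mul f (c • g) = c • mul f g := map_smul (mulB f) c g
theorem mul_add_left : mul (f + f') g = mul f g + mul f' g := LinearMap.map_add₂ mulB f f' g
theorem mul_sub_left : mul (f - f') g = mul f g - mul f' g := LinearMap.map_sub₂ mulB f f' g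
theorem mul_neg_left : mul (-f) g = -mul f g := LinearMap.map_neg₂ mulB f g
theorem mul_zero_left : mul 0 g = 0 := LinearMap.map_zero₂ mulB g
theorem mul_smul_left (c : R) : mul (c • f) g = c • mul f g := LinearMap.map_smul₂ mulB c f g

end

theorem parity_mul (f g : FormalFun R L B) : parity (mul f g) = mul (parity f) (parity g) := by
  rw [← sub_eq_zero]
  refine family_eq_zero_of_contractions (fun x : FormalFun R L B × FormalFun R L B =>
    parity (mul x.1 x.2) - mul (parity x.1) (parity x.2)) ?_ ?_ ?_ (f, g)
  · rintro ⟨f, g⟩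
    simp only [map_sub, c0_parity, c0_mul, sub_self]
  · rintro W hW ⟨f, g⟩ l
    have : iL l (parity (mul f g) - mul (parity f) (parity g)) =
        -(parity (mul (iL l f) g) - mul (parity (iL l f)) (parity g)) -
        (parity (mul (parity f) (iL l g)) - mul (parity (parity f)) (parity (iL l g))) := by
      simp only [map_sub, map_add, iL_parity, iL_mul, mul_neg_left, mul_neg_right, neg_add]
      abel
    rw [this]
    exact sub_mem (neg_mem (hW (iL l f, g))) (hW (parity f, iL l g))
  · rintro W hW ⟨f, g⟩ b
    have : iB b (parity (mul f g) - mul (parity f) (parity g)) =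
        (parity (mul (iB b f) g) - mul (parity (iB b f)) (parity g)) +
        (parity (mul f (iB b g)) - mul (parity f) (parity (iB b g))) := by
      simp only [map_sub, map_add, iB_parity, iB_mul]
      abel
    rw [this]
    exact add_mem (hW (iB b f, g)) (hW (f, iB b g))

theorem mul_assoc' (f g h : FormalFun R L B) : mul (mul f g) h = mul f (mul g h) := by
  rw [← sub_eq_zero]
  refine family_eq_zero_of_contractions
    (fun x : FormalFun R L B × FormalFun R L B × FormalFun R L B =>
      mul (mul x.1 x.2.1) x.2.2 - mul x.1 (mul x.2.1 x.2.2)) ?_ ?_ ?_ (f, g, h)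
  · rintro ⟨f, g, h⟩
    simp only [map_sub, c0_mul, mul_assoc, sub_self]
  · rintro W hW ⟨f, g, h⟩ l
    have : iL l (mul (mul f g) h - mul f (mul g h)) =
        (mul (mul (iL l f) g) h - mul (iL l f) (mul g h)) +
        (mul (mul (parity f) (iL l g)) h - mul (parity f) (mul (iL l g) h)) +
        (mul (mul (parity f) (parity g)) (iL l h) - mul (parity f) (mul (parity g) (iL l h))) := by
      simp only [map_sub, iL_mul, mul_add_left, mul_add_right, parity_mul]
      abel
    rw [this]
    exact add_mem (add_mem (hW (iL l f, g, h))
      (hW (parity f, iL l g, h))) (hW (parity f, parity g, iL l h))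
  · rintro W hW ⟨f, g, h⟩ b
    have : iB b (mul (mul f g) h - mul f (mul g h)) =
        (mul (mul (iB b f) g) h - mul (iB b f) (mul g h)) +
        (mul (mul f (iB b g)) h - mul f (mul (iB b g) h)) +
        (mul (mul f g) (iB b h) - mul f (mul g (iB b h))) := by
      simp only [map_sub, iB_mul, mul_add_left, mul_add_right]
      abel
    rw [this]
    exact add_mem (add_mem (hW (iB b f, g, h))
      (hW (f, iB b g, h))) (hW (f, g, iB b h))

/-- Functions of form degree `0` are central. -/
protected theorem HasFormDegree.mul_comm {g : FormalFun R L B} (hg : HasFormDegree 0 g) (f : FormalFun R L B) :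
    mul f g = mul g f := by
  rw [← sub_eq_zero]
  refine family_eq_zero_of_contractions
    (fun x : FormalFun R L B × {g : FormalFun R L B // HasFormDegree 0 g} =>
      mul x.1 x.2.1 - mul x.2.1 x.1) ?_ ?_ ?_ (f, ⟨g, hg⟩)
  · rintro ⟨f, g, hg⟩
    simp only [map_sub, c0_mul, _root_.mul_comm, sub_self]
  · rintro W hW ⟨f, g, hg⟩ l
    have : iL l (mul f g - mul g f) = mul (iL l f) g - mul g (iL l f) := by
      simp only [map_sub, iL_mul, hg.iL_eq_zero, hg.parity_zero, mul_zero_left, mul_zero_right,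
        add_zero, zero_add]
    dsimp only
    rw [this]
    exact hW (iL l f, ⟨g, hg⟩)
  · rintro W hW ⟨f, g, hg⟩ b
    have : iB b (mul f g - mul g f) = (mul (iB b f) g - mul g (iB b f)) +
        (mul f (iB b g) - mul (iB b g) f) := by
      simp only [map_sub, iB_mul]
      abel
    dsimp only
    rw [this]
    exact add_mem (hW (iB b f, ⟨g, hg⟩)) (hW (f, ⟨iB b g, hg.iB b⟩))

omit [Algebra ℚ R] in
theorem one_formDegree : HasFormDegree 0 (one R L B) := by
  rintro (_ | p) k h
  · exact absurd rfl h
  · rfl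

omit [Algebra ℚ R] in
theorem one_symDegree : HasSymDegree 0 (one R L B) := by
  rintro (_ | p) (_ | k) h
  · exact absurd rfl h
  all_goals rfl

omit [Algebra ℚ R] in
theorem c0_one : c0 (one R L B) = 1 := rfl

theorem mul_one' (f : FormalFun R L B) : mul f (one R L B) = f := by
  rw [← sub_eq_zero]
  refine family_eq_zero_of_contractions (fun f : FormalFun R L B => mul f (one R L B) - f) ?_ ?_ ?_ f
  · intro f
    simp only [map_sub, c0_mul, c0_one, mul_one, sub_self]
  · intro W hW f l
    have : iL l (mul f (one R L B) - f) = mul (iL l f) (one R L B) - iL l f := by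
      simp only [map_sub, iL_mul, one_formDegree.iL_eq_zero, mul_zero_right, add_zero]
    rw [this]
    exact hW (iL l f)
  · intro W hW f b
    have : iB b (mul f (one R L B) - f) = mul (iB b f) (one R L B) - iB b f := by
      simp only [map_sub, iB_mul, one_symDegree.iB_eq_zero, mul_zero_right, add_zero]
    rw [this]
    exact hW (iB b f)

theorem one_mul' (f : FormalFun R L B) : mul (one R L B) f = f := by
  rw [← one_formDegree.mul_comm, mul_one']

/-- The Koszul vector field is a derivation of degree `1`. -/
theorem koszul_mul (π : L →ₗ[R] B) (f g : FormalFun R L B) :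
    koszul π (mul f g) = mul (koszul π f) g + mul (parity f) (koszul π g) := by
  rw [← sub_eq_zero]
  refine family_eq_zero_of_contractions (fun x : FormalFun R L B × FormalFun R L B =>
    koszul π (mul x.1 x.2) - (mul (koszul π x.1) x.2 + mul (parity x.1) (koszul π x.2)))
    ?_ ?_ ?_ (f, g)
  · rintro ⟨f, g⟩
    simp only [map_sub, map_add, c0_koszul, c0_mul, mul_zero, zero_mul, add_zero, sub_self]
  · rintro W hW ⟨f, g⟩ l
    have : iL l (koszul π (mul f g) - (mul (koszul π f) g + mul (parity f) (koszul π g))) =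
        -(koszul π (mul (iL l f) g) - (mul (koszul π (iL l f)) g +
          mul (parity (iL l f)) (koszul π g))) -
        (koszul π (mul (parity f) (iL l g)) - (mul (koszul π (parity f)) (iL l g) +
          mul (parity (parity f)) (koszul π (iL l g)))) := by
      simp only [map_sub, map_add, iL_koszul, iL_parity, iL_mul, iB_mul, mul_neg_left,
        mul_sub_left, mul_sub_right, koszul_parity, parity_parity]
      abel
    rw [this]
    exact sub_mem (neg_mem (hW (iL l f, g))) (hW (parity f, iL l g))
  · rintro W hW ⟨f, g⟩ b
    have : iB b (koszul π (mul f g) - (mul (koszul π f) g + mul (parity f) (koszul π g))) =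
        (koszul π (mul (iB b f) g) - (mul (koszul π (iB b f)) g +
          mul (parity (iB b f)) (koszul π g))) +
        (koszul π (mul f (iB b g)) - (mul (koszul π f) (iB b g) +
          mul (parity f) (koszul π (iB b g)))) := by
      simp only [map_sub, map_add, iB_koszul, iB_parity, iB_mul]
      abel
    rw [this]
    exact add_mem (hW (iB b f, g)) (hW (f, iB b g))

/-! ### Commutation relations of vertical differential operators -/

section
variable {q : ℕ} (s s' : SymForm R B q →ₗ[R] FormalFun R L B) (f g : FormalFun R L B)

theorem vdo_add_fun : vdo q s (f + g) = vdo q s f + vdo q s g := map_add (vdoB q s) f g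
theorem vdo_sub_fun : vdo q s (f - g) = vdo q s f - vdo q s g := map_sub (vdoB q s) f g
theorem vdo_neg_fun : vdo q s (-f) = -vdo q s f := map_neg (vdoB q s) f
theorem vdo_zero_fun : vdo q s 0 = 0 := map_zero (vdoB q s)
theorem vdo_sub : vdo q (s - s') f = vdo q s f - vdo q s' f := LinearMap.map_sub₂ (vdoB q) s s' f
theorem vdo_neg : vdo q (-s) f = -vdo q s f := LinearMap.map_neg₂ (vdoB q) s f
theorem vdo_zero : vdo q (0 : SymForm R B q →ₗ[R] FormalFun R L B) f = 0 :=
  LinearMap.map_zero₂ (vdoB q) f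

end

/-- Multiplication by a form `w` acts on the components of form degree `0` through the function
`c0 w`. -/
theorem comp0_mul_of_symDegree {w : FormalFun R L B} (hw : HasSymDegree 0 w) (q : ℕ)
    (f : FormalFun R L B) : comp0 q (mul f w) = c0 w • comp0 q f := by
  have key : ∀ (q : ℕ) (f : FormalFun R L B) v,
      comp0 q (mul f w) v = c0 w * comp0 q f v := by
    intro q
    induction q with
    | zero =>
      intro f v
      rw [Subsingleton.elim v ![]]
      exact (c0_mul f w).trans (mul_comm _ _)
    | succ q ih =>
      intro f v
      have h1 : ∀ g : FormalFun R L B, comp0 (q + 1) g v = comp0 q (iB (v 0) g) (Fin.tail v) := by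
        intro g
        conv_lhs => rw [← Fin.cons_self_tail v]
        rfl
      rw [h1, h1, iB_mul, hw.iB_eq_zero, mul_zero_right, add_zero, ih]
  exact SymForm.ext fun v => key q f v

omit [Algebra ℚ R] in
theorem comp0_one_apply (f : FormalFun R L B) (v : Fin 1 → B) : comp0 1 f v = c0 (iB (v 0) f) := by
  rw [← Fin.cons_self_tail v]
  exact congrArg (fun w => f 0 1 ![] (Fin.cons (v 0) w)) (Subsingleton.elim _ _)

theorem comp0_one_mul (f g : FormalFun R L B) :
    comp0 1 (mul f g) = c0 g • comp0 1 f + c0 f • comp0 1 g := by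
  refine SymForm.ext fun v => ?_
  rw [map_add, map_smul, map_smul, _root_.add_apply, _root_.smul_apply, _root_.smul_apply,
    comp0_one_apply, comp0_one_apply, comp0_one_apply, iB_mul, map_add, c0_mul, c0_mul,
    smul_eq_mul, smul_eq_mul, mul_comm (c0 g)]

section
variable {q : ℕ} (s : SymForm R B q →ₗ[R] FormalFun R L B)

omit [Algebra ℚ R]

theorem parityL_comp_iL (l : L) : parityL R L B ∘ₗ iL l ∘ₗ s = -(iL l ∘ₗ parityL R L B ∘ₗ s) :=
  LinearMap.ext fun β => by
    change parity (iL l (s β)) = -iL l (parity (s β))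
    rw [iL_parity, neg_neg]

theorem parityL_comp_parityL : parityL R L B ∘ₗ parityL R L B ∘ₗ s = s :=
  LinearMap.ext fun β => parity_parity (s β)

theorem parityL_comp_koszulL (π : L →ₗ[R] B) :
    parityL R L B ∘ₗ koszulL π ∘ₗ s = -(koszulL π ∘ₗ parityL R L B ∘ₗ s) :=
  LinearMap.ext fun β => by
    change parity (koszul π (s β)) = -koszul π (parity (s β))
    rw [koszul_parity, neg_neg]

theorem iL_comp_koszulL (π : L →ₗ[R] B) (l : L) :
    iL l ∘ₗ koszulL π ∘ₗ s = iB (π l) ∘ₗ s - koszulL π ∘ₗ iL l ∘ₗ s :=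
  LinearMap.ext fun β => iL_koszul π l (s β)

theorem iB_comp_koszulL (π : L →ₗ[R] B) (b : B) :
    iB b ∘ₗ koszulL π ∘ₗ s = koszulL π ∘ₗ iB b ∘ₗ s :=
  LinearMap.ext fun β => iB_koszul π b (s β)

end

theorem parity_vdo {q : ℕ} (s : SymForm R B q →ₗ[R] FormalFun R L B) (f : FormalFun R L B) :
    parity (vdo q s f) = vdo q (parityL R L B ∘ₗ s) (parity f) := by
  rw [← sub_eq_zero]
  refine family_eq_zero_of_contractions
    (fun x : (SymForm R B q →ₗ[R] FormalFun R L B) × FormalFun R L B =>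
      parity (vdo q x.1 x.2) - vdo q (parityL R L B ∘ₗ x.1) (parity x.2)) ?_ ?_ ?_ (s, f)
  · rintro ⟨s, f⟩
    dsimp only
    rw [map_sub, c0_parity, c0_vdo, c0_vdo, comp0_parity, LinearMap.comp_apply, parityL_apply,
      c0_parity, sub_self]
  · rintro W hW ⟨s, f⟩ l
    have : iL l (parity (vdo q s f) - vdo q (parityL R L B ∘ₗ s) (parity f)) =
        -(parity (vdo q (iL l ∘ₗ s) f) - vdo q (parityL R L B ∘ₗ iL l ∘ₗ s) (parity f)) -
        (parity (vdo q (parityL R L B ∘ₗ s) (iL l f)) -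
          vdo q (parityL R L B ∘ₗ parityL R L B ∘ₗ s) (parity (iL l f))) := by
      rw [map_sub, iL_parity, iL_vdo, iL_vdo, iL_parity, map_add, parityL_comp_iL, vdo_neg,
        vdo_neg_fun]
      abel
    dsimp only
    rw [this]
    exact sub_mem (neg_mem (hW (iL l ∘ₗ s, f)))
      (hW (parityL R L B ∘ₗ s, iL l f))
  · rintro W hW ⟨s, f⟩ b
    have : iB b (parity (vdo q s f) - vdo q (parityL R L B ∘ₗ s) (parity f)) =
        (parity (vdo q (iB b ∘ₗ s) f) - vdo q (parityL R L B ∘ₗ iB b ∘ₗ s) (parity f)) +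
        (parity (vdo q s (iB b f)) - vdo q (parityL R L B ∘ₗ s) (parity (iB b f))) := by
      rw [map_sub, iB_parity, iB_vdo, iB_vdo, iB_parity, map_add]
      exact add_sub_add_comm _ _ _ _
    dsimp only
    rw [this]
    exact add_mem (hW (iB b ∘ₗ s, f)) (hW (s, iB b f))

/-- Vertical differential operators are linear over the forms. -/
theorem vdo_mul_right {q : ℕ} (s : SymForm R B q →ₗ[R] FormalFun R L B) (f : FormalFun R L B)
    {w : FormalFun R L B} (hw : HasSymDegree 0 w) : vdo q s (mul f w) = mul (vdo q s f) w := by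
  rw [← sub_eq_zero]
  refine family_eq_zero_of_contractions
    (fun x : (SymForm R B q →ₗ[R] FormalFun R L B) × FormalFun R L B ×
        {w : FormalFun R L B // HasSymDegree 0 w} =>
      vdo q x.1 (mul x.2.1 x.2.2.1) - mul (vdo q x.1 x.2.1) x.2.2.1) ?_ ?_ ?_ (s, f, ⟨w, hw⟩)
  · rintro ⟨s, f, w, hw⟩
    dsimp only
    rw [map_sub, c0_vdo, comp0_mul_of_symDegree hw, map_smul, map_smul, c0_mul, c0_vdo,
      smul_eq_mul, mul_comm, sub_self]
  · rintro W hW ⟨s, f, w, hw⟩ l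
    have : iL l (vdo q s (mul f w) - mul (vdo q s f) w) =
        (vdo q (iL l ∘ₗ s) (mul f w) - mul (vdo q (iL l ∘ₗ s) f) w) +
        (vdo q (parityL R L B ∘ₗ s) (mul (iL l f) w) -
          mul (vdo q (parityL R L B ∘ₗ s) (iL l f)) w) +
        (vdo q (parityL R L B ∘ₗ s) (mul (parity f) (iL l w)) -
          mul (vdo q (parityL R L B ∘ₗ s) (parity f)) (iL l w)) := by
      rw [map_sub, iL_vdo, iL_mul, iL_mul, iL_vdo, vdo_add_fun, mul_add_left, parity_vdo]
      abel
    dsimp only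
    rw [this]
    exact add_mem (add_mem (hW (iL l ∘ₗ s, f, ⟨w, hw⟩))
      (hW (parityL R L B ∘ₗ s, iL l f, ⟨w, hw⟩)))
      (hW (parityL R L B ∘ₗ s, parity f, ⟨iL l w, hw.iL l⟩))
  · rintro W hW ⟨s, f, w, hw⟩ b
    have : iB b (vdo q s (mul f w) - mul (vdo q s f) w) =
        (vdo q (iB b ∘ₗ s) (mul f w) - mul (vdo q (iB b ∘ₗ s) f) w) +
        (vdo q s (mul (iB b f) w) - mul (vdo q s (iB b f)) w) := by
      rw [map_sub, iB_vdo, iB_mul, iB_mul, iB_vdo, hw.iB_eq_zero, mul_zero_right, mul_zero_right,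
        add_zero, add_zero, mul_add_left]
      exact add_sub_add_comm _ _ _ _
    dsimp only
    rw [this]
    exact add_mem (hW (iB b ∘ₗ s, f, ⟨w, hw⟩))
      (hW (s, iB b f, ⟨w, hw⟩))

/-- The commutator of the Koszul vector field with a vertical differential operator acts on its
coefficients. -/
theorem koszul_vdo (π : L →ₗ[R] B) {q : ℕ} (s : SymForm R B q →ₗ[R] FormalFun R L B)
    (f : FormalFun R L B) : koszul π (vdo q s f) =
      vdo q (koszulL π ∘ₗ s) f + vdo q (parityL R L B ∘ₗ s) (koszul π f) := by
  rw [← sub_eq_zero]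
  refine family_eq_zero_of_contractions
    (fun x : (SymForm R B q →ₗ[R] FormalFun R L B) × FormalFun R L B =>
      koszul π (vdo q x.1 x.2) - (vdo q (koszulL π ∘ₗ x.1) x.2 +
        vdo q (parityL R L B ∘ₗ x.1) (koszul π x.2))) ?_ ?_ ?_ (s, f)
  · rintro ⟨s, f⟩
    dsimp only
    rw [map_sub, map_add, c0_koszul, c0_vdo, c0_vdo, comp0_koszul, map_zero, map_zero,
      LinearMap.comp_apply, koszulL_apply, c0_koszul, add_zero, sub_zero]
  · rintro W hW ⟨s, f⟩ l
    have : iL l (koszul π (vdo q s f) - (vdo q (koszulL π ∘ₗ s) f +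
        vdo q (parityL R L B ∘ₗ s) (koszul π f))) =
        -(koszul π (vdo q (iL l ∘ₗ s) f) - (vdo q (koszulL π ∘ₗ iL l ∘ₗ s) f +
          vdo q (parityL R L B ∘ₗ iL l ∘ₗ s) (koszul π f))) -
        (koszul π (vdo q (parityL R L B ∘ₗ s) (iL l f)) -
          (vdo q (koszulL π ∘ₗ parityL R L B ∘ₗ s) (iL l f) +
          vdo q (parityL R L B ∘ₗ parityL R L B ∘ₗ s) (koszul π (iL l f)))) := by
      rw [map_sub, map_add, iL_koszul, iL_vdo, iL_vdo, iL_vdo, iL_koszul, iB_vdo, map_add,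
        parityL_comp_koszulL, iL_comp_koszulL, parityL_comp_iL, parityL_comp_parityL,
        vdo_neg, vdo_neg, vdo_sub, vdo_sub_fun]
      abel
    dsimp only
    rw [this]
    exact sub_mem (neg_mem (hW (iL l ∘ₗ s, f)))
      (hW (parityL R L B ∘ₗ s, iL l f))
  · rintro W hW ⟨s, f⟩ b
    have : iB b (koszul π (vdo q s f) - (vdo q (koszulL π ∘ₗ s) f +
        vdo q (parityL R L B ∘ₗ s) (koszul π f))) =
        (koszul π (vdo q (iB b ∘ₗ s) f) - (vdo q (koszulL π ∘ₗ iB b ∘ₗ s) f +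
          vdo q (parityL R L B ∘ₗ iB b ∘ₗ s) (koszul π f))) +
        (koszul π (vdo q s (iB b f)) - (vdo q (koszulL π ∘ₗ s) (iB b f) +
          vdo q (parityL R L B ∘ₗ s) (koszul π (iB b f)))) := by
      rw [map_sub, map_add, iB_koszul, iB_vdo, iB_vdo, iB_vdo, iB_koszul, map_add,
        iB_comp_koszulL]
      have : iB b ∘ₗ parityL R L B ∘ₗ s = parityL R L B ∘ₗ iB b ∘ₗ s := rfl
      rw [this]
      abel
    dsimp only
    rw [this]
    exact add_mem (hW (iB b ∘ₗ s, f)) (hW (s, iB b f))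

theorem vdo_one_mul_of_formDegree_zero {s : SymForm R B 1 →ₗ[R] FormalFun R L B}
    (hs : ∀ β, HasFormDegree 0 (s β)) (f g : FormalFun R L B) :
    vdo 1 s (mul f g) = mul (vdo 1 s f) g + mul f (vdo 1 s g) := by
  rw [← sub_eq_zero]
  refine family_eq_zero_of_contractions
    (fun x : {s : SymForm R B 1 →ₗ[R] FormalFun R L B // ∀ β, HasFormDegree 0 (s β)} ×
        FormalFun R L B × FormalFun R L B =>
      vdo 1 x.1.1 (mul x.2.1 x.2.2) -
        (mul (vdo 1 x.1.1 x.2.1) x.2.2 + mul x.2.1 (vdo 1 x.1.1 x.2.2))) ?_ ?_ ?_ (⟨s, hs⟩, f, g)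
  · rintro ⟨⟨s, hs⟩, f, g⟩
    dsimp only
    rw [map_sub, map_add, c0_mul, c0_mul, c0_vdo, c0_vdo, c0_vdo, comp0_one_mul, map_add, map_smul,
      map_smul, map_add, map_smul, map_smul, smul_eq_mul, smul_eq_mul, mul_comm (c0 g), sub_self]
  · rintro W hW ⟨⟨s, hs⟩, f, g⟩ l
    have h1 : iL l ∘ₗ s = 0 := LinearMap.ext fun β => (hs β).iL_eq_zero l
    have h2 : parityL R L B ∘ₗ s = s := LinearMap.ext fun β => (hs β).parity_zero
    have h3 : ∀ f, iL l (vdo 1 s f) = vdo 1 s (iL l f) := fun f => by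
      rw [iL_vdo, h1, h2, vdo_zero, zero_add]
    have h4 : ∀ f, parity (vdo 1 s f) = vdo 1 s (parity f) := fun f => by rw [parity_vdo, h2]
    have : iL l (vdo 1 s (mul f g) - (mul (vdo 1 s f) g + mul f (vdo 1 s g))) =
        (vdo 1 s (mul (iL l f) g) - (mul (vdo 1 s (iL l f)) g + mul (iL l f) (vdo 1 s g))) +
        (vdo 1 s (mul (parity f) (iL l g)) - (mul (vdo 1 s (parity f)) (iL l g) +
          mul (parity f) (vdo 1 s (iL l g)))) := by
      rw [map_sub, map_add, h3, iL_mul, iL_mul, iL_mul, h3, h3, h4, vdo_add_fun]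
      abel
    dsimp only
    rw [this]
    exact add_mem (hW (⟨s, hs⟩, iL l f, g))
      (hW (⟨s, hs⟩, parity f, iL l g))
  · rintro W hW ⟨⟨s, hs⟩, f, g⟩ b
    have : iB b (vdo 1 s (mul f g) - (mul (vdo 1 s f) g + mul f (vdo 1 s g))) =
        (vdo 1 (iB b ∘ₗ s) (mul f g) - (mul (vdo 1 (iB b ∘ₗ s) f) g +
          mul f (vdo 1 (iB b ∘ₗ s) g))) +
        (vdo 1 s (mul (iB b f) g) - (mul (vdo 1 s (iB b f)) g + mul (iB b f) (vdo 1 s g))) +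
        (vdo 1 s (mul f (iB b g)) - (mul (vdo 1 s f) (iB b g) + mul f (vdo 1 s (iB b g)))) := by
      rw [map_sub, map_add, iB_vdo, iB_mul, iB_mul, iB_mul, iB_vdo, iB_vdo, vdo_add_fun,
        mul_add_left, mul_add_right]
      abel
    dsimp only
    rw [this]
    exact add_mem (add_mem (hW (⟨iB b ∘ₗ s, fun β => (hs β).iB b⟩, f, g))
      (hW (⟨s, hs⟩, iB b f, g))) (hW (⟨s, hs⟩, f, iB b g))

/-- Vertical vector fields of form degree `1` are derivations of degree `1`. -/
theorem vdo_one_mul {s : SymForm R B 1 →ₗ[R] FormalFun R L B}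
    (hs : ∀ β, HasFormDegree 1 (s β)) (f g : FormalFun R L B) :
    vdo 1 s (mul f g) = mul (vdo 1 s f) g + mul (parity f) (vdo 1 s g) := by
  rw [← sub_eq_zero]
  refine family_eq_zero_of_contractions
    (fun x : {s : SymForm R B 1 →ₗ[R] FormalFun R L B // ∀ β, HasFormDegree 1 (s β)} ×
        FormalFun R L B × FormalFun R L B =>
      vdo 1 x.1.1 (mul x.2.1 x.2.2) -
        (mul (vdo 1 x.1.1 x.2.1) x.2.2 + mul (parity x.2.1) (vdo 1 x.1.1 x.2.2)))
      ?_ ?_ ?_ (⟨s, hs⟩, f, g)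
  · rintro ⟨⟨s, hs⟩, f, g⟩
    dsimp only
    rw [map_sub, map_add, c0_mul, c0_mul, c0_vdo, c0_vdo, c0_vdo, (hs _).c0_eq_zero,
      (hs _).c0_eq_zero, (hs _).c0_eq_zero, zero_mul, mul_zero, add_zero, sub_zero]
  · rintro W hW ⟨⟨s, hs⟩, f, g⟩ l
    have h1 : ∀ β, HasFormDegree 0 ((iL l ∘ₗ s) β) := fun β => (hs β).iL l
    have h2 : parityL R L B ∘ₗ s = -s := LinearMap.ext fun β => by
      change parity (s β) = -s β
      rw [(hs β).parity_eq, pow_one, neg_one_smul]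
    have h3 : ∀ f, iL l (vdo 1 s f) = vdo 1 (iL l ∘ₗ s) f - vdo 1 s (iL l f) := fun f => by
      rw [iL_vdo, h2, vdo_neg, sub_eq_add_neg]
    have h4 : ∀ f, parity (vdo 1 s f) = -vdo 1 s (parity f) := fun f => by
      rw [parity_vdo, h2, vdo_neg]
    have : iL l (vdo 1 s (mul f g) - (mul (vdo 1 s f) g + mul (parity f) (vdo 1 s g))) =
        -(vdo 1 s (mul (iL l f) g) - (mul (vdo 1 s (iL l f)) g +
          mul (parity (iL l f)) (vdo 1 s g))) -
        (vdo 1 s (mul (parity f) (iL l g)) - (mul (vdo 1 s (parity f)) (iL l g) +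
          mul (parity (parity f)) (vdo 1 s (iL l g)))) := by
      rw [map_sub, map_add, h3, iL_mul, iL_mul, iL_mul, h3, h3, h4, vdo_add_fun, iL_parity,
        parity_parity, vdo_one_mul_of_formDegree_zero h1, mul_neg_left, mul_neg_left, mul_sub_left,
        mul_sub_right]
      abel
    dsimp only
    rw [this]
    exact sub_mem (neg_mem (hW (⟨s, hs⟩, iL l f, g)))
      (hW (⟨s, hs⟩, parity f, iL l g))
  · rintro W hW ⟨⟨s, hs⟩, f, g⟩ b
    have : iB b (vdo 1 s (mul f g) - (mul (vdo 1 s f) g + mul (parity f) (vdo 1 s g))) =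
        (vdo 1 (iB b ∘ₗ s) (mul f g) - (mul (vdo 1 (iB b ∘ₗ s) f) g +
          mul (parity f) (vdo 1 (iB b ∘ₗ s) g))) +
        (vdo 1 s (mul (iB b f) g) - (mul (vdo 1 s (iB b f)) g +
          mul (parity (iB b f)) (vdo 1 s g))) +
        (vdo 1 s (mul f (iB b g)) - (mul (vdo 1 s f) (iB b g) +
          mul (parity f) (vdo 1 s (iB b g)))) := by
      rw [map_sub, map_add, iB_vdo, iB_mul, iB_mul, iB_mul, iB_vdo, iB_vdo, vdo_add_fun,
        mul_add_left, mul_add_right, iB_parity]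
      abel
    dsimp only
    rw [this]
    exact add_mem (add_mem (hW (⟨iB b ∘ₗ s, fun β => (hs β).iB b⟩, f, g))
      (hW (⟨s, hs⟩, iB b f, g))) (hW (⟨s, hs⟩, f, iB b g))

end
end
end Fedosov

namespace Fedosov
noncomputable section

/-! ### The homotopy operator -/

section
variable {R L B : Type*} [CommRing R] [Algebra ℚ R] [AddCommGroup L] [Module R L] [AddCommGroup B]
  [Module R B]

theorem symProd_zero_left {j m : ℕ} (h : 0 + j = m)
    (G : MultilinearMap R (fun _ : Fin 0 => B) (SymForm R B j)) (v : Fin m → B) :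
    symProd h G v = G ![] (fun i => v (Fin.cast h (Fin.natAdd 0 i))) := by
  subst h
  refine eq_of_nsmul_eq R (mul_ne_zero (0).factorial_ne_zero j.factorial_ne_zero) ?_
  rw [nsmul_symProd_apply, shuffleSum]
  have key : ∀ σ : Equiv.Perm (Fin (0 + j)), ((Equiv.Perm.sign σ ^ 0 : ℤˣ) •
      G (fun i => v (σ (Fin.cast rfl (Fin.castAdd j i))))
        (fun i => v (σ (Fin.cast rfl (Fin.natAdd 0 i))))) =
      G ![] (fun i => v (Fin.cast rfl (Fin.natAdd 0 i))) := by
    intro σ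
    rw [pow_zero, one_smul, Subsingleton.elim (fun i : Fin 0 => v (σ (Fin.cast rfl
      (Fin.castAdd j i)))) ![]]
    let e : Fin j ≃ Fin (0 + j) := finCongr (zero_add j).symm
    have he : ∀ i, Fin.cast rfl (Fin.natAdd 0 i) = e i := fun i => by
      ext
      simp [e]
    refine Eq.trans ?_ ((G ![]).symm (e.symm.permCongr σ) _)
    congr 1
    funext i
    simp only [he, Equiv.permCongr_apply, Equiv.symm_symm, Equiv.apply_symm_apply]
  rw [Finset.sum_congr rfl fun σ _ => key σ, Finset.sum_const, Finset.card_univ, Fintype.card_perm,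
    Fintype.card_fin, Nat.factorial_zero, one_mul]
  congr 2
  exact zero_add j

/-- The vector field `∑ η^i ∂/∂ξ^i` of a splitting as an operator on the function algebra. -/
def dualVF (ib : B →ₗ[R] L) : FormalFun R L B →ₗ[R] FormalFun R L B where
  toFun f
    | _, 0 => 0
    | p, k + 1 => koszulDual ib p k (f (p + 1) k)
  map_add' f g := by
    funext p k
    cases k with
    | zero => simp
    | succ k => simp
  map_smul' c f := by
    funext p k
    cases k with
    | zero => simp
    | succ k => simp

theorem koszulDual_apply (ib : B →ₗ[R] L) (p k : ℕ) (w : Form R L B (p + 1) k) (v : Fin p → L) :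
    koszulDual ib p k w v = symProd (Nat.add_comm 1 k)
      (MultilinearMap.ofSubsingletonₗ R R B (SymForm R B k) (0 : Fin 1)
        (flipAlt (w.curryLeft.comp ib) v)) := rfl

theorem insertB_koszulDual (ib : B →ₗ[R] L) (f : FormalFun R L B) (p k : ℕ) (v : Fin p → L) (b : B)
    (u : Fin k → B) :
    koszulDual ib p k (f (p + 1) k) v (Fin.cons b u) =
      f (p + 1) k (Fin.cons (ib b) v) u + dualVF ib (iB b f) p k v u := by
  rw [koszulDual_apply]
  set G := MultilinearMap.ofSubsingletonₗ R R B (SymForm R B k) (0 : Fin 1)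
        (flipAlt ((f (p + 1) k).curryLeft.comp ib) v) with hG
  have hGs : IsSymm G := fun σ v => by rw [Subsingleton.elim σ 1]; rfl
  have h0 : ∀ (h : 0 + k = k) , symProd h (G.curryLeft b) u =
      f (p + 1) k (Fin.cons (ib b) v) u := by
    intro h
    rw [symProd_zero_left]
    have : G.curryLeft b ![] = f (p + 1) k (Fin.cons (ib b) v) := rfl
    rw [this]
    congr 1
    funext i
    congr 1
    ext
    simp
  cases k with
  | zero =>
    change insertB 0 b (symProd (Nat.add_comm 1 0) G) u = _
    rw [insertB_symProd_succ_zero (r := 0) (m := 0) _ rfl hGs, h0]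
    exact (add_zero _).symm
  | succ k =>
    change insertB (k + 1) b (symProd (Nat.add_comm 1 (k + 1)) G) u = _
    rw [insertB_symProd_succ_succ (r := 0) (j := k) (m := k + 1) _ (zero_add _)
      (by omega) hGs, map_add, _root_.add_apply, h0]
    rfl

theorem iL_dualVF (ib : B →ₗ[R] L) (l : L) (f : FormalFun R L B) :
    iL l (dualVF ib f) = -dualVF ib (iL l f) := by
  funext p k
  cases k with
  | zero =>
    change (0 : Form R L B (p + 1) 0).curryLeft l = -(0 : Form R L B p 0)
    rw [neg_zero]
    rfl
  | succ k =>
    refine AlternatingMap.ext fun v => ?_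
    change koszulDual ib (p + 1) k (f (p + 1 + 1) k) (Fin.cons l v) =
      -koszulDual ib p k ((f (p + 1 + 1) k).curryLeft l) v
    rw [koszulDual_apply, koszulDual_apply, ← map_neg, ← map_neg]
    congr 2
    ext b : 1
    change f (p + 1 + 1) k (Fin.cons (ib b) (Fin.cons l v)) =
      -f (p + 1 + 1) k (Fin.cons l (Fin.cons (ib b) v))
    rw [← AlternatingMap.map_swap _ _ (show (0 : Fin (p + 2)) ≠ 1 by simp)]
    congr 1
    funext x
    refine Fin.cases ?_ (fun x => ?_) x
    · simp
    · refine Fin.cases ?_ (fun x => ?_) x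
      · simp
      · simp only [Function.comp_apply, Fin.cons_succ]
        rw [Equiv.swap_apply_of_ne_of_ne (Fin.succ_ne_zero _) (by simp [Fin.ext_iff])]
        simp

theorem iB_dualVF (ib : B →ₗ[R] L) (b : B) (f : FormalFun R L B) :
    iB b (dualVF ib f) = iL (ib b) f + dualVF ib (iB b f) :=
  formalFun_ext fun p k v u => insertB_koszulDual ib f p k v b u

theorem c0_dualVF (ib : B →ₗ[R] L) (f : FormalFun R L B) : c0 (dualVF ib f) = 0 := rfl

/-! ### Operators depending on the bidegree -/

/-- The operator which multiplies the sections of `Λ^{p₁} A^∨ ⊗ Λ^{p₂} B^∨ ⊗ S^q B^∨` by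
`c (p₂ + q)`. -/
def weight (π : L →ₗ[R] B) (ib : B →ₗ[R] L) (c : ℕ → ℚ) : FormalFun R L B →ₗ[R] FormalFun R L B where
  toFun f := fun p k => ∑ t ∈ Finset.range (p + 1),
    algebraMap ℚ R (c (t + k)) • bidegree π ib t (f p k)
  map_add' f g := by
    funext p k
    simp [Finset.sum_add_distrib]
  map_smul' c f := by
    funext p k
    simp [Finset.smul_sum, smul_comm c]

section
variable (π : L →ₗ[R] B) (ib : B →ₗ[R] L)

omit [Algebra ℚ R] in
theorem bidegree_apply {n : ℕ} (t : ℕ) (f : FormalFun R L B) (k : ℕ) (v : Fin n → L)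
    (w : Fin k → B) :
    bidegree π ib t (f n k) v w = ∑ T ∈ (Finset.univ : Finset (Fin n)).powersetCard t,
      f n k (fun i => if i ∈ T then ib (π (v i)) else v i - ib (π (v i))) w := by
  have h1 : bidegree π ib t (f n k) v = ∑ T ∈ (Finset.univ : Finset (Fin n)).powersetCard t,
      f n k (fun i => (if i ∈ T then ib ∘ₗ π else LinearMap.id - ib ∘ₗ π) (v i)) := by
    change (∑ T ∈ (Finset.univ : Finset (Fin n)).powersetCard t,
        ((f n k).toMultilinearMap).compLinearMap
          (fun i => if i ∈ T then ib ∘ₗ π else LinearMap.id - ib ∘ₗ π)) v = _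
    rw [_root_.sum_apply]
    rfl
  rw [h1, map_sum, _root_.sum_apply]
  refine Finset.sum_congr rfl fun T _ => ?_
  congr 3
  funext i
  split_ifs <;> rfl

omit [Algebra ℚ R] in
theorem alternating_sum_apply {N ι : Type*} [AddCommGroup N] [Module R N] {n : ℕ} (s : Finset ι)
    (F : ι → L [⋀^Fin n]→ₗ[R] N) (v : Fin n → L) : (∑ i ∈ s, F i) v = ∑ i ∈ s, F i v :=
  map_sum ({ toFun := fun a => a v, map_zero' := rfl, map_add' := fun _ _ => rfl } :
    (L [⋀^Fin n]→ₗ[R] N) →+ N) F s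

theorem weight_apply (c : ℕ → ℚ) (f : FormalFun R L B) (p k : ℕ) (v : Fin p → L) (w : Fin k → B) :
    weight π ib c f p k v w = ∑ T : Finset (Fin p), algebraMap ℚ R (c (T.card + k)) *
      f p k (fun i => if i ∈ T then ib (π (v i)) else v i - ib (π (v i))) w := by
  have h1 : weight π ib c f p k v w = ∑ t ∈ Finset.range (p + 1),
      algebraMap ℚ R (c (t + k)) * bidegree π ib t (f p k) v w := by
    change (∑ t ∈ Finset.range (p + 1),
      algebraMap ℚ R (c (t + k)) • bidegree π ib t (f p k)) v w = _
    rw [alternating_sum_apply, map_sum, _root_.sum_apply]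
    rfl
  rw [h1, ← Finset.powerset_univ, Finset.sum_powerset, Finset.card_univ, Fintype.card_fin]
  refine Finset.sum_congr rfl fun t _ => ?_
  rw [bidegree_apply, Finset.mul_sum]
  refine Finset.sum_congr rfl fun T hT => ?_
  rw [(Finset.mem_powersetCard.1 hT).2]

theorem sum_finset_fin_succ {N : Type*} [AddCommMonoid N] {n : ℕ} (F : Finset (Fin (n + 1)) → N) :
    ∑ T, F T = ∑ T : Finset (Fin n), F (T.map (Fin.succEmb n)) +
      ∑ T : Finset (Fin n), F (insert 0 (T.map (Fin.succEmb n))) := by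
  have h0 : (0 : Fin (n + 1)) ∉ (Finset.univ : Finset (Fin n)).map (Fin.succEmb n) := by simp
  have h1 : (Finset.univ : Finset (Fin (n + 1))) =
      insert 0 ((Finset.univ : Finset (Fin n)).map (Fin.succEmb n)) := by
    ext x
    refine Fin.cases ?_ (fun x => ?_) x <;> simp
  have h2 : ∀ G : Finset (Fin (n + 1)) → N,
      ∑ T ∈ ((Finset.univ : Finset (Fin n)).map (Fin.succEmb n)).powerset, G T =
      ∑ T : Finset (Fin n), G (T.map (Fin.succEmb n)) := by
    intro G
    symm
    refine Finset.sum_nbij (fun T => T.map (Fin.succEmb n)) ?_ ?_ ?_ ?_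
    · intro T _
      rw [Finset.mem_powerset]
      exact Finset.map_subset_map.2 (Finset.subset_univ T)
    · intro T _ T' _ h
      exact Finset.map_injective _ h
    · intro T hT
      rw [Finset.mem_coe, Finset.mem_powerset, Finset.subset_map_iff] at hT
      obtain ⟨u, -, rfl⟩ := hT
      exact ⟨u, by simp, rfl⟩
    · intro T _
      rfl
  rw [← Finset.powerset_univ, h1, Finset.sum_powerset_insert h0, h2, h2]

theorem iL_weight (c : ℕ → ℚ) (l : L) (f : FormalFun R L B) :
    iL l (weight π ib c f) = weight π ib c (iL (l - ib (π l)) f) +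
      weight π ib (fun n => c (n + 1)) (iL (ib (π l)) f) := by
  refine formalFun_ext fun p k v w => ?_
  have h1 : ∀ g g' : FormalFun R L B, (g + g') p k v w = g p k v w + g' p k v w := fun _ _ => rfl
  rw [h1, iL_apply, weight_apply, weight_apply, weight_apply, sum_finset_fin_succ]
  congr 1
  · refine Finset.sum_congr rfl fun T _ => ?_
    rw [Finset.card_map, iL_apply]
    congr 4
    funext i
    refine Fin.cases ?_ (fun i => ?_) i <;> simp
  · refine Finset.sum_congr rfl fun T _ => ?_
    rw [Finset.card_insert_of_notMem (by simp), Finset.card_map, iL_apply, Nat.add_right_comm]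
    congr 4
    funext i
    refine Fin.cases ?_ (fun i => ?_) i <;> simp

theorem iB_weight (c : ℕ → ℚ) (b : B) (f : FormalFun R L B) :
    iB b (weight π ib c f) = weight π ib (fun n => c (n + 1)) (iB b f) := by
  refine formalFun_ext fun p k v w => ?_
  rw [iB_apply, weight_apply, weight_apply]
  rfl

theorem c0_weight (c : ℕ → ℚ) (f : FormalFun R L B) :
    c0 (weight π ib c f) = algebraMap ℚ R (c 0) * c0 f := by
  rw [c0_apply, weight_apply, Fintype.sum_unique]
  congr 1
  exact congrArg (fun v => f 0 0 v ![]) (Subsingleton.elim _ _)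

theorem weight_add (c c' : ℕ → ℚ) (f : FormalFun R L B) :
    weight π ib (fun n => c n + c' n) f = weight π ib c f + weight π ib c' f := by
  funext p k
  refine AlternatingMap.ext fun v => SymForm.ext fun w => ?_
  change weight π ib (fun n => c n + c' n) f p k v w =
    weight π ib c f p k v w + weight π ib c' f p k v w
  simp only [weight_apply, map_add, add_mul, Finset.sum_add_distrib]

theorem weight_one (f : FormalFun R L B) : weight π ib (fun _ => 1) f = f := by
  rw [← sub_eq_zero]
  refine family_eq_zero_of_contractions
    (fun f : FormalFun R L B => weight π ib (fun _ => 1) f - f) ?_ ?_ ?_ f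
  · intro f
    rw [map_sub, c0_weight, map_one, one_mul, sub_self]
  · intro W hW f l
    have : iL l (weight π ib (fun _ => 1) f - f) =
        weight π ib (fun _ => 1) (iL l f) - iL l f := by
      rw [map_sub, iL_weight, ← map_add]
      congr 2
      refine formalFun_ext fun p k v w => ?_
      change f (p + 1) k (Fin.cons (l - ib (π l)) v) w + f (p + 1) k (Fin.cons (ib (π l)) v) w =
        f (p + 1) k (Fin.cons l v) w
      have h2 := (f (p + 1) k).map_update_add (Fin.cons l v) 0 (l - ib (π l)) (ib (π l))
      rw [sub_add_cancel, Fin.update_cons_zero, Fin.update_cons_zero, Fin.update_cons_zero] at h2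
      rw [h2]
      rfl
    rw [this]
    exact hW (iL l f)
  · intro W hW f b
    have : iB b (weight π ib (fun _ => 1) f - f) =
        weight π ib (fun _ => 1) (iB b f) - iB b f := by
      rw [map_sub, iB_weight]
    rw [this]
    exact hW (iB b f)

omit [Algebra ℚ R] in
theorem iL_add (l l' : L) (f : FormalFun R L B) : iL (l + l') f = iL l f + iL l' f := by
  funext p k
  exact map_add (f (p + 1) k).curryLeft l l'

omit [Algebra ℚ R] in
theorem iL_zero (f : FormalFun R L B) : iL (0 : L) f = 0 := by
  funext p k
  exact map_zero (f (p + 1) k).curryLeft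

omit [Algebra ℚ R] in
theorem iB_zero (f : FormalFun R L B) : iB (0 : B) f = 0 := by
  refine formalFun_ext fun p k v w => ?_
  change insertB k 0 (f p (k + 1) v) w = 0
  rw [map_zero]
  rfl

variable {π ib} (hib : ∀ b, π (ib b) = b)
include hib

theorem weight_weight (c c' : ℕ → ℚ) (f : FormalFun R L B) :
    weight π ib c (weight π ib c' f) = weight π ib (fun n => c n * c' n) f := by
  rw [← sub_eq_zero]
  refine family_eq_zero_of_contractions (fun x : (ℕ → ℚ) × (ℕ → ℚ) × FormalFun R L B =>
    weight π ib x.1 (weight π ib x.2.1 x.2.2) - weight π ib (fun n => x.1 n * x.2.1 n) x.2.2)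
    ?_ ?_ ?_ (c, c', f)
  · rintro ⟨c, c', f⟩
    dsimp only
    rw [map_sub, c0_weight, c0_weight, c0_weight, map_mul, mul_assoc, sub_self]
  · rintro W hW ⟨c, c', f⟩ l
    have : iL l (weight π ib c (weight π ib c' f) - weight π ib (fun n => c n * c' n) f) =
        (weight π ib c (weight π ib c' (iL (l - ib (π l)) f)) -
          weight π ib (fun n => c n * c' n) (iL (l - ib (π l)) f)) +
        (weight π ib (fun n => c (n + 1)) (weight π ib (fun n => c' (n + 1)) (iL (ib (π l)) f)) -
          weight π ib (fun n => c (n + 1) * c' (n + 1)) (iL (ib (π l)) f)) := by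
      rw [map_sub, iL_weight, iL_weight, iL_weight, iL_weight, map_sub π, hib, sub_self,
        sub_self, map_zero, sub_zero, iL_zero, map_zero, map_zero, add_zero, zero_add]
      abel
    dsimp only
    rw [this]
    exact add_mem (hW (c, c', iL (l - ib (π l)) f))
      (hW (fun n => c (n + 1), fun n => c' (n + 1), iL (ib (π l)) f))
  · rintro W hW ⟨c, c', f⟩ b
    dsimp only
    rw [map_sub, iB_weight, iB_weight, iB_weight]
    exact hW (fun n => c (n + 1), fun n => c' (n + 1), iB b f)

theorem weight_koszul (c : ℕ → ℚ) (f : FormalFun R L B) :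
    weight π ib c (koszul π f) = koszul π (weight π ib c f) := by
  rw [← sub_eq_zero]
  refine family_eq_zero_of_contractions (fun x : (ℕ → ℚ) × FormalFun R L B =>
    weight π ib x.1 (koszul π x.2) - koszul π (weight π ib x.1 x.2)) ?_ ?_ ?_ (c, f)
  · rintro ⟨c, f⟩
    dsimp only
    rw [map_sub, c0_weight, c0_koszul, c0_koszul, mul_zero, sub_self]
  · rintro W hW ⟨c, f⟩ l
    have : iL l (weight π ib c (koszul π f) - koszul π (weight π ib c f)) =
        -(weight π ib c (koszul π (iL (l - ib (π l)) f)) -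
          koszul π (weight π ib c (iL (l - ib (π l)) f))) -
        (weight π ib (fun n => c (n + 1)) (koszul π (iL (ib (π l)) f)) -
          koszul π (weight π ib (fun n => c (n + 1)) (iL (ib (π l)) f))) := by
      rw [map_sub, iL_weight, iL_koszul, iL_koszul, iL_koszul, iL_weight, iB_weight, map_sub π, hib,
        sub_self, iB_zero, map_sub (weight π ib _), map_sub (weight π ib _), map_zero,
        map_add (koszul π)]
      abel
    dsimp only
    rw [this]
    exact sub_mem (neg_mem (hW (c, iL (l - ib (π l)) f)))
      (hW (fun n => c (n + 1), iL (ib (π l)) f))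
  · rintro W hW ⟨c, f⟩ b
    dsimp only
    rw [map_sub, iB_weight, iB_koszul, iB_koszul, iB_weight]
    exact hW (fun n => c (n + 1), iB b f)

theorem dualVF_koszul_add (f : FormalFun R L B) :
    dualVF ib (koszul π f) + koszul π (dualVF ib f) = weight π ib (fun n => n) f := by
  rw [← sub_eq_zero]
  refine family_eq_zero_of_contractions (fun f : FormalFun R L B =>
    dualVF ib (koszul π f) + koszul π (dualVF ib f) - weight π ib (fun n => n) f) ?_ ?_ ?_ f
  · intro f
    rw [map_sub, map_add, c0_dualVF, c0_koszul, c0_weight, Nat.cast_zero, map_zero, zero_mul,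
      add_zero, sub_zero]
  · intro W hW f l
    have : iL l (dualVF ib (koszul π f) + koszul π (dualVF ib f) - weight π ib (fun n => n) f) =
        dualVF ib (koszul π (iL l f)) + koszul π (dualVF ib (iL l f)) -
          weight π ib (fun n => n) (iL l f) := by
      have h1 : weight π ib (fun n : ℕ => ((n + 1 : ℕ) : ℚ)) (iL (ib (π l)) f) =
          weight π ib (fun n => n) (iL (ib (π l)) f) + iL (ib (π l)) f := by
        simp only [Nat.cast_add, Nat.cast_one]
        rw [weight_add, weight_one]
      have h2 : iL l f = iL (l - ib (π l)) f + iL (ib (π l)) f := by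
        rw [← iL_add, sub_add_cancel]
      have h3 : weight π ib (fun n => n) (iL l f) = weight π ib (fun n => n) (iL (l - ib (π l)) f) +
          weight π ib (fun n => n) (iL (ib (π l)) f) := by
        rw [h2, map_add]
      rw [map_sub, map_add, iL_dualVF, iL_koszul, iL_koszul, iL_dualVF, iB_dualVF, iL_weight, h1, h3,
        map_sub (dualVF ib), map_neg (koszul π)]
      abel
    rw [this]
    exact hW (iL l f)
  · intro W hW f b
    have : iB b (dualVF ib (koszul π f) + koszul π (dualVF ib f) - weight π ib (fun n => n) f) =
        dualVF ib (koszul π (iB b f)) + koszul π (dualVF ib (iB b f)) -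
          weight π ib (fun n => n) (iB b f) := by
      have h1 : weight π ib (fun n : ℕ => ((n + 1 : ℕ) : ℚ)) (iB b f) =
          weight π ib (fun n => n) (iB b f) + iB b f := by
        simp only [Nat.cast_add, Nat.cast_one]
        rw [weight_add, weight_one]
      rw [map_sub, map_add, iB_dualVF, iB_koszul, iB_koszul, iB_dualVF, iL_koszul, iB_weight, h1,
        hib, map_add (koszul π)]
      abel
    rw [this]
    exact hW (iB b f)

omit hib in
theorem homotopy_eq (f : FormalFun R L B) :
    homotopy π ib f = dualVF ib (weight π ib (fun n => (n : ℚ)⁻¹) f) := by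
  funext p k
  cases k with
  | zero => rfl
  | succ k =>
    change ∑ t ∈ Finset.range (p + 2),
        algebraMap ℚ R ((t + k : ℕ) : ℚ)⁻¹ • koszulDual ib p k (bidegree π ib t (f (p + 1) k)) =
      koszulDual ib p k (∑ t ∈ Finset.range (p + 2),
        algebraMap ℚ R ((t + k : ℕ) : ℚ)⁻¹ • bidegree π ib t (f (p + 1) k))
    rw [map_sum]
    refine Finset.sum_congr rfl fun t _ => ?_
    rw [map_smul]

omit hib in
variable (π ib) in
/-- The projection onto the components in `Λ^• A^∨ ⊗ S^0 B^∨`. -/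
def proj00 : FormalFun R L B →ₗ[R] FormalFun R L B :=
  weight π ib (fun n => if n = 0 then 1 else 0)

/-- The homotopy operator contracts the Koszul complex onto `Λ^• A^∨`. -/
theorem homotopy_koszul_add (f : FormalFun R L B) :
    homotopy π ib (koszul π f) + koszul π (homotopy π ib f) = f - proj00 π ib f := by
  rw [homotopy_eq, homotopy_eq, weight_koszul hib, dualVF_koszul_add hib, weight_weight hib,
    eq_sub_iff_add_eq, proj00, ← weight_add]
  refine Eq.trans ?_ (weight_one π ib f)
  congr 2
  funext n
  split_ifs with h
  · simp [h]
  · rw [mul_inv_cancel₀ (by exact_mod_cast h), add_zero]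

omit hib in
theorem proj00_eq_zero {f : FormalFun R L B}
    (h : ∀ (p : ℕ) (v : Fin p → L), (∀ i, π (v i) = 0) → f p 0 v ![] = 0)
    (hib : ∀ b, π (ib b) = b) : proj00 π ib f = 0 := by
  refine formalFun_ext fun p k v w => ?_
  rw [proj00, weight_apply]
  refine Finset.sum_eq_zero fun T _ => ?_
  split_ifs with h0
  · obtain ⟨h1, rfl⟩ : T.card = 0 ∧ k = 0 := by omega
    rw [Finset.card_eq_zero] at h1
    subst h1
    have h2 := h p (fun i => v i - ib (π (v i))) fun i => by rw [map_sub, hib, sub_self]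
    rw [Subsingleton.elim w ![]]
    simpa using h2
  · rw [map_zero, zero_mul]

end
end
end
end Fedosov

namespace Fedosov
noncomputable section

/-! ### The covariant derivative -/

section
variable {𝕜 R L B : Type*} [CommRing R] [Algebra ℚ R] [AddCommGroup L] [Module R L]
  [AddCommGroup B] [Module R B] [CommRing 𝕜] [Algebra 𝕜 R] {Λ : LieAlgebroidStructure 𝕜 R L}

namespace LConnection

/-- The map `l ↦ ∇_l b`. -/
def nablaL (D : LConnection Λ B) (b : B) : L →ₗ[R] B where
  toFun l := D.nabla l b
  map_add' l l' := D.add_left l l' b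
  map_smul' c l := D.smul_left c l b

end LConnection

/-- `T` is the Lie derivative along `l` on `Γ(Λ^• L^∨ ⊗ Ŝ B^∨)` for the connection `D` on `B`. -/
def IsLieDerivative (D : LConnection Λ B) (l : L) (T : Op R L B) : Prop :=
  ∀ (f : FormalFun R L B) (p k : ℕ) (v : Fin p → L) (w : Fin k → B),
    T f p k v w = Λ.anchor l (f p k v w) -
      ∑ a : Fin k, f p k v (Function.update w a (D.nabla l (w a))) -
      ∑ j : Fin p, f p k (Function.update v j (Λ.bracket l (v j))) w

variable {D : LConnection Λ B}

namespace IsLieDerivative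

variable {l : L} {T : Op R L B} (hT : IsLieDerivative D l T)
include hT

omit [Algebra ℚ R] in
theorem iL_comm (l' : L) (f : FormalFun R L B) :
    iL l' (T f) = T (iL l' f) - iL (Λ.bracket l l') f := by
  refine formalFun_ext fun p k v w => ?_
  change T f (p + 1) k (Fin.cons l' v) w = T (iL l' f) p k v w - iL (Λ.bracket l l') f p k v w
  rw [hT, hT, Fin.sum_univ_succ, Fin.update_cons_zero]
  simp only [iL_apply, Fin.cons_succ, Fin.cons_zero, Fin.cons_update]
  ring

omit [Algebra ℚ R] in
theorem iB_comm (b : B) (f : FormalFun R L B) :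
    iB b (T f) = T (iB b f) - iB (D.nabla l b) f := by
  refine formalFun_ext fun p k v w => ?_
  change T f p (k + 1) v (Fin.cons b w) = T (iB b f) p k v w - iB (D.nabla l b) f p k v w
  rw [hT, hT, Fin.sum_univ_succ, Fin.update_cons_zero]
  simp only [iB_apply, Fin.cons_succ, Fin.cons_zero, Fin.cons_update]
  ring

omit [Algebra ℚ R] in
theorem c0_eq (f : FormalFun R L B) : c0 (T f) = Λ.anchor l (c0 f) := by
  rw [c0_apply, hT]
  simp [c0_apply]

omit [Algebra ℚ R] in
theorem parity_comm (f : FormalFun R L B) : T (parity f) = parity (T f) := by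
  refine formalFun_ext fun p k v w => ?_
  have h : ∀ v w, parity f p k v w = (-1 : R) ^ p * f p k v w := fun _ _ => rfl
  have h' : parity (T f) p k v w = (-1 : R) ^ p * T f p k v w := rfl
  have h2 : ∀ x : R, Λ.anchor l ((-1 : R) ^ p * x) = (-1 : R) ^ p * Λ.anchor l x := by
    intro x
    rcases neg_one_pow_eq_or R p with h | h <;> simp [h]
  rw [h', hT, hT]
  simp only [h, h2, ← Finset.mul_sum]
  ring

theorem map_mul (f g : FormalFun R L B) : T (mul f g) = mul (T f) g + mul f (T g) := by
  rw [← sub_eq_zero]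
  refine family_eq_zero_of_contractions (fun x : FormalFun R L B × FormalFun R L B =>
    T (mul x.1 x.2) - (mul (T x.1) x.2 + mul x.1 (T x.2))) ?_ ?_ ?_ (f, g)
  · rintro ⟨f, g⟩
    dsimp only
    rw [map_sub, map_add, hT.c0_eq, c0_mul, c0_mul, c0_mul, hT.c0_eq, hT.c0_eq, Derivation.leibniz,
      smul_eq_mul, smul_eq_mul]
    ring
  · rintro W hW ⟨f, g⟩ l'
    have : iL l' (T (mul f g) - (mul (T f) g + mul f (T g))) =
        (T (mul (iL l' f) g) - (mul (T (iL l' f)) g + mul (iL l' f) (T g))) +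
        (T (mul (parity f) (iL l' g)) -
          (mul (T (parity f)) (iL l' g) + mul (parity f) (T (iL l' g)))) := by
      rw [map_sub, map_add, hT.iL_comm, iL_mul, iL_mul, iL_mul, iL_mul, hT.iL_comm, hT.iL_comm,
        hT.parity_comm, map_add T, mul_sub_left, mul_sub_right]
      abel
    dsimp only
    rw [this]
    exact add_mem (hW (iL l' f, g)) (hW (parity f, iL l' g))
  · rintro W hW ⟨f, g⟩ b
    have : iB b (T (mul f g) - (mul (T f) g + mul f (T g))) =
        (T (mul (iB b f) g) - (mul (T (iB b f)) g + mul (iB b f) (T g))) +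
        (T (mul f (iB b g)) - (mul (T f) (iB b g) + mul f (T (iB b g)))) := by
      rw [map_sub, map_add, hT.iB_comm, iB_mul, iB_mul, iB_mul, iB_mul, hT.iB_comm, hT.iB_comm,
        map_add T, mul_sub_left, mul_sub_right]
      abel
    dsimp only
    rw [this]
    exact add_mem (hW (iB b f, g)) (hW (f, iB b g))

end IsLieDerivative

omit [Algebra ℚ R] in
theorem bracketTerm_iB (f : FormalFun R L B) (k : ℕ) (b : B) (w : Fin k → B) (p : ℕ)
    (v : Fin (p + 1) → L) :
    bracketTerm Λ f (k + 1) (Fin.cons b w) p v = bracketTerm Λ (iB b f) k w p v := by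
  cases p with
  | zero => rfl
  | succ p => rfl

omit [Algebra ℚ R] in
theorem alternating_update {p k : ℕ} (g : Form R L B (p + 1) k) (v : Fin (p + 1) → L)
    (j : Fin (p + 1)) (x : L) (w : Fin k → B) :
    g (Function.update v j x) w = (-1 : R) ^ (j : ℕ) * g (Fin.cons x (j.removeNth v)) w := by
  have h := alternating_insertNth g j x (j.removeNth v)
  rw [Fin.insertNth_removeNth] at h
  rw [h, pow_one]
  rcases neg_one_pow_eq_or ℤˣ (j : ℕ) with h1 | h1 <;>
    rcases Nat.even_or_odd (j : ℕ) with h2 | h2 <;>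
    simp_all [h2.neg_one_pow, Units.smul_def]

omit [Algebra ℚ R] in
theorem alternating_cons_cons {p k : ℕ} (g : Form R L B (p + 2) k) (x y : L) (u : Fin p → L)
    (w : Fin k → B) : g (Fin.cons x (Fin.cons y u)) w = -g (Fin.cons y (Fin.cons x u)) w := by
  have h := g.map_swap (Fin.cons y (Fin.cons x u)) (i := 0) (j := 1) (by simp)
  have h1 : (Fin.cons y (Fin.cons x u) : Fin (p + 2) → L) ∘ Equiv.swap 0 1 =
      Fin.cons x (Fin.cons y u) := by
    funext i
    refine Fin.cases ?_ (fun i => Fin.cases ?_ (fun i => ?_) i) i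
    · simp
    · simp
    · rw [Function.comp_apply, Equiv.swap_apply_of_ne_of_ne (Fin.succ_ne_zero _)
        (by simp [Fin.ext_iff])]
      simp
  rw [← h1, h]
  rfl

omit [Algebra ℚ R] in
theorem removeNth_succ_cons {X : Type*} {p : ℕ} (j : Fin (p + 1)) (x : X) (v : Fin (p + 1) → X) :
    j.succ.removeNth (Fin.cons x v : Fin (p + 2) → X) = Fin.cons x (j.removeNth v) := by
  funext i
  refine Fin.cases ?_ (fun i => ?_) i <;> simp [Fin.removeNth]

omit [Algebra ℚ R] in
theorem bracketTerm_cons_zero (f : FormalFun R L B) (k : ℕ) (w : Fin k → B)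
    (l : L) (v : Fin 1 → L) :
    bracketTerm Λ f k w 1 (Fin.cons l v) =
      -∑ j : Fin 1, f 1 k (Function.update v j (Λ.bracket l (v j))) w := by
  simp only [bracketTerm, Fin.sum_univ_succ, alternating_update]
  simp only [Finset.univ_eq_empty, Finset.sum_empty]
  simp
  exact congrArg (fun u => f 1 k (Fin.cons _ u) w) (Subsingleton.elim _ _)

omit [Algebra ℚ R] in
theorem bracketTerm_cons_succ (f : FormalFun R L B) (k : ℕ) (w : Fin k → B) (p : ℕ)
    (l : L) (v : Fin (p + 2) → L) :
    bracketTerm Λ f k w (p + 2) (Fin.cons l v) =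
      -∑ j : Fin (p + 2), f (p + 2) k (Function.update v j (Λ.bracket l (v j))) w -
        bracketTerm Λ (iL l f) k w (p + 1) v := by
  have h0 : ∀ g : Fin (p + 2) → R, (∑ i : Fin (p + 2),
      if i.castSucc < (0 : Fin (p + 3)) then g i else 0) = 0 := by
    intro g
    refine Finset.sum_eq_zero fun i _ => if_neg (Fin.not_lt_zero _)
  rw [bracketTerm, Fin.sum_univ_succ, h0, zero_add, bracketTerm, neg_sub_left,
    ← Finset.sum_add_distrib, ← Finset.sum_neg_distrib]
  refine Finset.sum_congr rfl fun j _ => ?_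
  rw [Fin.sum_univ_succ, neg_add_rev, ← Finset.sum_neg_distrib]
  congr 1
  · rw [if_pos (by simp), alternating_update, removeNth_succ_cons]
    simp [Fin.removeNth_zero, pow_succ]
  · refine Finset.sum_congr rfl fun i _ => ?_
    simp only [← Fin.succ_castSucc, Fin.succ_lt_succ_iff, removeNth_succ_cons, Fin.cons_succ,
      Fin.val_succ, iL_apply]
    split_ifs with hij
    · rw [alternating_cons_cons]
      ring
    · simp

/-- The operator `ι_l d + d ι_l`. -/
def cartan (d : Op R L B) (l : L) : Op R L B where
  toFun f := iL l (d f) + d (iL l f)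
  map_zero' := by simp
  map_add' f g := by
    simp only [map_add]
    abel

variable {d : Op R L B}

namespace IsCovariantDerivative

variable (hd : IsCovariantDerivative D d)
include hd

omit [Algebra ℚ R] in
theorem zero_form (f : FormalFun R L B) (k : ℕ) : d f 0 k = 0 := by
  refine AlternatingMap.ext fun v => SymForm.ext fun w => ?_
  exact (hd f k w).1 v

omit [Algebra ℚ R] in
theorem c0_eq (f : FormalFun R L B) : c0 (d f) = 0 := by
  rw [c0_apply, hd.zero_form]
  rfl

omit [Algebra ℚ R] in
/-- Cartan's formula: `d ι_l + ι_l d` is the Lie derivative along `l`. -/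
theorem isLieDerivative (l : L) :
    IsLieDerivative D l (cartan d l) := by
  intro f p k v w
  change d f (p + 1) k (Fin.cons l v) w + d (iL l f) p k v w = _
  rw [(hd f k w).2, Fin.sum_univ_succ]
  cases p with
  | zero =>
    rw [hd.zero_form]
    have h0 : Fin.removeNth 0 (Fin.cons l v : Fin 1 → L) = v := Subsingleton.elim _ _
    simp [bracketTerm, h0]
  | succ p =>
    rw [(hd (iL l f) k w).2]
    have h0 : Fin.removeNth 0 (Fin.cons l v : Fin (p + 2) → L) = v := by
      simp [Fin.removeNth_zero]
    have h1 : bracketTerm Λ f k w (p + 1) (Fin.cons l v) =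
        -∑ j : Fin (p + 1), f (p + 1) k (Function.update v j (Λ.bracket l (v j))) w -
          bracketTerm Λ (iL l f) k w p v := by
      cases p with
      | zero => rw [bracketTerm_cons_zero]; simp [bracketTerm]
      | succ p => exact bracketTerm_cons_succ f k w p l v
    rw [h1, h0]
    simp only [Fin.val_zero, pow_zero, one_mul, Fin.cons_zero, Fin.val_succ, pow_succ, Fin.cons_succ,
      removeNth_succ_cons, iL_apply, mul_neg, mul_one, neg_mul, Finset.sum_neg_distrib]
    ring

theorem iL_comm (l : L) (f : FormalFun R L B) :
    iL l (d f) = cartan d l f - d (iL l f) :=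
  (add_sub_cancel_right _ _).symm

omit [Algebra ℚ R] in
theorem iB_comm (b : B) (f : FormalFun R L B) :
    iB b (d f) = d (iB b f) - koszul (D.nablaL b) f := by
  refine formalFun_ext fun p k v w => ?_
  change d f p (k + 1) v (Fin.cons b w) = d (iB b f) p k v w - koszul (D.nablaL b) f p k v w
  cases p with
  | zero =>
    rw [hd.zero_form, hd.zero_form]
    exact (sub_zero _).symm
  | succ p =>
    rw [(hd f (k + 1) _).2, (hd (iB b f) k w).2, koszul_apply, bracketTerm_iB, add_sub_right_comm,
      ← Finset.sum_sub_distrib]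
    congr 1
    refine Finset.sum_congr rfl fun i _ => ?_
    rw [Fin.sum_univ_succ, Fin.update_cons_zero]
    simp only [iB_apply, Fin.cons_succ, Fin.cons_zero, Fin.cons_update]
    change _ = _ - (-1) ^ (i : ℕ) * f p (k + 1) (i.removeNth v) (Fin.cons (D.nabla (v i) b) w)
    ring

omit [Algebra ℚ R] in
theorem apply_congr {f g : FormalFun R L B} {p k : ℕ} (h : f p k = g p k) :
    d f (p + 1) k = d g (p + 1) k := by
  refine AlternatingMap.ext fun v => SymForm.ext fun w => ?_
  rw [(hd f k w).2, (hd g k w).2, h]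
  congr 1
  cases p with
  | zero => rfl
  | succ p => rw [bracketTerm, bracketTerm, h]

omit [Algebra ℚ R] in
theorem apply_eq_zero {f : FormalFun R L B} {p k : ℕ} (h : f p k = 0) : d f (p + 1) k = 0 := by
  rw [hd.apply_congr (g := 0) h, map_zero]
  rfl

omit [Algebra ℚ R] in
theorem formDegree {f : FormalFun R L B} {p : ℕ} (hf : HasFormDegree p f) :
    HasFormDegree (p + 1) (d f) := by
  intro p' k h
  cases p' with
  | zero => exact hd.zero_form f k
  | succ p' => exact hd.apply_eq_zero (hf p' k (by omega))

omit [Algebra ℚ R] in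
theorem symDegree {f : FormalFun R L B} {k : ℕ} (hf : HasSymDegree k f) :
    HasSymDegree k (d f) := by
  intro p k' h
  cases p with
  | zero => exact hd.zero_form f k'
  | succ p => exact hd.apply_eq_zero (hf p k' h)

omit [Algebra ℚ R] in
theorem adic {f : FormalFun R L B} {n : ℤ} (hf : f ∈ adic R L B n) : d f ∈ adic R L B n := by
  intro p k h
  cases p with
  | zero => exact hd.zero_form f k
  | succ p => exact hd.apply_eq_zero (hf p k h)

omit [Algebra ℚ R] in
theorem parity_comm (f : FormalFun R L B) : d (parity f) = -parity (d f) := by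
  funext p k
  cases p with
  | zero =>
    change d (parity f) 0 k = -((-1 : R) ^ 0 • d f 0 k)
    rw [hd.zero_form, hd.zero_form, smul_zero, neg_zero]
  | succ p =>
    rcases neg_one_pow_eq_or R p with h | h
    · rw [hd.apply_congr (g := f) (by rw [parity_apply, h, one_smul])]
      change _ = -((-1 : R) ^ (p + 1) • d f (p + 1) k)
      rw [pow_succ, h]
      simp
    · rw [hd.apply_congr (g := -f) (by rw [parity_apply, h, neg_one_smul]; rfl), map_neg]
      change _ = -((-1 : R) ^ (p + 1) • d f (p + 1) k)
      rw [pow_succ, h]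
      simp

theorem map_mul (f g : FormalFun R L B) :
    d (mul f g) = mul (d f) g + mul (parity f) (d g) := by
  rw [← sub_eq_zero]
  refine family_eq_zero_of_contractions (fun x : FormalFun R L B × FormalFun R L B =>
    d (mul x.1 x.2) - (mul (d x.1) x.2 + mul (parity x.1) (d x.2))) ?_ ?_ ?_ (f, g)
  · rintro ⟨f, g⟩
    dsimp only
    rw [map_sub, map_add, hd.c0_eq, c0_mul, c0_mul, hd.c0_eq, hd.c0_eq, zero_mul, mul_zero,
      add_zero, sub_zero]
  · rintro W hW ⟨f, g⟩ l
    have : iL l (d (mul f g) - (mul (d f) g + mul (parity f) (d g))) =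
        -(d (mul (iL l f) g) - (mul (d (iL l f)) g + mul (parity (iL l f)) (d g))) -
        (d (mul (parity f) (iL l g)) -
          (mul (d (parity f)) (iL l g) + mul (parity (parity f)) (d (iL l g)))) := by
      rw [map_sub, map_add, hd.iL_comm, (hd.isLieDerivative l).map_mul, iL_mul, iL_mul, iL_mul,
        hd.iL_comm, hd.iL_comm, hd.parity_comm, map_add d, mul_sub_left, mul_sub_right, iL_parity,
        parity_parity, mul_neg_left, mul_neg_left]
      abel
    dsimp only
    rw [this]
    exact sub_mem (neg_mem (hW (iL l f, g))) (hW (parity f, iL l g))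
  · rintro W hW ⟨f, g⟩ b
    have : iB b (d (mul f g) - (mul (d f) g + mul (parity f) (d g))) =
        (d (mul (iB b f) g) - (mul (d (iB b f)) g + mul (parity (iB b f)) (d g))) +
        (d (mul f (iB b g)) - (mul (d f) (iB b g) + mul (parity f) (d (iB b g)))) := by
      rw [map_sub, map_add, hd.iB_comm, iB_mul, iB_mul, iB_mul, hd.iB_comm, hd.iB_comm,
        koszul_mul, map_add d, mul_sub_left, mul_sub_right, iB_parity]
      abel
    dsimp only
    rw [this]
    exact add_mem (hW (iB b f, g)) (hW (f, iB b g))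

end IsCovariantDerivative

omit [Algebra ℚ R] in
/-- On `Λ^• L^∨` the covariant derivative is the Chevalley–Eilenberg differential, whatever the
connection. -/
theorem IsCovariantDerivative.eq_of_symDegree_zero {D' : LConnection Λ B} {d' : Op R L B}
    (hd : IsCovariantDerivative D d) (hd' : IsCovariantDerivative D' d') {f : FormalFun R L B}
    (hf : HasSymDegree 0 f) : d f = d' f := by
  funext p k
  rcases eq_or_ne k 0 with rfl | hk
  · cases p with
    | zero => rw [hd.zero_form, hd'.zero_form]
    | succ p =>
      refine AlternatingMap.ext fun v => SymForm.ext fun w => ?_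
      rw [(hd f 0 w).2, (hd' f 0 w).2]
      simp
  · rw [hd.symDegree hf p k hk, hd'.symDegree hf p k hk]

end
end
end Fedosov

namespace Fedosov
noncomputable section

/-! ### Functions without form part -/

section
variable {R L B : Type*} [CommRing R] [AddCommGroup L] [Module R L] [AddCommGroup B] [Module R B]

/-- The inclusion of `S^k B^∨` as the functions of form degree `0` and symmetric degree `k`. -/
def incl (k : ℕ) : SymForm R B k →ₗ[R] FormalFun R L B where
  toFun β
    | 0, k' => if h : k = k' then AlternatingMap.constOfIsEmpty R L (Fin 0) (castSym h β) else 0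
    | _ + 1, _ => 0
  map_add' β β' := by
    funext p k'
    cases p with
    | zero =>
      by_cases h : k = k'
      · subst h
        simp [AlternatingMap.ext_iff]
      · simp [h]
    | succ p => exact (add_zero _).symm
  map_smul' c β := by
    funext p k'
    cases p with
    | zero =>
      by_cases h : k = k'
      · subst h
        simp [AlternatingMap.ext_iff]
      · simp [h]
    | succ p => exact (smul_zero (A := Form R L B (p + 1) k') c).symm

theorem incl_apply {k : ℕ} (β : SymForm R B k) (v : Fin 0 → L) :
    (incl k β : FormalFun R L B) 0 k v = β := by
  change (if h : k = k then AlternatingMap.constOfIsEmpty R L (Fin 0) (castSym h β)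
    else (0 : Form R L B 0 k)) v = β
  rw [dif_pos rfl]
  rfl

theorem incl_formDegree {k : ℕ} (β : SymForm R B k) :
    HasFormDegree 0 (incl k β : FormalFun R L B) := by
  intro p k' h
  cases p with
  | zero => exact absurd rfl h
  | succ p => rfl

theorem incl_symDegree {k : ℕ} (β : SymForm R B k) :
    HasSymDegree k (incl k β : FormalFun R L B) := by
  intro p k' h
  cases p with
  | zero => exact dif_neg (Ne.symm h)
  | succ p => rfl

theorem comp0_incl {k : ℕ} (β : SymForm R B k) : comp0 k (incl k β : FormalFun R L B) = β :=
  incl_apply β ![]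

theorem incl_comp0 {k : ℕ} {f : FormalFun R L B} (h0 : HasFormDegree 0 f) (hk : HasSymDegree k f) :
    incl k (comp0 k f) = f := by
  funext p k'
  by_cases hp : p = 0
  · by_cases hk' : k' = k
    · subst hp hk'
      refine AlternatingMap.ext fun v => ?_
      rw [incl_apply, Subsingleton.elim v ![]]
      rfl
    · rw [hk p k' hk', incl_symDegree _ p k' hk']
  · rw [h0 p k' hp, incl_formDegree _ p k' hp]

/-! ### Homogeneous components -/

/-- The component of symmetric degree `k`. -/
def symPart (k : ℕ) : FormalFun R L B →ₗ[R] FormalFun R L B where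
  toFun f := fun p k' => if k' = k then f p k' else 0
  map_add' f g := by
    funext p k'
    by_cases h : k' = k <;> simp [h]
  map_smul' c f := by
    funext p k'
    by_cases h : k' = k <;> simp [h]

/-- The component of form degree `p`. -/
def formPart (p : ℕ) : FormalFun R L B →ₗ[R] FormalFun R L B where
  toFun f := fun p' k => if p' = p then f p' k else 0
  map_add' f g := by
    funext p' k
    by_cases h : p' = p <;> simp [h]
  map_smul' c f := by
    funext p' k
    by_cases h : p' = p <;> simp [h]

theorem symPart_apply (k : ℕ) (f : FormalFun R L B) (p k' : ℕ) :
    symPart k f p k' = if k' = k then f p k' else 0 := rfl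

theorem formPart_apply (p : ℕ) (f : FormalFun R L B) (p' k : ℕ) :
    formPart p f p' k = if p' = p then f p' k else 0 := rfl

theorem symPart_symDegree (k : ℕ) (f : FormalFun R L B) : HasSymDegree k (symPart k f) :=
  fun _ _ h => if_neg h

theorem formPart_formDegree (p : ℕ) (f : FormalFun R L B) : HasFormDegree p (formPart p f) :=
  fun _ _ h => if_neg h

theorem HasSymDegree.formPart {k : ℕ} {f : FormalFun R L B} (hf : HasSymDegree k f) (p : ℕ) :
    HasSymDegree k (formPart p f) := by
  intro p' k' h
  rw [formPart_apply, hf p' k' h, ite_self]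

theorem sub_sum_symPart_mem (f : FormalFun R L B) (m : ℕ) :
    f - ∑ k ∈ Finset.range m, symPart k f ∈ adic R L B m := by
  intro p k h
  have h1 : (∑ i ∈ Finset.range m, symPart i f) p k = ∑ i ∈ Finset.range m, symPart i f p k := by
    rw [Finset.sum_apply, Finset.sum_apply]
  change f p k - (∑ i ∈ Finset.range m, symPart i f) p k = 0
  have h2 : ∑ i ∈ Finset.range m, symPart i f p k = symPart k f p k :=
    Finset.sum_eq_single_of_mem k (by simpa using h) fun i _ hi => if_neg (Ne.symm hi)
  rw [h1, h2, symPart_apply, if_pos rfl, sub_self]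

/-! ### The adic filtration -/

theorem adic_mono {m n : ℤ} (h : m ≤ n) {f : FormalFun R L B} (hf : f ∈ adic R L B n) :
    f ∈ adic R L B m :=
  fun p k hk => hf p k (lt_of_lt_of_le hk h)

theorem mem_adic_of_nonpos {n : ℤ} (h : n ≤ 0) (f : FormalFun R L B) : f ∈ adic R L B n :=
  fun p k hk => absurd hk (by omega)

theorem eq_zero_of_mem_adic {f : FormalFun R L B} (h : ∀ n : ℕ, f ∈ adic R L B n) : f = 0 :=
  funext fun p => funext fun k => h (k + 1) p k (by push_cast; omega)

theorem HasSymDegree.mem_adic {k : ℕ} {f : FormalFun R L B} (hf : HasSymDegree k f) :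
    f ∈ adic R L B k :=
  fun p k' h => hf p k' (by omega)

theorem parity_mem_adic {n : ℤ} {f : FormalFun R L B} (hf : f ∈ adic R L B n) :
    parity f ∈ adic R L B n := by
  intro p k h
  rw [parity_apply, hf p k h, smul_zero]

theorem HasFormDegree.parity {p : ℕ} {f : FormalFun R L B} (hf : HasFormDegree p f) :
    HasFormDegree p (parity f) := by
  intro p' k h
  rw [parity_apply, hf p' k h, smul_zero]

theorem HasFormDegree.add {p : ℕ} {f g : FormalFun R L B} (hf : HasFormDegree p f)
    (hg : HasFormDegree p g) : HasFormDegree p (f + g) := by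
  intro p' k h
  change f p' k + g p' k = 0
  rw [hf p' k h, hg p' k h, add_zero]

theorem HasFormDegree.neg {p : ℕ} {f : FormalFun R L B} (hf : HasFormDegree p f) :
    HasFormDegree p (-f) := by
  intro p' k h
  change -f p' k = 0
  rw [hf p' k h, neg_zero]

theorem HasFormDegree.sub {p : ℕ} {f g : FormalFun R L B} (hf : HasFormDegree p f)
    (hg : HasFormDegree p g) : HasFormDegree p (f - g) := by
  rw [sub_eq_add_neg]
  exact hf.add hg.neg

theorem hasFormDegree_zero (p : ℕ) : HasFormDegree p (0 : FormalFun R L B) := fun _ _ _ => rfl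

theorem HasFormDegree.sum {ι : Type*} {s : Finset ι} {p : ℕ} {f : ι → FormalFun R L B}
    (hf : ∀ i ∈ s, HasFormDegree p (f i)) : HasFormDegree p (∑ i ∈ s, f i) := by
  classical
  induction s using Finset.induction_on with
  | empty => exact hasFormDegree_zero p
  | insert i s hi ih =>
    rw [Finset.sum_insert hi]
    exact (hf i (Finset.mem_insert_self i s)).add
      (ih fun j hj => hf j (Finset.mem_insert_of_mem hj))

/-! ### Degrees and order of the Koszul vector field -/

section
variable (π : L →ₗ[R] B)

theorem koszul_eq_zero {f : FormalFun R L B} {p k : ℕ} (h : f p (k + 1) = 0) :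
    koszul π f (p + 1) k = 0 := by
  refine AlternatingMap.ext fun v => SymForm.ext fun w => ?_
  rw [koszul_apply, h]
  exact Finset.sum_eq_zero fun i _ => mul_zero _

theorem koszul_mem_adic {n : ℤ} {f : FormalFun R L B} (hf : f ∈ adic R L B n) :
    koszul π f ∈ adic R L B (n - 1) := by
  intro p k h
  cases p with
  | zero => rfl
  | succ p => exact koszul_eq_zero π (hf p (k + 1) (by push_cast; omega))

theorem koszul_formDegree {p : ℕ} {f : FormalFun R L B} (hf : HasFormDegree p f) :
    HasFormDegree (p + 1) (koszul π f) := by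
  intro p' k h
  cases p' with
  | zero => rfl
  | succ p' => exact koszul_eq_zero π (hf p' (k + 1) (by omega))

theorem koszul_symDegree_zero {f : FormalFun R L B} (hf : HasSymDegree 0 f) : koszul π f = 0 := by
  funext p k
  cases p with
  | zero => rfl
  | succ p => exact koszul_eq_zero π (hf p (k + 1) (Nat.succ_ne_zero k))

end
end

section
variable {R L B : Type*} [CommRing R] [Algebra ℚ R] [AddCommGroup L] [Module R L] [AddCommGroup B]
  [Module R B]

/-! ### Degrees and order of products -/

theorem mul_eq_zero_of {f g : FormalFun R L B} {n m : ℕ}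
    (h : ∀ p p' j j', p + p' = n → j + j' = m → f p j = 0 ∨ g p' j' = 0) : mul f g n m = 0 := by
  rw [mul_eq]
  refine adSum_eq_zero fun p p' hp => adSum_eq_zero fun j j' hj => ?_
  rcases h p p' j j' hp hj with h | h
  · rw [h, wedge_zero_left]
  · rw [h, wedge_zero_right]

theorem mul_mem_adic {a b : ℤ} {f g : FormalFun R L B} (hf : f ∈ adic R L B a)
    (hg : g ∈ adic R L B b) : mul f g ∈ adic R L B (a + b) := by
  intro n m h
  refine mul_eq_zero_of fun p p' j j' _ hj => ?_
  by_cases hja : (j : ℤ) < a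
  · exact Or.inl (hf p j hja)
  · exact Or.inr (hg p' j' (by omega))

theorem mul_mem_adic_left {a : ℤ} {f g : FormalFun R L B} (hf : f ∈ adic R L B a) :
    mul f g ∈ adic R L B a := by
  simpa using mul_mem_adic hf (mem_adic_of_nonpos le_rfl g)

theorem mul_mem_adic_right {a : ℤ} {f g : FormalFun R L B} (hg : g ∈ adic R L B a) :
    mul f g ∈ adic R L B a := by
  simpa using mul_mem_adic (mem_adic_of_nonpos le_rfl f) hg

theorem mul_formDegree {p p' : ℕ} {f g : FormalFun R L B} (hf : HasFormDegree p f)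
    (hg : HasFormDegree p' g) : HasFormDegree (p + p') (mul f g) := by
  intro n m h
  refine mul_eq_zero_of fun a a' j j' ha _ => ?_
  by_cases hap : a = p
  · exact Or.inr (hg a' j' (by omega))
  · exact Or.inl (hf a j hap)

theorem mul_smul_one (c : R) (f : FormalFun R L B) : mul f (c • one R L B) = c • f := by
  rw [mul_smul_right, mul_one']

/-- One-forms commute with functions up to the parity. -/
theorem mul_comm_of_formDegree_one {e : FormalFun R L B} (h1 : HasFormDegree 1 e)
    (f : FormalFun R L B) : mul e f = mul (parity f) e := by
  rw [← sub_eq_zero]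
  refine family_eq_zero_of_contractions
    (fun x : FormalFun R L B × {e : FormalFun R L B // HasFormDegree 1 e} =>
      mul x.2.1 x.1 - mul (parity x.1) x.2.1) ?_ ?_ ?_ (f, ⟨e, h1⟩)
  · rintro ⟨f, e, h1⟩
    simp only [map_sub, c0_mul, h1.c0_eq_zero, mul_zero, zero_mul, sub_self]
  · rintro W hW ⟨f, e, h1⟩ l
    have : iL l (mul e f - mul (parity f) e) =
        -(mul e (iL l f) - mul (parity (iL l f)) e) := by
      rw [map_sub, iL_mul, iL_mul, h1.parity_eq, iL_parity, parity_parity, (h1.iL l).mul_comm,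
        pow_one, neg_one_smul, mul_neg_left, mul_neg_left]
      abel
    dsimp only
    rw [this]
    exact neg_mem (hW (iL l f, ⟨e, h1⟩))
  · rintro W hW ⟨f, e, h1⟩ b
    have : iB b (mul e f - mul (parity f) e) = (mul e (iB b f) - mul (parity (iB b f)) e) +
        (mul (iB b e) f - mul (parity f) (iB b e)) := by
      simp only [map_sub, iB_mul, iB_parity]
      abel
    dsimp only
    rw [this]
    exact add_mem (hW (iB b f, ⟨e, h1⟩)) (hW (f, ⟨iB b e, h1.iB b⟩))

/-! ### Degrees and order of vertical differential operators -/

section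
variable {q : ℕ} {s : SymForm R B q →ₗ[R] FormalFun R L B} {g : FormalFun R L B}

theorem vdo_eq_zero_of {n m : ℕ} (h : ∀ p p' r j, p + p' = n → r + j = m →
    (∀ β, s β p j = 0) ∨ g p' (r + q) = 0) : vdo q s g n m = 0 := by
  rw [vdo_eq]
  refine adSum_eq_zero fun p p' hp => adSum_eq_zero fun r j hj => ?_
  rcases h p p' r j hp hj with h | h
  · have : coef s p j = 0 := by
      refine AlternatingMap.ext fun v => LinearMap.ext fun β => ?_
      change s β p j v = 0
      rw [h]
      rfl
    rw [this, wedge_zero_left]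
  · rw [h, wedge_zero_right]

theorem vdo_mem_adic {a b : ℤ} (hs : ∀ β, s β ∈ adic R L B a) (hg : g ∈ adic R L B b) :
    vdo q s g ∈ adic R L B (a + b - q) := by
  intro n m h
  refine vdo_eq_zero_of fun p p' r j _ hj => ?_
  by_cases hja : (j : ℤ) < a
  · exact Or.inl fun β => hs β p j hja
  · exact Or.inr (hg p' (r + q) (by push_cast; omega))

theorem vdo_mem_adic_coeff {a : ℤ} (hs : ∀ β, s β ∈ adic R L B a) (g : FormalFun R L B) :
    vdo q s g ∈ adic R L B a := by
  intro n m h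
  exact vdo_eq_zero_of fun p p' r j _ hj => Or.inl fun β => hs β p j (by omega)

theorem vdo_mem_adic_symDegree {k : ℕ} (s : SymForm R B q →ₗ[R] FormalFun R L B)
    (hg : g ∈ adic R L B k) : vdo q s g ∈ adic R L B (k - q) := by
  simpa using vdo_mem_adic (a := 0) (fun β => mem_adic_of_nonpos le_rfl (s β)) hg

theorem vdo_formDegree {a b : ℕ} (hs : ∀ β, HasFormDegree a (s β)) (hg : HasFormDegree b g) :
    HasFormDegree (a + b) (vdo q s g) := by
  intro n m h
  refine vdo_eq_zero_of fun p p' r j hp _ => ?_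
  by_cases hpa : p = a
  · exact Or.inr (hg p' (r + q) (by omega))
  · exact Or.inl fun β => hs β p j hpa

theorem vdo_eq_zero_of_lt (s : SymForm R B q →ₗ[R] FormalFun R L B) {k : ℕ}
    (hg : HasSymDegree k g) (h : k < q) : vdo q s g = 0 := by
  funext n m
  exact vdo_eq_zero_of fun p p' r j _ _ => Or.inr (hg p' (r + q) (by omega))

theorem vdo_incl (s : SymForm R B q →ₗ[R] FormalFun R L B) (β : SymForm R B q) :
    vdo q s (incl q β) = s β := by
  rw [← sub_eq_zero]
  refine family_eq_zero_of_contractions (fun x : SymForm R B q →ₗ[R] FormalFun R L B =>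
    vdo q x (incl q β) - x β) ?_ ?_ ?_ s
  · intro s
    rw [map_sub, c0_vdo, comp0_incl, sub_self]
  · intro W hW s l
    have : iL l (vdo q s (incl q β) - s β) = vdo q (iL l ∘ₗ s) (incl q β) - (iL l ∘ₗ s) β := by
      rw [map_sub, iL_vdo, (incl_formDegree β).iL_eq_zero, vdo_zero_fun, add_zero]
      rfl
    rw [this]
    exact hW _
  · intro W hW s b
    have h0 : vdo q s (iB b (incl q β)) = 0 := by
      funext n m
      refine vdo_eq_zero_of fun p p' r j _ _ => Or.inr ?_
      change (insertB (r + q) b).compAlternatingMap (incl q β p' (r + q + 1)) = 0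
      rw [incl_symDegree β p' (r + q + 1) (by omega)]
      refine AlternatingMap.ext fun v => ?_
      exact map_zero (insertB (r + q) b)
    have : iB b (vdo q s (incl q β) - s β) = vdo q (iB b ∘ₗ s) (incl q β) - (iB b ∘ₗ s) β := by
      rw [map_sub, iB_vdo, h0, add_zero]
      rfl
    rw [this]
    exact hW _

end

/-! ### Degrees and order of the homotopy operator -/

section
variable (π : L →ₗ[R] B) (ib : B →ₗ[R] L)

theorem homotopy_eq_zero {f : FormalFun R L B} {p k : ℕ} (h : f (p + 1) k = 0) :
    homotopy π ib f p (k + 1) = 0 := by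
  change ∑ t ∈ Finset.range (p + 2), algebraMap ℚ R ((t + k : ℕ) : ℚ)⁻¹ •
    koszulDual ib p k (bidegree π ib t (f (p + 1) k)) = 0
  refine Finset.sum_eq_zero fun t _ => ?_
  rw [h, map_zero, map_zero, smul_zero]

theorem homotopy_mem_adic {n : ℤ} {f : FormalFun R L B} (hf : f ∈ adic R L B n) :
    homotopy π ib f ∈ adic R L B (n + 1) := by
  intro p k h
  cases k with
  | zero => rfl
  | succ k => exact homotopy_eq_zero π ib (hf (p + 1) k (by push_cast at h; omega))

theorem homotopy_formDegree {p : ℕ} {f : FormalFun R L B} (hf : HasFormDegree (p + 1) f) :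
    HasFormDegree p (homotopy π ib f) := by
  intro p' k h
  cases k with
  | zero => rfl
  | succ k => exact homotopy_eq_zero π ib (hf (p' + 1) k (by omega))

theorem homotopy_formDegree_zero {f : FormalFun R L B} (hf : HasFormDegree 0 f) :
    homotopy π ib f = 0 := by
  funext p k
  cases k with
  | zero => rfl
  | succ k => exact homotopy_eq_zero π ib (hf (p + 1) k (Nat.succ_ne_zero p))

variable {π ib}

theorem proj00_of_mem_adic (hib : ∀ b, π (ib b) = b) {f : FormalFun R L B}
    (hf : f ∈ adic R L B 1) : proj00 π ib f = 0 := by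
  refine proj00_eq_zero (fun p v _ => ?_) hib
  rw [hf p 0 (by norm_num)]
  rfl

theorem proj00_koszul (hib : ∀ b, π (ib b) = b) (f : FormalFun R L B) :
    proj00 π ib (koszul π f) = koszul π (proj00 π ib f) :=
  weight_koszul hib _ f

end
end
end
end Fedosov

namespace Fedosov
noncomputable section

/-! ### Local frames and vertical operators -/

/-- The module `L` has local frames: there are enough functions `χ` such that `χ • L` is generated by
finitely many sections. For the sections of a vector bundle, these are bump functions with support
in the domain of a trivialization. -/
def HasLocalFrames (R L : Type*) [CommRing R] [AddCommGroup L] [Module R L] : Prop :=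
  ∃ S : Set R, (∀ r : R, (∀ χ ∈ S, χ * r = 0) → r = 0) ∧
    ∀ χ ∈ S, ∃ (n : ℕ) (e : Fin n → L) (ε : Fin n → L →ₗ[R] R),
      ∀ l, χ • l = ∑ i, ε i l • e i

section
variable {R L B : Type*} [CommRing R] [AddCommGroup L] [Module R L] [AddCommGroup B] [Module R B]

/-- Local frames of `L` give local frames of a direct summand of `L`. -/
theorem HasLocalFrames.of_splitting (h : HasLocalFrames R L) {π : L →ₗ[R] B} {ib : B →ₗ[R] L}
    (hib : ∀ b, π (ib b) = b) : HasLocalFrames R B := by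
  obtain ⟨S, hS, h⟩ := h
  refine ⟨S, hS, fun χ hχ => ?_⟩
  obtain ⟨n, e, ε, he⟩ := h χ hχ
  refine ⟨n, fun i => π (e i), fun i => (ε i).comp ib, fun b => ?_⟩
  have h1 := congrArg π (he (ib b))
  rw [map_smul, hib, map_sum] at h1
  rw [h1]
  exact Finset.sum_congr rfl fun i _ => map_smul _ _ _

/-- A linear form on `L` as a function of form degree `1`. -/
def oneForm (ε : L →ₗ[R] R) : FormalFun R L B
  | 1, 0 => AlternatingMap.ofSubsingleton R L (SymForm R B 0) (0 : Fin 1)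
      ((LinearMap.toSpanSingleton R (SymForm R B 0)
        (SymForm.mk (MultilinearMap.constOfIsEmpty R _ 1) fun _ _ => rfl)).comp ε)
  | _, _ => 0

theorem oneForm_formDegree (ε : L →ₗ[R] R) : HasFormDegree 1 (oneForm ε : FormalFun R L B) := by
  intro p k h
  match p, k, h with
  | 0, _, _ => rfl
  | 1, _, h => exact absurd rfl h
  | _ + 2, _, _ => rfl

theorem oneForm_symDegree (ε : L →ₗ[R] R) : HasSymDegree 0 (oneForm ε : FormalFun R L B) := by
  intro p k h
  match p, k, h with
  | _, 0, h => exact absurd rfl h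
  | 0, _ + 1, _ => rfl
  | 1, _ + 1, _ => rfl
  | _ + 2, _ + 1, _ => rfl

theorem iL_oneForm (ε : L →ₗ[R] R) (l : L) :
    iL l (oneForm ε : FormalFun R L B) = ε l • one R L B := by
  refine formalFun_ext fun p k v w => ?_
  change (oneForm ε : FormalFun R L B) (p + 1) k (Fin.cons l v) w = ε l * one R L B p k v w
  match p, k, v, w with
  | 0, 0, _, _ => rfl
  | 0, _ + 1, _, _ => exact (mul_zero _).symm
  | _ + 1, _, _, _ => exact (mul_zero _).symm

/-- A linear form on `B` as an element of `S^1 B^∨`. -/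
def linForm (ε : B →ₗ[R] R) : SymForm R B 1 :=
  SymForm.mk (MultilinearMap.ofSubsingleton R B R (0 : Fin 1) ε) fun σ v => by
    rw [Subsingleton.elim σ 1]
    rfl

theorem iB_incl_linForm (ε : B →ₗ[R] R) (b : B) :
    iB b (incl 1 (linForm ε) : FormalFun R L B) = ε b • one R L B := by
  refine formalFun_ext fun p k v w => ?_
  change (incl 1 (linForm ε) : FormalFun R L B) p (k + 1) v (Fin.cons b w) =
    ε b * one R L B p k v w
  match p, k, v, w with
  | 0, 0, v, w =>
    rw [incl_apply]
    exact (mul_one _).symm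
  | 0, k + 1, v, w =>
    rw [incl_symDegree (linForm ε) 0 (k + 1 + 1) (by omega)]
    exact (mul_zero _).symm
  | _ + 1, _, _, _ => exact (mul_zero _).symm

/-- The operator which multiplies the components of form degree `p` by `p`. -/
def formEuler : FormalFun R L B →ₗ[R] FormalFun R L B where
  toFun f := fun p k => (p : R) • f p k
  map_add' _ _ := funext fun _ => funext fun _ => smul_add _ _ _
  map_smul' c f := funext fun p => funext fun k => smul_comm (p : R) c (f p k)

/-- The operator which multiplies the components of symmetric degree `k` by `k`. -/
def symEuler : FormalFun R L B →ₗ[R] FormalFun R L B where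
  toFun f := fun p k => (k : R) • f p k
  map_add' _ _ := funext fun _ => funext fun _ => smul_add _ _ _
  map_smul' c f := funext fun p => funext fun k => smul_comm (k : R) c (f p k)

theorem HasFormDegree.formEuler {p : ℕ} {f : FormalFun R L B} (hf : HasFormDegree p f) :
    formEuler f = (p : R) • f := by
  funext p' k
  change (p' : R) • f p' k = (p : R) • f p' k
  by_cases h : p' = p
  · rw [h]
  · rw [hf p' k h, smul_zero, smul_zero]

theorem HasSymDegree.symEuler {k : ℕ} {f : FormalFun R L B} (hf : HasSymDegree k f) :
    symEuler f = (k : R) • f := by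
  funext p k'
  change (k' : R) • f p k' = (k : R) • f p k'
  by_cases h : k' = k
  · rw [h]
  · rw [hf p k' h, smul_zero, smul_zero]

theorem iL_formEuler (l : L) (f : FormalFun R L B) :
    iL l (formEuler f) = iL l f + formEuler (iL l f) := by
  refine formalFun_ext fun p k v w => ?_
  change ((p + 1 : ℕ) : R) * f (p + 1) k (Fin.cons l v) w =
    f (p + 1) k (Fin.cons l v) w + (p : R) * f (p + 1) k (Fin.cons l v) w
  push_cast
  ring

theorem iB_symEuler (b : B) (f : FormalFun R L B) :
    iB b (symEuler f) = iB b f + symEuler (iB b f) := by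
  refine formalFun_ext fun p k v w => ?_
  change ((k + 1 : ℕ) : R) * f p (k + 1) v (Fin.cons b w) =
    f p (k + 1) v (Fin.cons b w) + (k : R) * f p (k + 1) v (Fin.cons b w)
  push_cast
  ring

theorem iL_iL (l l' : L) (f : FormalFun R L B) : iL l (iL l' f) = -iL l' (iL l f) :=
  formalFun_ext fun p k v w => alternating_cons_cons (f (p + 2) k) l' l v w

theorem iB_iB (b b' : B) (f : FormalFun R L B) : iB b (iB b' f) = iB b' (iB b f) := by
  refine formalFun_ext fun p k v w => ?_
  change f p (k + 2) v (Fin.cons b' (Fin.cons b w)) = f p (k + 2) v (Fin.cons b (Fin.cons b' w))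
  rw [← (f p (k + 2) v).symm (Equiv.swap 0 1)]
  congr 1
  funext x
  refine Fin.cases ?_ (fun x => Fin.cases ?_ (fun x => ?_) x) x
  · simp
  · simp
  · rw [Equiv.swap_apply_of_ne_of_ne (Fin.succ_ne_zero _) (by simp [Fin.ext_iff])]
    simp

theorem iL_sum_smul {n : ℕ} (c : Fin n → R) (e : Fin n → L) (f : FormalFun R L B) :
    iL (∑ i, c i • e i) f = ∑ i, c i • iL (e i) f := by
  let T : L →ₗ[R] FormalFun R L B :=
    { toFun := fun l => iL l f
      map_add' := fun l l' => iL_add l l' f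
      map_smul' := fun c l => funext fun p => funext fun k => map_smul (f (p + 1) k).curryLeft c l }
  change T _ = ∑ i, c i • T (e i)
  rw [map_sum]
  exact Finset.sum_congr rfl fun i _ => map_smul _ _ _

theorem iB_sum_smul {n : ℕ} (c : Fin n → R) (e : Fin n → B) (f : FormalFun R L B) :
    iB (∑ i, c i • e i) f = ∑ i, c i • iB (e i) f := by
  let T : B →ₗ[R] FormalFun R L B :=
    { toFun := fun b => iB b f
      map_add' := fun b b' => formalFun_ext fun p k v w =>
        congrArg (fun g => SymForm.toMulti g w) (LinearMap.map_add₂ (insertB k) b b' (f p (k + 1) v))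
      map_smul' := fun c b => formalFun_ext fun p k v w =>
        congrArg (fun g => SymForm.toMulti g w)
          (LinearMap.map_smul₂ (insertB k) c b (f p (k + 1) v)) }
  change T _ = ∑ i, c i • T (e i)
  rw [map_sum]
  exact Finset.sum_congr rfl fun i _ => map_smul _ _ _

end

section
variable {R L B : Type*} [CommRing R] [Algebra ℚ R] [AddCommGroup L] [Module R L] [AddCommGroup B]
  [Module R B]

/-- Euler's identity for the form degree, in a local frame. -/
theorem sum_oneForm_mul_iL {χ : R} {n : ℕ} {e : Fin n → L} {ε : Fin n → L →ₗ[R] R}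
    (he : ∀ l, χ • l = ∑ i, ε i l • e i) (f : FormalFun R L B) :
    ∑ i, mul (oneForm (ε i)) (iL (e i) f) = χ • formEuler f := by
  rw [← sub_eq_zero]
  refine family_eq_zero_of_contractions (fun f : FormalFun R L B =>
    ∑ i, mul (oneForm (ε i)) (iL (e i) f) - χ • formEuler f) ?_ ?_ ?_ f
  · intro f
    have h1 : c0 (formEuler f) = 0 := by
      change ((0 : ℕ) : R) * f 0 0 ![] ![] = 0
      simp
    simp only [map_sub, map_sum, c0_mul, (oneForm_formDegree _).c0_eq_zero, zero_mul,
      Finset.sum_const_zero, map_smul, h1, smul_zero, sub_zero]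
  · intro W hW f l
    have h1 : χ • iL l f = ∑ i, ε i l • iL (e i) f := by
      rw [← iL_sum_smul, ← he]
      exact (funext fun p => funext fun k => (map_smul (f (p + 1) k).curryLeft χ l).symm)
    have : iL l (∑ i, mul (oneForm (ε i)) (iL (e i) f) - χ • formEuler f) =
        ∑ i, mul (oneForm (ε i)) (iL (e i) (iL l f)) - χ • formEuler (iL l f) := by
      have h2 : ∀ i, iL l (mul (oneForm (ε i)) (iL (e i) f)) =
          ε i l • iL (e i) f + mul (oneForm (ε i)) (iL (e i) (iL l f)) := fun i => by
        rw [iL_mul, iL_oneForm, (oneForm_formDegree (ε i)).parity_eq, pow_one, neg_one_smul,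
          mul_neg_left, iL_iL, mul_neg_right, neg_neg, mul_smul_left, one_mul']
      rw [map_sub, map_sum, Finset.sum_congr rfl fun i _ => h2 i, Finset.sum_add_distrib, ← h1,
        map_smul, iL_formEuler, smul_add]
      abel
    rw [this]
    exact hW _
  · intro W hW f b
    have : iB b (∑ i, mul (oneForm (ε i)) (iL (e i) f) - χ • formEuler f) =
        ∑ i, mul (oneForm (ε i)) (iL (e i) (iB b f)) - χ • formEuler (iB b f) := by
      have h2 : ∀ i, iB b (mul (oneForm (ε i)) (iL (e i) f)) =
          mul (oneForm (ε i)) (iL (e i) (iB b f)) := fun i => by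
        rw [iB_mul, (oneForm_symDegree (ε i)).iB_eq_zero, mul_zero_left, zero_add]
        rfl
      rw [map_sub, map_sum, Finset.sum_congr rfl fun i _ => h2 i, map_smul]
      congr 2
    rw [this]
    exact hW _

/-- Euler's identity for the symmetric degree, in a local frame. -/
theorem sum_linForm_mul_iB {χ : R} {n : ℕ} {e : Fin n → B} {ε : Fin n → B →ₗ[R] R}
    (he : ∀ b, χ • b = ∑ i, ε i b • e i) (f : FormalFun R L B) :
    ∑ i, mul (incl 1 (linForm (ε i))) (iB (e i) f) = χ • symEuler f := by
  rw [← sub_eq_zero]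
  refine family_eq_zero_of_contractions (fun f : FormalFun R L B =>
    ∑ i, mul (incl 1 (linForm (ε i))) (iB (e i) f) - χ • symEuler f) ?_ ?_ ?_ f
  · intro f
    have h1 : c0 (symEuler f) = 0 := by
      change ((0 : ℕ) : R) * f 0 0 ![] ![] = 0
      simp
    have h2 : ∀ i, c0 (incl 1 (linForm (ε i)) : FormalFun R L B) = 0 := fun i => by
      rw [c0_apply, incl_symDegree (linForm (ε i)) 0 0 (by omega)]
      rfl
    simp only [map_sub, map_sum, c0_mul, h2, zero_mul,
      Finset.sum_const_zero, map_smul, h1, smul_zero, sub_zero]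
  · intro W hW f l
    have : iL l (∑ i, mul (incl 1 (linForm (ε i))) (iB (e i) f) - χ • symEuler f) =
        ∑ i, mul (incl 1 (linForm (ε i))) (iB (e i) (iL l f)) - χ • symEuler (iL l f) := by
      have h2 : ∀ i, iL l (mul (incl 1 (linForm (ε i))) (iB (e i) f)) =
          mul (incl 1 (linForm (ε i))) (iB (e i) (iL l f)) := fun i => by
        rw [iL_mul, (incl_formDegree (linForm (ε i))).iL_eq_zero, mul_zero_left, zero_add,
          (incl_formDegree (linForm (ε i))).parity_zero]
        rfl
      rw [map_sub, map_sum, Finset.sum_congr rfl fun i _ => h2 i, map_smul]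
      rfl
    rw [this]
    exact hW _
  · intro W hW f b
    have h1 : χ • iB b f = ∑ i, ε i b • iB (e i) f := by
      rw [← iB_sum_smul, ← he]
      exact formalFun_ext fun p k v w => congrArg (fun g => SymForm.toMulti g w)
          (LinearMap.map_smul₂ (insertB k) χ b (f p (k + 1) v)).symm
    have : iB b (∑ i, mul (incl 1 (linForm (ε i))) (iB (e i) f) - χ • symEuler f) =
        ∑ i, mul (incl 1 (linForm (ε i))) (iB (e i) (iB b f)) - χ • symEuler (iB b f) := by
      have h2 : ∀ i, iB b (mul (incl 1 (linForm (ε i))) (iB (e i) f)) =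
          ε i b • iB (e i) f + mul (incl 1 (linForm (ε i))) (iB (e i) (iB b f)) := fun i => by
        rw [iB_mul, iB_incl_linForm, mul_smul_left, one_mul', iB_iB]
      rw [map_sub, map_sum, Finset.sum_congr rfl fun i _ => h2 i, Finset.sum_add_distrib, ← h1,
        map_smul, iB_symEuler, smul_add]
      abel
    rw [this]
    exact hW _

omit [Algebra ℚ R] in
/-- Forms whose degree exceeds the rank vanish. -/
theorem smul_form_eq_zero [IsReduced R] {χ : R} {n : ℕ} {e : Fin n → L} {ε : Fin n → L →ₗ[R] R}
    (he : ∀ l, χ • l = ∑ i, ε i l • e i) {p k : ℕ} (hp : n < p) (g : Form R L B p k) :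
    χ • g = 0 := by
  refine AlternatingMap.ext fun v => SymForm.ext fun w => ?_
  change χ * g v w = 0
  have h1 : g (fun i => χ • v i) = 0 := by
    simp only [he]
    have h2 := g.toMultilinearMap.map_sum (fun (i : Fin p) (j : Fin n) => ε j (v i) • e j)
    refine h2.trans (Finset.sum_eq_zero fun I _ => ?_)
    obtain ⟨i, j, hij, hI⟩ := Fintype.exists_ne_map_eq_of_card_lt I (by simpa using hp)
    refine (g.toMultilinearMap.map_smul_univ _ _).trans ?_
    have h3 : g (fun i => e (I i)) = 0 := g.map_eq_zero_of_eq _ (by rw [hI]) hij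
    exact (congrArg _ h3).trans (smul_zero _)
  have h2 : χ ^ p * g v w = 0 := by
    have h3 : g (fun i => χ • v i) = (∏ _i : Fin p, χ) • g v :=
      g.toMultilinearMap.map_smul_univ (fun _ => χ) v
    rw [h1, Finset.prod_const, Finset.card_univ, Fintype.card_fin] at h3
    exact (congrArg (fun x => SymForm.toMulti x w) h3).symm
  refine IsReduced.eq_zero _ ⟨p, ?_⟩
  obtain ⟨m, rfl⟩ : ∃ m, p = m + 1 := ⟨p - 1, by omega⟩
  rw [mul_pow, pow_succ (g v w), ← mul_assoc, mul_right_comm, h2, zero_mul]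

section
variable {T : Op R L B}

/-- Additive operators that are linear over the forms are `R`-linear. -/
theorem map_smul_of_mul (hT : ∀ f w, HasSymDegree 0 w → T (mul f w) = mul (T f) w) (c : R)
    (f : FormalFun R L B) : T (c • f) = c • T f := by
  have h1 : HasSymDegree 0 (c • one R L B) := by
    intro p k h
    change c • one R L B p k = 0
    rw [one_symDegree p k h, smul_zero]
  rw [← mul_smul_one, hT f _ h1, mul_smul_one]

/-- The values of an operator which is linear over the forms, on the functions of symmetric degree
`k`, are as small as those on `S^k B^∨`: by Euler's identity, one-forms generate the forms. -/
theorem mem_adic_of_homogeneous (hfr : HasLocalFrames R L)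
    (hT : ∀ f w, HasSymDegree 0 w → T (mul f w) = mul (T f) w) {k : ℕ} {n : ℤ}
    (h0 : ∀ β : SymForm R B k, T (incl k β) ∈ adic R L B n) {p : ℕ} {f : FormalFun R L B}
    (hp : HasFormDegree p f) (hk : HasSymDegree k f) : T f ∈ adic R L B n := by
  induction p generalizing f with
  | zero => rw [← incl_comp0 hp hk]; exact h0 _
  | succ p ih =>
    intro a m hm
    obtain ⟨S, hS, hfr⟩ := hfr
    refine AlternatingMap.ext fun v => SymForm.ext fun w => hS _ fun χ hχ => ?_
    obtain ⟨r, e, ε, he⟩ := hfr χ hχ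
    have h1 : T (χ • formEuler f) ∈ adic R L B n := by
      rw [← sum_oneForm_mul_iL he, map_sum]
      refine sum_mem fun i _ => ?_
      rw [mul_comm_of_formDegree_one (oneForm_formDegree (ε i)), hT _ _ (oneForm_symDegree (ε i))]
      exact mul_mem_adic_left (ih (hp.iL (e i)).parity (hk.iL (e i)).parity)
    rw [map_smul_of_mul hT, hp.formEuler, map_smul_of_mul hT] at h1
    have h2 : χ * (((p + 1 : ℕ) : R) * T f a m v w) = 0 :=
      congrArg (fun x => SymForm.toMulti x w) (AlternatingMap.congr_fun (h1 a m hm) v)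
    refine eq_of_nsmul_eq R (Nat.succ_ne_zero p) ?_
    rw [nsmul_eq_mul, mul_left_comm]
    exact h2.trans (smul_zero _).symm

/-- Continuity of an additive operator at `0`. -/
theorem IsVertical.exists_adic (h : IsVertical T) (n : ℕ) :
    ∃ m : ℕ, ∀ f ∈ adic R L B m, T f ∈ adic R L B n := by
  obtain ⟨m, hm⟩ := h.1 0 n
  refine ⟨m, fun f hf => ?_⟩
  have h1 := hm f (by rwa [sub_zero])
  rwa [map_zero, sub_zero] at h1

theorem isVertical_of (hc : ∀ n : ℕ, ∃ m : ℕ, ∀ f ∈ adic R L B m, T f ∈ adic R L B n)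
    (hT : ∀ f w, HasSymDegree 0 w → T (mul f w) = mul (T f) w) : IsVertical T := by
  refine ⟨fun f n => ?_, hT⟩
  obtain ⟨m, hm⟩ := hc n
  refine ⟨m, fun g hg => ?_⟩
  rw [← map_sub]
  exact hm _ hg

variable [IsReduced R] (hfr : HasLocalFrames R L) (hT : IsVertical T)
include hfr hT

theorem IsVertical.mem_adic_of_symDegree {n : ℤ} {k : ℕ}
    (h : ∀ β : SymForm R B k, T (incl k β) ∈ adic R L B n) {f : FormalFun R L B}
    (hf : HasSymDegree k f) : T f ∈ adic R L B n := by
  intro a m hm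
  have hfr' := hfr
  obtain ⟨S, hS, hfr⟩ := hfr
  refine AlternatingMap.ext fun v => SymForm.ext fun w => hS _ fun χ hχ => ?_
  obtain ⟨r, e, ε, he⟩ := hfr χ hχ
  have h1 : χ • f = ∑ p ∈ Finset.range (r + 1), χ • formPart p f := by
    funext p k
    rw [Finset.sum_apply, Finset.sum_apply]
    by_cases hp : p < r + 1
    · have h2 : ∑ i ∈ Finset.range (r + 1), (χ • formPart i f) p k = (χ • formPart p f) p k := by
        refine Finset.sum_eq_single_of_mem p (by simpa using hp) fun i _ hi => ?_
        change χ • formPart i f p k = 0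
        rw [formPart_apply, if_neg (Ne.symm hi), smul_zero]
      rw [h2]
      change _ = χ • formPart p f p k
      rw [formPart_apply, if_pos rfl]
      rfl
    · refine (smul_form_eq_zero he (by omega) (f p k)).trans (Finset.sum_eq_zero fun i hi => ?_).symm
      change χ • formPart i f p k = 0
      rw [Finset.mem_range] at hi
      rw [formPart_apply, if_neg (by omega), smul_zero]
  have h2 : χ • T f ∈ adic R L B n := by
    rw [← map_smul_of_mul hT.2, h1, map_sum]
    refine sum_mem fun p _ => ?_
    rw [map_smul_of_mul hT.2]
    exact Submodule.smul_mem _ _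
      (mem_adic_of_homogeneous hfr' hT.2 h (formPart_formDegree p f) (hf.formPart p))
  exact congrArg (fun x => SymForm.toMulti x w) (AlternatingMap.congr_fun (h2 a m hm) v)

/-- A vertical operator which is small on `Ŝ B^∨` is small. -/
theorem IsVertical.mem_adic {n : ℤ} (h : ∀ k (β : SymForm R B k), T (incl k β) ∈ adic R L B n)
    (f : FormalFun R L B) : T f ∈ adic R L B n := by
  obtain ⟨m, hm⟩ := hT.exists_adic n.toNat
  have h1 := adic_mono (by omega) (hm _ (sub_sum_symPart_mem f m)) (m := n)
  rw [map_sub, map_sum] at h1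
  rw [← sub_add_cancel (T f) (∑ k ∈ Finset.range m, T (symPart k f))]
  exact add_mem h1 (sum_mem fun k _ => hT.mem_adic_of_symDegree hfr (h k) (symPart_symDegree k f))

/-- A vertical operator is determined by its restriction to `Ŝ B^∨`. -/
theorem IsVertical.eq_zero (h : ∀ k (β : SymForm R B k), T (incl k β) = 0) : T = 0 := by
  refine AddMonoidHom.ext fun f => eq_zero_of_mem_adic fun n => ?_
  exact hT.mem_adic hfr (fun k β => by rw [h]; exact zero_mem _) f

end

/-! ### Operators shifting the filtration -/

/-- Vertical operators mapping `I^m` to `I^{m+N}` for all `m`. -/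
def IsShift (N : ℤ) (T : Op R L B) : Prop :=
  IsVertical T ∧ ∀ (m : ℤ) (f : FormalFun R L B), f ∈ adic R L B m → T f ∈ adic R L B (m + N)

namespace IsShift

variable {N N' : ℤ} {T T' : Op R L B}

theorem of_mul (hT : ∀ f w, HasSymDegree 0 w → T (mul f w) = mul (T f) w)
    (h : ∀ (m : ℤ) (f : FormalFun R L B), f ∈ adic R L B m → T f ∈ adic R L B (m + N)) :
    IsShift N T := by
  refine ⟨isVertical_of (fun n => ⟨(n - N).toNat, fun f hf => ?_⟩) hT, h⟩
  exact adic_mono (by omega) (h _ f hf)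

theorem smul (hT : IsShift N T) (c : R) (f : FormalFun R L B) : T (c • f) = c • T f :=
  map_smul_of_mul hT.1.2 c f

theorem mono (hT : IsShift N T) (h : N' ≤ N) : IsShift N' T :=
  ⟨hT.1, fun m f hf => adic_mono (by omega) (hT.2 m f hf)⟩

theorem add (hT : IsShift N T) (hT' : IsShift N T') : IsShift N (T + T') := by
  refine of_mul (fun f w hw => ?_) fun m f hf => add_mem (hT.2 m f hf) (hT'.2 m f hf)
  change T (mul f w) + T' (mul f w) = mul (T f + T' f) w
  rw [hT.1.2 f w hw, hT'.1.2 f w hw, mul_add_left]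

theorem neg (hT : IsShift N T) : IsShift N (-T) := by
  refine of_mul (fun f w hw => ?_) fun m f hf => neg_mem (hT.2 m f hf)
  change -T (mul f w) = mul (-T f) w
  rw [hT.1.2 f w hw, mul_neg_left]

theorem sub (hT : IsShift N T) (hT' : IsShift N T') : IsShift N (T - T') := by
  rw [sub_eq_add_neg]
  exact hT.add hT'.neg

theorem zero : IsShift N (0 : Op R L B) :=
  of_mul (fun _ _ _ => (mul_zero_left _).symm) fun _ _ _ => zero_mem _

theorem one : IsShift 0 (1 : Op R L B) :=
  of_mul (fun _ _ _ => rfl) fun m f hf => by rwa [add_zero]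

theorem comp (hT : IsShift N T) (hT' : IsShift N' T') : IsShift (N + N') (T * T') := by
  refine of_mul (fun f w hw => ?_) fun m f hf => ?_
  · change T (T' (mul f w)) = mul (T (T' f)) w
    rw [hT'.1.2 f w hw, hT.1.2 _ w hw]
  · have h := hT.2 _ _ (hT'.2 m f hf)
    rwa [add_assoc, add_comm N'] at h

theorem sum {ι : Type*} {s : Finset ι} {u : ι → Op R L B} (h : ∀ i ∈ s, IsShift N (u i)) :
    IsShift N (∑ i ∈ s, u i) :=
  Finset.sum_induction u (IsShift N) (fun _ _ => add) zero h

theorem mem_adic (hT : IsShift N T) (f : FormalFun R L B) : T f ∈ adic R L B N := by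
  simpa using hT.2 0 f (mem_adic_of_nonpos le_rfl f)

theorem eq_zero (h : ∀ N : ℕ, IsShift (N : ℤ) T) : T = 0 :=
  AddMonoidHom.ext fun f => eq_zero_of_mem_adic fun n => (h n).mem_adic f

theorem shifts (hT : IsShift N T) : Shifts N T := fun k f hf => hT.2 k f hf.mem_adic

theorem isFiltrationShifting (hT : IsShift N T) : IsFiltrationShifting T := ⟨hT.1, N, hT.shifts⟩

/-- The order of a vertical operator can be read off from its restriction to `Ŝ B^∨`. -/
theorem of_incl [IsReduced R] (hfr : HasLocalFrames R L) (hT : IsVertical T)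
    (h : ∀ k (β : SymForm R B k), T (incl k β) ∈ adic R L B (k + N)) : IsShift N T := by
  refine ⟨hT, fun m f hf => ?_⟩
  obtain ⟨r, hr⟩ := hT.exists_adic (m + N).toNat
  have h1 := adic_mono (by omega) (hr _ (sub_sum_symPart_mem f r)) (m := m + N)
  rw [map_sub, map_sum] at h1
  rw [← sub_add_cancel (T f) (∑ k ∈ Finset.range r, T (symPart k f))]
  refine add_mem h1 (sum_mem fun k _ => ?_)
  by_cases hk : (k : ℤ) < m
  · have h2 : symPart k f = 0 := by
      funext p k'
      rw [symPart_apply]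
      split_ifs with h
      · rw [h, hf p k hk]
        rfl
      · rfl
    rw [h2, map_zero]
    exact zero_mem _
  · exact adic_mono (by omega) (hT.mem_adic_of_symDegree hfr (h k) (symPart_symDegree k f))

end IsShift

theorem IsFiltrationShifting.exists_isShift [IsReduced R] (hfr : HasLocalFrames R L)
    {T : Op R L B} (hT : IsFiltrationShifting T) : ∃ N : ℤ, IsShift N T := by
  obtain ⟨h, N, hN⟩ := hT
  exact ⟨N, IsShift.of_incl hfr h fun k β => hN k _ (incl_symDegree β)⟩

end
end
end Fedosov

namespace Fedosov
noncomputable section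

/-! ### Series of operators -/

section
variable {R L B : Type*} [CommRing R] [AddCommGroup L] [Module R L] [AddCommGroup B] [Module R B]

theorem mem_adic_of_hasUniformSum {u : ℕ → FormalFun R L B → FormalFun R L B}
    {φ : FormalFun R L B → FormalFun R L B} (h : HasUniformSum u φ) {n : ℤ} {f : FormalFun R L B}
    {K : ℕ} (hu : ∀ m ≥ K, ∑ i ∈ Finset.range m, u i f ∈ adic R L B n) : φ f ∈ adic R L B n := by
  obtain ⟨N₀, hN⟩ := h n.toNat
  have h1 := adic_mono (by omega) (hN (max N₀ K) (le_max_left _ _) f) (m := n)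
  rw [← sub_add_cancel (φ f) (∑ i ∈ Finset.range (max N₀ K), u i f)]
  exact add_mem h1 (hu _ (le_max_right _ _))

theorem HasUniformSum.unique {u : ℕ → FormalFun R L B → FormalFun R L B} {φ φ' : Op R L B}
    (h : HasUniformSum u φ) (h' : HasUniformSum u φ') : φ = φ' := by
  refine AddMonoidHom.ext fun f => sub_eq_zero.1 (eq_zero_of_mem_adic fun n => ?_)
  obtain ⟨N₀, hN⟩ := h n
  obtain ⟨N₁, hN'⟩ := h' n
  have h1 := sub_mem (hN (max N₀ N₁) (le_max_left _ _) f) (hN' (max N₀ N₁) (le_max_right _ _) f)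
  rwa [sub_sub_sub_cancel_right] at h1

theorem HasUniformSum.sub {u u' : ℕ → FormalFun R L B → FormalFun R L B} {φ φ' : Op R L B}
    (h : HasUniformSum u φ) (h' : HasUniformSum u' φ') :
    HasUniformSum (fun i f => u i f - u' i f) (φ - φ' : Op R L B) := by
  intro n
  obtain ⟨N₀, hN⟩ := h n
  obtain ⟨N₁, hN'⟩ := h' n
  refine ⟨max N₀ N₁, fun N hle f => ?_⟩
  have h1 := sub_mem (hN N (le_trans (le_max_left _ _) hle) f)
    (hN' N (le_trans (le_max_right _ _) hle) f)
  rw [Finset.sum_sub_distrib]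
  change φ f - φ' f - _ ∈ _
  rwa [sub_sub_sub_comm]

/-- The sum of a series of operators whose `i`-th term has values in `I^{i+N}`. -/
def opSum (N : ℤ) (u : ℕ → Op R L B) : Op R L B where
  toFun f := fun p m => ∑ i ∈ Finset.range ((m : ℤ) - N + 1).toNat, u i f p m
  map_zero' := by
    funext p m
    exact Finset.sum_eq_zero fun i _ => by rw [map_zero]; rfl
  map_add' f g := by
    funext p m
    change _ = (∑ i ∈ Finset.range ((m : ℤ) - N + 1).toNat, u i f p m) +
      ∑ i ∈ Finset.range ((m : ℤ) - N + 1).toNat, u i g p m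
    rw [← Finset.sum_add_distrib]
    exact Finset.sum_congr rfl fun i _ => by rw [map_add]; rfl

theorem hasUniformSum_opSum {N : ℤ} {u : ℕ → Op R L B}
    (hu : ∀ (i : ℕ) f, u i f ∈ adic R L B (i + N)) :
    HasUniformSum (fun i => ⇑(u i)) (opSum N u) := by
  intro n
  refine ⟨(n - N).toNat, fun K hK f p m hm => ?_⟩
  have h1 : (∑ i ∈ Finset.range K, u i f) p m = ∑ i ∈ Finset.range K, u i f p m := by
    rw [Finset.sum_apply, Finset.sum_apply]
  change (∑ i ∈ Finset.range ((m : ℤ) - N + 1).toNat, u i f p m) -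
    (∑ i ∈ Finset.range K, u i f) p m = 0
  rw [h1, sub_eq_zero]
  refine Finset.sum_subset (Finset.range_subset_range.2 (by omega)) fun i _ hi => ?_
  rw [Finset.mem_range] at hi
  exact hu i f p m (by omega)

theorem formDegree_of_hasUniformSum {u : ℕ → FormalFun R L B → FormalFun R L B}
    {φ : FormalFun R L B → FormalFun R L B} (h : HasUniformSum u φ) {p : ℕ} {f : FormalFun R L B}
    (hu : ∀ i, HasFormDegree p (u i f)) : HasFormDegree p (φ f) := by
  intro a m ha
  obtain ⟨N₀, hN⟩ := h (m + 1)
  have h1 := hN N₀ le_rfl f a m (by push_cast; omega)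
  have h2 := HasFormDegree.sum (s := Finset.range N₀) (fun i _ => hu i) a m ha
  rw [← sub_add_cancel (φ f) (∑ i ∈ Finset.range N₀, u i f)]
  change (φ f - ∑ i ∈ Finset.range N₀, u i f) a m + (∑ i ∈ Finset.range N₀, u i f) a m = 0
  rw [h1, h2, add_zero]

end

section
variable {R L B : Type*} [CommRing R] [Algebra ℚ R] [AddCommGroup L] [Module R L] [AddCommGroup B]
  [Module R B]

theorem IsShift.of_hasUniformSum {N : ℤ} {u : ℕ → Op R L B} {φ : Op R L B}
    (h : HasUniformSum (fun i => ⇑(u i)) φ) (hu : ∀ i, IsShift N (u i)) : IsShift N φ := by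
  refine IsShift.of_mul (fun f w hw => sub_eq_zero.1 (eq_zero_of_mem_adic fun n => ?_))
    fun m f hf => mem_adic_of_hasUniformSum h (K := 0) fun r _ =>
      sum_mem fun i _ => (hu i).2 m f hf
  obtain ⟨N₀, hN⟩ := h n
  have h1 := sub_mem (hN N₀ le_rfl (mul f w)) (mul_mem_adic_left (hN N₀ le_rfl f) (g := w))
  have h2 : ∑ i ∈ Finset.range N₀, u i (mul f w) = mul (∑ i ∈ Finset.range N₀, u i f) w := by
    rw [Finset.sum_congr rfl fun i _ => (hu i).1.2 f w hw]
    exact (LinearMap.map_sum₂ mulB (Finset.range N₀) (fun i => u i f) w).symm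
  rwa [h2, mul_sub_left, sub_sub_sub_cancel_right] at h1

theorem IsShift.sub_sum_of_hasUniformSum {N : ℤ} {u : ℕ → Op R L B} {φ : Op R L B}
    (h : HasUniformSum (fun i => ⇑(u i)) φ) (hu : ∀ i : ℕ, IsShift (i + N) (u i))
    (hφ : IsVertical φ) (n : ℕ) : IsShift (n + N) (φ - ∑ i ∈ Finset.range n, u i) := by
  refine IsShift.of_mul (fun f w hw => ?_) fun m f hf => ?_
  · have h1 : (∑ i ∈ Finset.range n, u i) (mul f w) = mul ((∑ i ∈ Finset.range n, u i) f) w := by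
      exact (IsShift.sum (N := N) fun i _ => (hu i).mono (by omega)).1.2 f w hw
    change φ (mul f w) - (∑ i ∈ Finset.range n, u i) (mul f w) =
      mul (φ f - (∑ i ∈ Finset.range n, u i) f) w
    rw [h1, hφ.2 f w hw, mul_sub_left]
  · obtain ⟨N₀, hN⟩ := h (m + (n + N)).toNat
    have h1 := adic_mono (by omega) (hN (n + N₀) (by omega) f) (m := m + (n + N))
    change φ f - (∑ i ∈ Finset.range n, u i) f ∈ _
    have h2 : (∑ i ∈ Finset.range n, u i) f = ∑ i ∈ Finset.range n, u i f :=
      AddMonoidHom.finsetSum_apply u (Finset.range n) f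
    rw [Finset.sum_range_add, ← sub_sub] at h1
    rw [h2, ← sub_add_cancel (φ f - ∑ i ∈ Finset.range n, u i f)
      (∑ i ∈ Finset.range N₀, u (n + i) f)]
    refine add_mem h1 (sum_mem fun i _ => ?_)
    exact adic_mono (by push_cast; omega) ((hu (n + i)).2 m f hf)

/-! ### Expansion of operators in vertical differential operators -/

/-- The vertical differential operator of a section, as an operator. -/
def vdoOp (q : ℕ) (s : SymForm R B q →ₗ[R] FormalFun R L B) : Op R L B :=
  (vdoB q s).toAddMonoidHom

theorem isShift_vdoOp {q : ℕ} {s : SymForm R B q →ₗ[R] FormalFun R L B} {N : ℤ}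
    (hs : ∀ β, s β ∈ adic R L B (q + N)) : IsShift N (vdoOp q s) := by
  refine IsShift.of_mul (fun f w hw => vdo_mul_right s f hw) fun m f hf => ?_
  exact adic_mono (by omega) (vdo_mem_adic hs hf)

/-- `φ = ∑ D_{s q}` with `s q` a section of `Λ^• L^∨ ⊗ Ŝ^{≥ q + N} B^∨ ⊗ S^q B`. -/
def IsExpansion (N : ℤ) (s : ∀ q : ℕ, SymForm R B q →ₗ[R] FormalFun R L B) (φ : Op R L B) : Prop :=
  (∀ (q : ℕ) β, s q β ∈ adic R L B (q + N)) ∧ HasUniformSum (fun q => vdo q (s q)) φ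

namespace IsExpansion

variable {N : ℤ} {s s' : ∀ q : ℕ, SymForm R B q →ₗ[R] FormalFun R L B} {φ φ' : Op R L B}

theorem isShift (h : IsExpansion N s φ) : IsShift N φ :=
  IsShift.of_hasUniformSum (u := fun q => vdoOp q (s q)) h.2 fun q => isShift_vdoOp (h.1 q)

/-- The coefficients of the expansion are determined recursively. -/
theorem apply_incl (h : IsExpansion N s φ) {q : ℕ} (β : SymForm R B q) :
    φ (incl q β) = ∑ i ∈ Finset.range q, vdo i (s i) (incl q β) + s q β := by
  rw [← sub_eq_zero]
  refine eq_zero_of_mem_adic fun n => ?_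
  obtain ⟨N₀, hN⟩ := h.2 n
  have h1 := hN (q + 1 + N₀) (by omega) (incl q β)
  have h2 : ∑ i ∈ Finset.range N₀, vdo (q + 1 + i) (s (q + 1 + i)) (incl q β) = 0 :=
    Finset.sum_eq_zero fun i _ => vdo_eq_zero_of_lt _ (incl_symDegree β) (by omega)
  rw [Finset.sum_range_add, Finset.sum_range_succ, h2, add_zero] at h1
  dsimp only at h1
  rwa [vdo_incl] at h1

theorem unique {N' : ℤ} (h : IsExpansion N s φ) (h' : IsExpansion N' s' φ) : s = s' := by
  funext q
  induction q using Nat.strong_induction_on with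
  | _ q ih =>
    refine LinearMap.ext fun β => ?_
    have h1 := h.apply_incl β
    rw [h'.apply_incl β, Finset.sum_congr rfl fun i hi => by rw [← ih i (Finset.mem_range.1 hi)]]
      at h1
    exact (add_left_cancel h1).symm

theorem formDegree (h : IsExpansion N s φ) {d : ℕ}
    (hd : ∀ q (β : SymForm R B q), HasFormDegree d (φ (incl q β))) (q : ℕ) (β : SymForm R B q) :
    HasFormDegree d (s q β) := by
  induction q using Nat.strong_induction_on with
  | _ q ih =>
    rw [← add_sub_cancel_left (∑ i ∈ Finset.range q, vdo i (s i) (incl q β)) (s q β),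
      ← h.apply_incl]
    refine (hd q β).sub (HasFormDegree.sum fun i hi => ?_)
    exact vdo_formDegree (ih i (Finset.mem_range.1 hi)) (incl_formDegree β)

theorem hasFormDegree_apply (h : IsExpansion N s φ) {d : ℕ}
    (hd : ∀ q (β : SymForm R B q), HasFormDegree d (s q β)) {p : ℕ} {f : FormalFun R L B}
    (hf : HasFormDegree p f) : HasFormDegree (p + d) (φ f) :=
  formDegree_of_hasUniformSum h.2 fun i => by
    rw [add_comm]
    exact vdo_formDegree (hd i) hf

theorem sub (h : IsExpansion N s φ) (h' : IsExpansion N s' φ') :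
    IsExpansion N (fun q => s q - s' q) (φ - φ') := by
  refine ⟨fun q β => sub_mem (h.1 q β) (h'.1 q β), ?_⟩
  have h1 : (fun q => vdo q (s q - s' q)) = fun q f => vdo q (s q) f - vdo q (s' q) f :=
    funext fun q => funext fun f => vdo_sub (s q) (s' q) f
  dsimp only
  rw [h1]
  exact h.2.sub h'.2

theorem zero (N : ℤ) : IsExpansion N (fun _ => 0) (0 : Op R L B) := by
  refine ⟨fun q β => zero_mem _, fun n => ⟨0, fun K _ f => ?_⟩⟩
  simp only [vdo_zero]
  rw [Finset.sum_const_zero, sub_zero]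
  exact zero_mem _

theorem exists_of_coeff (h : ∀ (q : ℕ) β, s q β ∈ adic R L B (q + N)) : ∃ φ, IsExpansion N s φ :=
  ⟨opSum N fun q => vdoOp q (s q), h,
    hasUniformSum_opSum (u := fun q => vdoOp q (s q)) fun i f => vdo_mem_adic_coeff (h i) f⟩

/-- The partial sums of the expansion of an operator: the coefficient of the next term is the
restriction to `S^q B^∨` of the difference between the operator and the partial sum. -/
def partialSum (T : FormalFun R L B →ₗ[R] FormalFun R L B) :
    ℕ → (FormalFun R L B →ₗ[R] FormalFun R L B)
  | 0 => 0
  | q + 1 => partialSum T q + vdoB q ((T - partialSum T q).comp (incl q))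

/-- Every operator shifting the filtration has an expansion: after `q` terms the remainder vanishes
on `S^k B^∨` for `k < q`, so that the remainders tend to `0` uniformly. -/
theorem exists_of_isShift [IsReduced R] (hfr : HasLocalFrames R L) (hφ : IsShift N φ) :
    ∃ s, IsExpansion N s φ := by
  let T : FormalFun R L B →ₗ[R] FormalFun R L B :=
    { toFun := φ, map_add' := map_add φ, map_smul' := fun c f => hφ.smul c f }
  let s : ∀ q : ℕ, SymForm R B q →ₗ[R] FormalFun R L B :=
    fun q => (T - partialSum T q).comp (incl q)
  have hP : ∀ q f, partialSum T q f = ∑ i ∈ Finset.range q, vdo i (s i) f := by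
    intro q
    induction q with
    | zero => exact fun f => rfl
    | succ q ih =>
      intro f
      rw [Finset.sum_range_succ, ← ih]
      rfl
  let ρ : ℕ → Op R L B := fun q => φ - ∑ i ∈ Finset.range q, vdoOp i (s i)
  have hρ : ∀ q f, ρ q f = φ f - ∑ i ∈ Finset.range q, vdo i (s i) f := fun q f =>
    congrArg (φ f - ·) (AddMonoidHom.finsetSum_apply (fun i => vdoOp i (s i)) (Finset.range q) f)
  have hs : ∀ q β, s q β = ρ q (incl q β) := fun q β => by
    rw [hρ, ← hP]
    rfl
  have key : ∀ q, IsShift N (ρ q) ∧ ∀ k < q, ∀ β : SymForm R B k, ρ q (incl k β) = 0 := by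
    intro q
    induction q with
    | zero => exact ⟨by simpa [ρ] using hφ, fun k hk => absurd hk (Nat.not_lt_zero k)⟩
    | succ q ih =>
      have h1 : ρ (q + 1) = ρ q - vdoOp q (s q) := by
        simp only [ρ, Finset.sum_range_succ, sub_sub]
      have h2 : ∀ f, ρ (q + 1) f = ρ q f - vdo q (s q) f := fun f => by rw [h1]; rfl
      refine ⟨?_, fun k hk β => ?_⟩
      · rw [h1]
        refine ih.1.sub (isShift_vdoOp fun β => ?_)
        rw [hs]
        exact ih.1.2 _ _ (incl_symDegree β).mem_adic
      · rw [h2]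
        rcases Nat.lt_succ_iff_lt_or_eq.1 hk with hk | rfl
        · rw [ih.2 k hk, vdo_eq_zero_of_lt _ (incl_symDegree β) hk, sub_zero]
        · rw [vdo_incl, hs, sub_self]
  refine ⟨s, fun q β => ?_, fun n => ⟨(n - N).toNat, fun K hK f => ?_⟩⟩
  · rw [hs]
    exact (key q).1.2 _ _ (incl_symDegree β).mem_adic
  · rw [← hρ]
    refine (key K).1.1.mem_adic hfr (fun k β => ?_) f
    by_cases hk : k < K
    · rw [(key K).2 k hk]
      exact zero_mem _
    · exact adic_mono (by omega) ((key K).1.2 _ _ (incl_symDegree β).mem_adic)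

end IsExpansion

/-! ### The homotopy operator on operators -/

section
variable {π : L →ₗ[R] B} {ib : B →ₗ[R] L} {N : ℤ}
  {s : ∀ q : ℕ, SymForm R B q →ₗ[R] FormalFun R L B} {φ φ' : Op R L B}

/-- The coefficients of `h_♮ φ`; the expansion of `φ` being unique, they do not depend on the choice
in the definition of `h_♮`. -/
theorem IsExpansion.homotopyNat (h : IsExpansion N s φ) :
    IsExpansion (N + 1) (fun q => (homotopy π ib).comp (s q)) (homotopyNat π ib φ) := by
  have h1 : ∀ (q : ℕ) β, (homotopy π ib).comp (s q) β ∈ adic R L B (q + (N + 1)) := fun q β => by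
    rw [← add_assoc]
    exact homotopy_mem_adic π ib (h.1 q β)
  obtain ⟨ψ, hψ⟩ := IsExpansion.exists_of_coeff h1
  have h2 : ∃ ψ, IsHomotopyNat π ib φ ψ := ⟨ψ, N, s, h.1, h.2, hψ.2⟩
  rw [Fedosov.homotopyNat, dif_pos h2]
  obtain ⟨N', s', hs', h3, h4⟩ := h2.choose_spec
  obtain rfl : s = s' := h.unique ⟨hs', h3⟩
  exact ⟨h1, h4⟩

variable [IsReduced R] (hfr : HasLocalFrames R L)
include hfr

/-- `h_♮` raises the order of operators by `1`. -/
theorem IsShift.homotopyNat (h : IsShift N φ) : IsShift (N + 1) (homotopyNat π ib φ) := by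
  obtain ⟨s, hs⟩ := IsExpansion.exists_of_isShift hfr h
  exact hs.homotopyNat.isShift

theorem homotopyNat_sub (h : IsShift N φ) (h' : IsShift N φ') :
    homotopyNat π ib (φ - φ') = homotopyNat π ib φ - homotopyNat π ib φ' := by
  obtain ⟨s, hs⟩ := IsExpansion.exists_of_isShift hfr h
  obtain ⟨s', hs'⟩ := IsExpansion.exists_of_isShift hfr h'
  have h1 := (hs.sub hs').homotopyNat (π := π) (ib := ib)
  have h2 := (hs.homotopyNat (π := π) (ib := ib)).sub (hs'.homotopyNat (π := π) (ib := ib))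
  have h3 : (fun q => (homotopy π ib).comp (s q - s' q)) =
      fun q => (homotopy π ib).comp (s q) - (homotopy π ib).comp (s' q) :=
    funext fun q => LinearMap.comp_sub _ _ _
  rw [h3] at h1
  exact h1.2.unique h2.2

/-- `h_♮` lowers the degree of operators by `1`. -/
theorem homotopyNat_formDegree (h : IsShift N φ) {d : ℕ}
    (hd : ∀ p f, HasFormDegree p f → HasFormDegree (p + (d + 1)) (φ f)) {p : ℕ}
    {f : FormalFun R L B} (hf : HasFormDegree p f) :
    HasFormDegree (p + d) (homotopyNat π ib φ f) := by
  obtain ⟨s, hs⟩ := IsExpansion.exists_of_isShift hfr h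
  refine hs.homotopyNat.hasFormDegree_apply (fun q β => homotopy_formDegree π ib ?_) hf
  refine hs.formDegree (fun q β => ?_) q β
  have h1 := hd 0 _ (incl_formDegree β)
  rwa [zero_add] at h1

/-- `h_♮` vanishes on operators of degree `0`. -/
theorem homotopyNat_eq_zero (h : IsShift N φ)
    (hd : ∀ p f, HasFormDegree p f → HasFormDegree p (φ f)) : homotopyNat π ib φ = 0 := by
  obtain ⟨s, hs⟩ := IsExpansion.exists_of_isShift hfr h
  have h1 := hs.homotopyNat (π := π) (ib := ib)
  have h2 : (fun q => (homotopy π ib).comp (s q)) = fun _ => 0 :=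
    funext fun q => LinearMap.ext fun β => homotopy_formDegree_zero π ib
      (hs.formDegree (fun q β => hd 0 _ (incl_formDegree β)) q β)
  rw [h2] at h1
  exact h1.2.unique (IsExpansion.zero (N + 1)).2

omit hfr [IsReduced R] in
/-- The commutator with the Koszul vector field acts on the coefficients of the expansion by the
Koszul vector field. -/
theorem IsExpansion.gradedComm_koszul (h : IsExpansion N s φ) :
    IsExpansion (N - 1) (fun q => koszulL π ∘ₗ s q) (gradedComm (koszul π) φ) := by
  refine ⟨fun q β => ?_, fun n => ?_⟩
  · have h1 := koszul_mem_adic π (h.1 q β)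
    rwa [add_sub_assoc] at h1
  · obtain ⟨N₀, hN⟩ := h.2 (n + 1)
    refine ⟨N₀, fun K hK f => ?_⟩
    have h1 := koszul_mem_adic π (hN K hK f)
    have h2 := parity_mem_adic (adic_mono (m := n) (by push_cast; omega)
      (hN K hK (parity (koszul π f))))
    rw [map_sub, map_sum, Nat.cast_add, Nat.cast_one, add_sub_cancel_right] at h1
    rw [map_sub, map_sum] at h2
    have h3 : ∀ i, vdo i (koszulL π ∘ₗ s i) f =
        koszul π (vdo i (s i) f) - parity (vdo i (s i) (parity (koszul π f))) := fun i => by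
      rw [koszul_vdo, parity_vdo, parity_parity, add_sub_cancel_right]
    simp only [h3]
    rw [Finset.sum_sub_distrib]
    change koszul π (φ f) - parity (φ (parity (koszul π f))) - _ ∈ _
    rw [sub_sub_sub_comm]
    exact sub_mem h1 h2

/-- The homotopy formula for operators: `h_♮ [k, Ψ] = Ψ` if `h_♮ Ψ` and the projection of `Ψ` onto
`Λ^• A^∨` vanish. -/
theorem homotopyNat_gradedComm_koszul (hib : ∀ b, π (ib b) = b) (h : IsShift N φ)
    (h0 : homotopyNat π ib φ = 0)
    (hσ : ∀ q (β : SymForm R B q), proj00 π ib (φ (incl q β)) = 0) :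
    homotopyNat π ib (gradedComm (koszul π) φ) = φ := by
  obtain ⟨s, hs⟩ := IsExpansion.exists_of_isShift hfr h
  have h1 := hs.homotopyNat (π := π) (ib := ib)
  rw [h0] at h1
  have h2 : ∀ q β, homotopy π ib (s q β) = 0 := fun q β =>
    LinearMap.congr_fun (congrFun (h1.unique (IsExpansion.zero N)) q) β
  have h3 : ∀ q β, proj00 π ib (s q β) = 0 := fun q β => by
    have h4 := hσ q β
    rw [hs.apply_incl, map_add, map_sum, Finset.sum_eq_zero fun i hi => ?_, zero_add] at h4
    · exact h4
    · rw [Finset.mem_range] at hi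
      exact proj00_of_mem_adic hib (adic_mono (by omega)
        (vdo_mem_adic_symDegree (s i) (incl_symDegree β).mem_adic))
  have h5 := (hs.gradedComm_koszul (π := π)).homotopyNat (π := π) (ib := ib)
  have h6 : (fun q => (homotopy π ib).comp (koszulL π ∘ₗ s q)) = s :=
    funext fun q => LinearMap.ext fun β => by
      have h7 := homotopy_koszul_add hib (s q β)
      rw [h2, h3, map_zero, add_zero, sub_zero] at h7
      exact h7
  rw [h6] at h5
  exact h5.2.unique hs.2

end
end
end
end Fedosov

namespace Fedosov
noncomputable section

/-! ### Odd derivations and Fedosov vector fields -/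

section
variable {R L B : Type*} [CommRing R] [Algebra ℚ R] [AddCommGroup L] [Module R L] [AddCommGroup B]
  [Module R B]

/-- A derivation of odd degree which preserves the forms `Γ(Λ^• L^∨)`. -/
structure IsOddDerivation (D : Op R L B) : Prop where
  map_mul : ∀ f g, D (mul f g) = mul (D f) g + mul (parity f) (D g)
  symDegree : ∀ f, HasSymDegree 0 f → HasSymDegree 0 (D f)

omit [Algebra ℚ R] in
theorem HasSymDegree.add {k : ℕ} {f g : FormalFun R L B} (hf : HasSymDegree k f)
    (hg : HasSymDegree k g) : HasSymDegree k (f + g) := by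
  intro p k' h
  change f p k' + g p k' = 0
  rw [hf p k' h, hg p k' h, add_zero]

omit [Algebra ℚ R] in
theorem hasSymDegree_zero (k : ℕ) : HasSymDegree k (0 : FormalFun R L B) := fun _ _ _ => rfl

namespace IsOddDerivation

variable {D D' : Op R L B}

theorem add (h : IsOddDerivation D) (h' : IsOddDerivation D') : IsOddDerivation (D + D') where
  map_mul f g := by
    change D (mul f g) + D' (mul f g) = mul (D f + D' f) g + mul (parity f) (D g + D' g)
    rw [h.map_mul, h'.map_mul, mul_add_left, mul_add_right]
    abel
  symDegree f hf := (h.symDegree f hf).add (h'.symDegree f hf)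

theorem gradedComm (h : IsOddDerivation D) {c N : ℤ}
    (hc : ∀ (m : ℤ) (f : FormalFun R L B), f ∈ adic R L B m → D f ∈ adic R L B (m - c))
    {φ : Op R L B} (hφ : IsShift N φ) : IsShift (N - c) (gradedComm D φ) := by
  refine IsShift.of_mul (fun f w hw => ?_) fun m f hf => ?_
  · change D (φ (mul f w)) - parity (φ (parity (D (mul f w)))) =
      mul (D (φ f) - parity (φ (parity (D f)))) w
    rw [hφ.1.2 f w hw, h.map_mul, h.map_mul, map_add parity, map_add φ, map_add parity, parity_mul,
      hφ.1.2 _ _ hw.parity, parity_mul, parity_parity, parity_mul, parity_parity,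
      hφ.1.2 _ _ (h.symDegree w hw).parity, parity_mul, parity_parity, mul_sub_left]
    abel
  · change D (φ f) - parity (φ (parity (D f))) ∈ _
    have h1 := hc _ _ (hφ.2 m f hf)
    have h2 := parity_mem_adic (hφ.2 _ _ (parity_mem_adic (hc m f hf)))
    rw [← add_sub_assoc]
    refine sub_mem h1 ?_
    rwa [sub_add_eq_add_sub] at h2

end IsOddDerivation

theorem isOddDerivation_koszul (π : L →ₗ[R] B) : IsOddDerivation (koszul π : Op R L B) where
  map_mul := koszul_mul π
  symDegree f hf := by
    rw [koszul_symDegree_zero π hf]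
    exact hasSymDegree_zero 0

/-- Odd derivations of square `0` of the form `-k + …`, the remainder preserving the filtration. Only
these properties of Fedosov vector fields enter their comparison. -/
structure IsFlat (π : L →ₗ[R] B) (Q : Op R L B) : Prop extends IsOddDerivation Q where
  koszul_add : ∀ (m : ℤ) (f : FormalFun R L B), f ∈ adic R L B m → (koszul π + Q) f ∈ adic R L B m
  formDegree : ∀ p f, HasFormDegree p f → HasFormDegree (p + 1) (Q f)
  sq : Q * Q = 0

variable {𝕜 : Type*} [CommRing 𝕜] [Algebra 𝕜 R] {Λ : LieAlgebroidStructure 𝕜 R L}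

theorem IsFedosov.isFlat {π : L →ₗ[R] B} {ib : B →ₗ[R] L} {D : LConnection Λ B} {Q : Op R L B}
    (hQ : IsFedosov π ib D Q) : IsFlat π Q := by
  obtain ⟨d, s, hd, hs, -, hQ, hsq⟩ := hQ
  refine ⟨⟨fun f g => ?_, fun f hf => ?_⟩, fun m f hf => ?_, fun p f hf => ?_, hsq⟩
  · rw [hQ, hQ, hQ, koszul_mul, hd.map_mul, vdo_one_mul fun β => (hs β).1]
    simp only [mul_add_left, mul_add_right, mul_neg_left, mul_neg_right]
    abel
  · rw [hQ, koszul_symDegree_zero π hf, neg_zero, zero_add,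
      vdo_eq_zero_of_lt s hf Nat.zero_lt_one, add_zero]
    exact hd.symDegree hf
  · change koszul π f + Q f ∈ _
    rw [hQ, add_assoc, add_neg_cancel_left]
    refine add_mem (hd.adic hf) (adic_mono ?_ (vdo_mem_adic (fun β => (hs β).2) hf))
    push_cast
    omega
  · rw [hQ]
    refine ((koszul_formDegree π hf).neg.add (hd.formDegree hf)).add ?_
    rw [add_comm p 1]
    exact vdo_formDegree (fun β => (hs β).1) hf

theorem IsFedosov.eq_of_symDegree_zero {π : L →ₗ[R] B} {ib₁ ib₂ : B →ₗ[R] L}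
    {D₁ D₂ : LConnection Λ B} {Q₁ Q₂ : Op R L B} (h₁ : IsFedosov π ib₁ D₁ Q₁)
    (h₂ : IsFedosov π ib₂ D₂ Q₂) {f : FormalFun R L B} (hf : HasSymDegree 0 f) : Q₁ f = Q₂ f := by
  obtain ⟨d, s, hd, -, -, hQ, -⟩ := h₁
  obtain ⟨d', s', hd', -, -, hQ', -⟩ := h₂
  rw [hQ, hQ', vdo_eq_zero_of_lt s hf Nat.zero_lt_one, vdo_eq_zero_of_lt s' hf Nat.zero_lt_one,
    hd.eq_of_symDegree_zero hd' hf]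

/-! ### Parity of vertical operators -/

section
variable {N : ℤ} {φ : Op R L B}

theorem IsShift.parity_conj (h : IsShift N φ) : IsShift N (parity * φ * parity) := by
  refine IsShift.of_mul (fun f w hw => ?_) fun m f hf => ?_
  · change parity (φ (parity (mul f w))) = mul (parity (φ (parity f))) w
    rw [parity_mul, h.1.2 _ _ hw.parity, parity_mul, parity_parity]
  · exact parity_mem_adic (h.2 _ _ (parity_mem_adic hf))

variable [IsReduced R] (hfr : HasLocalFrames R L)
include hfr

theorem IsShift.parity_conj_eq (h : IsShift N φ)
    (hd : ∀ p f, HasFormDegree p f → HasFormDegree p (φ f)) : parity * φ * parity = φ := by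
  refine sub_eq_zero.1 ((h.parity_conj.sub h).1.eq_zero hfr fun k β => ?_)
  change parity (φ (parity (incl k β))) - φ (incl k β) = 0
  rw [(incl_formDegree β).parity_zero, (hd 0 _ (incl_formDegree β)).parity_zero, sub_self]

theorem IsShift.parity_conj_eq_neg (h : IsShift N φ)
    (hd : ∀ p f, HasFormDegree p f → HasFormDegree (p + 1) (φ f)) : parity * φ * parity = -φ := by
  refine add_eq_zero_iff_eq_neg.1 ((h.parity_conj.add h).1.eq_zero hfr fun k β => ?_)
  change parity (φ (parity (incl k β))) + φ (incl k β) = 0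
  rw [(incl_formDegree β).parity_zero, (hd 0 _ (incl_formDegree β)).parity_eq, zero_add, pow_one,
    neg_one_smul, neg_add_cancel]

end

/-! ### The fixed point equation -/

section
variable {π : L →ₗ[R] B} {Q₁ Q₂ : Op R L B}

omit [Algebra ℚ R] in
theorem eth_sub (φ φ' : Op R L B) :
    eth π Q₁ Q₂ (φ - φ') = eth π Q₁ Q₂ φ - eth π Q₁ Q₂ φ' := by
  simp only [eth, gradedComm, mul_sub, sub_mul]
  abel

omit [Algebra ℚ R] in
theorem eth_one : eth π Q₁ Q₂ 1 = Q₁ - Q₂ := by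
  rw [eth, gradedComm, mul_one, mul_one, mul_one, parity_mul_parity, one_mul, sub_self, add_zero]

variable (h₁ : IsFlat π Q₁) (h₂ : IsFlat π Q₂) (h₁₂ : ∀ f, HasSymDegree 0 f → Q₁ f = Q₂ f)

include h₁ h₂ in
theorem eth_formDegree {φ : Op R L B} (hd : ∀ p f, HasFormDegree p f → HasFormDegree p (φ f)) {p : ℕ}
    {f : FormalFun R L B} (hf : HasFormDegree p f) :
    HasFormDegree (p + 1) (eth π Q₁ Q₂ φ f) := by
  have h3 : ∀ p f, HasFormDegree p f → HasFormDegree (p + 1) ((koszul π + Q₂) f) :=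
    fun p f hf => (koszul_formDegree π hf).add (h₂.formDegree p f hf)
  change HasFormDegree (p + 1) ((Q₁ (φ f) - Q₂ (φ f)) + ((koszul π + Q₂) (φ f) -
    parity (φ (parity ((koszul π + Q₂) f)))))
  exact ((h₁.formDegree _ _ (hd p f hf)).sub (h₂.formDegree _ _ (hd p f hf))).add
    ((h3 _ _ (hd p f hf)).sub (hd _ _ (h3 p f hf).parity).parity)

include h₁ h₂ h₁₂

/-- Two Fedosov vector fields agree on the forms, so that their difference is a vertical operator. -/
theorem isShift_sub : IsShift 0 (Q₁ - Q₂) := by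
  refine IsShift.of_mul (fun f w hw => ?_) fun m f hf => ?_
  · change Q₁ (mul f w) - Q₂ (mul f w) = mul (Q₁ f - Q₂ f) w
    rw [h₁.map_mul, h₂.map_mul, h₁₂ w hw, mul_sub_left]
    abel
  · have h := sub_mem (h₁.koszul_add m f hf) (h₂.koszul_add m f hf)
    change koszul π f + Q₁ f - (koszul π f + Q₂ f) ∈ _ at h
    rw [add_zero]
    rwa [add_sub_add_left_eq_sub] at h

theorem sub_mem_adic_one (f : FormalFun R L B) : (Q₁ - Q₂) f ∈ adic R L B 1 := by
  have h := (isShift_sub h₁ h₂ h₁₂).2 _ _ (sub_sum_symPart_mem f 1)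
  rw [Finset.sum_range_one, map_sub] at h
  have h0 : (Q₁ - Q₂) (symPart 0 f) = 0 := by
    change Q₁ (symPart 0 f) - Q₂ (symPart 0 f) = 0
    rw [h₁₂ _ (symPart_symDegree 0 f), sub_self]
  rw [h0, sub_zero] at h
  simpa using h

/-- `ð` preserves the order: the Koszul vector field, which lowers it, cancels in `k + Q₂`. -/
theorem isShift_eth {N : ℤ} {φ : Op R L B} (hφ : IsShift N φ) : IsShift N (eth π Q₁ Q₂ φ) := by
  have h3 := (isShift_sub h₁ h₂ h₁₂).comp hφ
  have h4 := ((isOddDerivation_koszul π).add h₂.toIsOddDerivation).gradedComm (c := 0)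
    (fun m f hf => by rw [sub_zero]; exact h₂.koszul_add m f hf) hφ
  rw [zero_add] at h3
  rw [sub_zero] at h4
  exact h3.add h4

variable [IsReduced R] (hfr : HasLocalFrames R L) (ib : B →ₗ[R] L)
include hfr

theorem isShift_homotopyNat_eth {N : ℤ} {φ : Op R L B} (hφ : IsShift N φ) :
    IsShift (N + 1) (homotopyNat π ib (eth π Q₁ Q₂ φ)) :=
  (isShift_eth h₁ h₂ h₁₂ hφ).homotopyNat hfr

theorem homotopyNat_eth_sub {N : ℤ} {φ φ' : Op R L B} (hφ : IsShift N φ) (hφ' : IsShift N φ') :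
    homotopyNat π ib (eth π Q₁ Q₂ (φ - φ')) =
      homotopyNat π ib (eth π Q₁ Q₂ φ) - homotopyNat π ib (eth π Q₁ Q₂ φ') := by
  rw [eth_sub, homotopyNat_sub hfr (isShift_eth h₁ h₂ h₁₂ hφ) (isShift_eth h₁ h₂ h₁₂ hφ')]

/-- The fixed point equation has at most one solution, as `h_♮ ð` raises the order of operators. -/
theorem eq_of_fixedPoint {φ ψ : Op R L B} (hφ : IsFiltrationShifting φ)
    (hψ : IsFiltrationShifting ψ) (eφ : φ = 1 + homotopyNat π ib (eth π Q₁ Q₂ φ))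
    (eψ : ψ = 1 + homotopyNat π ib (eth π Q₁ Q₂ ψ)) : ψ = φ := by
  obtain ⟨N, hφ⟩ := hφ.exists_isShift hfr
  obtain ⟨N', hψ⟩ := hψ.exists_isShift hfr
  have hφ := hφ.mono (min_le_left N N')
  have hψ := hψ.mono (min_le_right N N')
  have h3 : ψ - φ = homotopyNat π ib (eth π Q₁ Q₂ (ψ - φ)) := by
    rw [homotopyNat_eth_sub h₁ h₂ h₁₂ hfr ib hψ hφ]
    conv_lhs => rw [eψ, eφ]
    exact add_sub_add_left_eq_sub _ _ _
  have h4 : ∀ n : ℕ, IsShift (min N N' + n) (ψ - φ) := by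
    intro n
    induction n with
    | zero => simpa using hψ.sub hφ
    | succ n ih =>
      rw [h3]
      have h5 := isShift_homotopyNat_eth h₁ h₂ h₁₂ hfr ib ih
      rwa [add_assoc, ← Nat.cast_one, ← Nat.cast_add] at h5
  exact sub_eq_zero.1 (IsShift.eq_zero fun n =>
    (h4 (n + (-min N N').toNat)).mono (by push_cast; omega))

/-- The `n`-th iterate of `h_♮ ð` raises the order by `n`. -/
theorem isShift_iterate (n : ℕ) :
    IsShift n ((fun ψ => homotopyNat π ib (eth π Q₁ Q₂ ψ))^[n] 1) := by
  induction n with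
  | zero => exact IsShift.one
  | succ n ih =>
    rw [Function.iterate_succ_apply']
    exact isShift_homotopyNat_eth h₁ h₂ h₁₂ hfr ib ih

theorem formDegree_iterate (n : ℕ) : ∀ p f, HasFormDegree p f →
    HasFormDegree p ((fun ψ => homotopyNat π ib (eth π Q₁ Q₂ ψ))^[n] 1 f) := by
  induction n with
  | zero => exact fun p f hf => hf
  | succ n ih =>
    intro p f hf
    rw [Function.iterate_succ_apply']
    exact homotopyNat_formDegree (d := 0) hfr
      (isShift_eth h₁ h₂ h₁₂ (isShift_iterate h₁ h₂ h₁₂ hfr ib n))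
      (fun p f hf => eth_formDegree h₁ h₂ ih hf) hf

/-- The series of the iterates of `h_♮ ð` solves the fixed point equation. -/
theorem exists_fixedPoint : ∃ φ : Op R L B,
    HasUniformSum (fun n => ⇑((fun ψ => homotopyNat π ib (eth π Q₁ Q₂ ψ))^[n] 1)) φ ∧
    IsShift 0 φ ∧ (∀ p f, HasFormDegree p f → HasFormDegree p (φ f)) ∧
    φ = 1 + homotopyNat π ib (eth π Q₁ Q₂ φ) := by
  set T : Op R L B → Op R L B := fun ψ => homotopyNat π ib (eth π Q₁ Q₂ ψ) with hT
  have hu : ∀ n : ℕ, IsShift n (T^[n] 1) := isShift_iterate h₁ h₂ h₁₂ hfr ib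
  have hsum : HasUniformSum (fun n => ⇑(T^[n] 1)) (opSum 0 fun n => T^[n] 1) :=
    hasUniformSum_opSum fun i f => by
      rw [add_zero]
      exact (hu i).mem_adic f
  set φ := opSum 0 fun n => T^[n] 1
  have hφ : IsShift 0 φ := IsShift.of_hasUniformSum hsum fun i => (hu i).mono (by omega)
  refine ⟨φ, hsum, hφ, fun p f hf => formDegree_of_hasUniformSum hsum fun n =>
    formDegree_iterate h₁ h₂ h₁₂ hfr ib n p f hf, ?_⟩
  have hS : ∀ n : ℕ, IsShift 0 (∑ i ∈ Finset.range n, T^[i] 1) := fun n =>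
    IsShift.sum fun i _ => (hu i).mono (by omega)
  have hTsub : ∀ φ φ', IsShift 0 φ → IsShift 0 φ' → T (φ - φ') = T φ - T φ' := fun φ φ' h h' =>
    homotopyNat_eth_sub h₁ h₂ h₁₂ hfr ib h h'
  have hrec : ∀ n : ℕ, ∑ i ∈ Finset.range (n + 1), T^[i] 1 =
      1 + T (∑ i ∈ Finset.range n, T^[i] 1) := by
    intro n
    induction n with
    | zero =>
      have h0 := hTsub 0 0 IsShift.zero IsShift.zero
      rw [sub_self, sub_self] at h0
      rw [Finset.sum_range_one, Finset.sum_range_zero, h0, add_zero]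
      rfl
    | succ n ih =>
      have h3 : T (T^[n] 1) = T (∑ i ∈ Finset.range (n + 1), T^[i] 1) -
          T (∑ i ∈ Finset.range n, T^[i] 1) := by
        rw [← hTsub _ _ (hS (n + 1)) (hS n)]
        congr 1
        rw [Finset.sum_range_succ, add_sub_cancel_left]
      rw [Finset.sum_range_succ (fun i => T^[i] 1) (n + 1), Function.iterate_succ_apply', h3]
      nth_rewrite 1 [ih]
      abel
  rw [← sub_eq_zero]
  refine IsShift.eq_zero fun n => ?_
  have h3 : φ - (1 + T φ) = (φ - ∑ i ∈ Finset.range (n + 1), T^[i] 1) -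
      T (φ - ∑ i ∈ Finset.range n, T^[i] 1) := by
    rw [hTsub _ _ hφ (hS n), hrec]
    abel
  have h4 : ∀ n : ℕ, IsShift n (φ - ∑ i ∈ Finset.range n, T^[i] 1) := fun n => by
    have h5 := IsShift.sub_sum_of_hasUniformSum (N := 0) hsum
      (fun i => (hu i).mono (by omega)) hφ.1 n
    rwa [add_zero] at h5
  rw [h3]
  exact ((h4 (n + 1)).mono (by push_cast; omega)).sub
    ((isShift_homotopyNat_eth h₁ h₂ h₁₂ hfr ib (h4 n)).mono (by omega))

end
end
end
end Fedosov

namespace Fedosov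
noncomputable section

/-! ### The solution intertwines the Fedosov vector fields -/

section
variable {R L B : Type*} [CommRing R] [Algebra ℚ R] [IsReduced R] [AddCommGroup L] [Module R L]
  [AddCommGroup B] [Module R B]
variable {π : L →ₗ[R] B} {ib : B →ₗ[R] L} {Q₁ Q₂ φ : Op R L B}

theorem IsShift.parity_comm (hfr : HasLocalFrames R L) {N : ℤ} (h : IsShift N φ)
    (hd : ∀ p f, HasFormDegree p f → HasFormDegree p (φ f)) (f : FormalFun R L B) :
    φ (parity f) = parity (φ f) := by
  have h1 := DFunLike.congr_fun (h.parity_conj_eq hfr hd) (parity f)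
  change parity (φ (parity (parity f))) = _ at h1
  rw [← h1, parity_parity]

omit [Algebra ℚ R] [IsReduced R] in
theorem gradedComm_of_parity {D : Op R L B} (h : parity * φ * parity = φ) :
    gradedComm D φ = D * φ - φ * D := by
  rw [gradedComm, h]

/-- For an operator of degree `0` and positive order, `h_♮` inverts the commutator with the Koszul
vector field. -/
theorem homotopyNat_gradedComm_of_formDegree (hfr : HasLocalFrames R L) (hib : ∀ b, π (ib b) = b)
    {N : ℤ} (h : IsShift N φ) (hd : ∀ p f, HasFormDegree p f → HasFormDegree p (φ f))
    (hσ : ∀ q (β : SymForm R B q), φ (incl q β) ∈ adic R L B 1) :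
    homotopyNat π ib (gradedComm (koszul π) φ) = φ :=
  homotopyNat_gradedComm_koszul hfr hib h (homotopyNat_eq_zero hfr h hd)
    fun q β => proj00_of_mem_adic hib (hσ q β)

/-- For a degree-preserving operator `φ`, `ð φ` is the failure of `φ` to intertwine the two vector
fields, up to a commutator with the Koszul vector field. -/
theorem eth_eq (hp : parity * φ * parity = φ) :
    eth π Q₁ Q₂ φ = (Q₁ * φ - φ * Q₂) + gradedComm (koszul π) (φ - 1) := by
  have hp' : parity * (φ - 1) * parity = φ - 1 := by
    rw [mul_sub, sub_mul, hp, mul_one, parity_mul_parity]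
  rw [eth, gradedComm_of_parity hp, gradedComm_of_parity hp', mul_sub, sub_mul, sub_mul, mul_one,
    one_mul, add_mul, mul_add]
  abel

/-- Fixed points of `1 + h_♮ ð` intertwine the two vector fields: the defect `Ψ = Q₁ φ - φ Q₂`
satisfies `Ψ = h_♮ ((k + Q₁) Ψ + Ψ (k + Q₂))`, so that its order is arbitrarily high. -/
theorem intertwines_of_fixedPoint (h₁ : IsFlat π Q₁) (h₂ : IsFlat π Q₂)
    (h₁₂ : ∀ f, HasSymDegree 0 f → Q₁ f = Q₂ f) (hfr : HasLocalFrames R L)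
    (hib : ∀ b, π (ib b) = b) (hφ : IsShift 0 φ)
    (hd : ∀ p f, HasFormDegree p f → HasFormDegree p (φ f))
    (e : φ = 1 + homotopyNat π ib (eth π Q₁ Q₂ φ)) : φ * Q₂ = Q₁ * φ := by
  have hν : IsShift 1 (φ - 1) := by
    have h3 := isShift_homotopyNat_eth h₁ h₂ h₁₂ hfr ib hφ
    rw [zero_add] at h3
    nth_rewrite 1 [e]
    rwa [add_sub_cancel_left]
  have hνd : ∀ p f, HasFormDegree p f → HasFormDegree p ((φ - 1) f) :=
    fun p f hf => (hd p f hf).sub hf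
  have hp := hφ.parity_conj_eq hfr hd
  have h3 : homotopyNat π ib (gradedComm (koszul π) (φ - 1)) = φ - 1 :=
    homotopyNat_gradedComm_of_formDegree hfr hib hν hνd fun q β => hν.mem_adic _
  have h4 : IsShift 0 (gradedComm (koszul π) (φ - 1)) := by
    have h := (isOddDerivation_koszul π).gradedComm (fun m f hf => koszul_mem_adic π hf) hν
    rwa [sub_self] at h
  have h5 : Q₁ * φ - φ * Q₂ = eth π Q₁ Q₂ φ - gradedComm (koszul π) (φ - 1) := by
    rw [eth_eq hp, add_sub_cancel_right]
  set Ψ := Q₁ * φ - φ * Q₂ with hΨdef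
  have hΨ0 : IsShift 0 Ψ := by
    rw [h5]
    exact (isShift_eth h₁ h₂ h₁₂ hφ).sub h4
  have hΨh : homotopyNat π ib Ψ = 0 := by
    rw [h5, homotopyNat_sub hfr (isShift_eth h₁ h₂ h₁₂ hφ) h4, h3, sub_eq_zero, eq_sub_iff_add_eq,
      add_comm]
    exact e.symm
  have hΨσ : ∀ f, proj00 π ib (Ψ f) = 0 := by
    intro f
    have h6 : Ψ f = ((Q₁ - Q₂) f + (koszul π + Q₁) ((φ - 1) f) - (φ - 1) (Q₂ f)) -
        koszul π ((φ - 1) f) := by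
      change Q₁ (φ f) - φ (Q₂ f) = (Q₁ f - Q₂ f + (koszul π (φ f - f) + Q₁ (φ f - f)) -
        (φ (Q₂ f) - Q₂ f)) - koszul π (φ f - f)
      rw [map_sub Q₁]
      abel
    rw [h6, map_sub, proj00_koszul hib, proj00_of_mem_adic hib (hν.mem_adic f), map_zero, sub_zero]
    exact proj00_of_mem_adic hib (sub_mem (add_mem (sub_mem_adic_one h₁ h₂ h₁₂ f)
      (h₁.koszul_add _ _ (hν.mem_adic f))) (hν.mem_adic _))
  have hΨd : ∀ p f, HasFormDegree p f → HasFormDegree (p + 1) (Ψ f) := fun p f hf =>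
    (h₁.formDegree _ _ (hd p f hf)).sub (hd _ _ (h₂.formDegree p f hf))
  have hΨp := hΨ0.parity_conj_eq_neg hfr hΨd
  have h6 : gradedComm (koszul π) Ψ = (koszul π + Q₁) * Ψ + Ψ * (koszul π + Q₂) := by
    have h7 : Q₁ * Ψ + Ψ * Q₂ = 0 := by
      rw [hΨdef, mul_sub, sub_mul, ← mul_assoc, h₁.sq, zero_mul, mul_assoc φ, h₂.sq, mul_zero,
        ← mul_assoc]
      abel
    rw [gradedComm, hΨp, add_mul, mul_add]
    calc _ = koszul π * Ψ + Ψ * koszul π + (Q₁ * Ψ + Ψ * Q₂) := by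
          rw [h7, add_zero]
          exact AddMonoidHom.ext fun f => sub_neg_eq_add _ _
      _ = _ := by abel
  have h7 : ∀ n : ℕ, IsShift n Ψ := by
    intro n
    induction n with
    | zero => simpa using hΨ0
    | succ n ih =>
      have h8 : IsShift n (gradedComm (koszul π) Ψ) := by
        refine ⟨((isOddDerivation_koszul π).gradedComm (fun m f hf => koszul_mem_adic π hf) ih).1,
          fun m f hf => ?_⟩
        rw [h6]
        exact add_mem (h₁.koszul_add _ _ (ih.2 m f hf)) (ih.2 m _ (h₂.koszul_add m f hf))
      have h9 := h8.homotopyNat (π := π) (ib := ib) hfr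
      rw [homotopyNat_gradedComm_koszul hfr hib hΨ0 hΨh fun q β => hΨσ _] at h9
      exact_mod_cast h9
  exact (sub_eq_zero.1 (IsShift.eq_zero h7)).symm

/-! ### Intertwining operators of degree zero are automorphisms -/

/-- The operator `f ↦ f g`. -/
def mulRight (g : FormalFun R L B) : Op R L B := (mulB.flip g).toAddMonoidHom

/-- The operator `g ↦ f g`. -/
def mulLeft (f : FormalFun R L B) : Op R L B := (mulB f).toAddMonoidHom

omit [IsReduced R] in
theorem isShift_mulLeft (f : FormalFun R L B) : IsShift 0 (mulLeft f) :=
  IsShift.of_mul (fun g w _ => (mul_assoc' f g w).symm) fun m g hg => by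
    rw [add_zero]
    exact mul_mem_adic_right hg

omit [IsReduced R] in
theorem isShift_mulRight {g : FormalFun R L B} (hg : HasFormDegree 0 g) : IsShift 0 (mulRight g) :=
  IsShift.of_mul (fun f w _ => by
    change mul (mul f w) g = mul (mul f g) w
    rw [mul_assoc', mul_assoc', hg.mul_comm]) fun m f hf => by
    rw [add_zero]
    exact mul_mem_adic_left hf

section
variable (h₁ : IsFlat π Q₁) (h₂ : IsFlat π Q₂) (hfr : HasLocalFrames R L)
  (hib : ∀ b, π (ib b) = b) (hν : IsShift 1 (φ - 1))
  (hd : ∀ p f, HasFormDegree p f → HasFormDegree p (φ f))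

omit [IsReduced R] in
include hν in
theorem isShift_of_sub_one : IsShift 0 φ := by
  rw [← sub_add_cancel φ 1]
  exact (hν.mono (by norm_num)).add IsShift.one

include h₁ h₂ hfr hib hν hd in
/-- Intertwining operators are multiplicative: for `g` of degree `0`, the defect
`Δ_g f = φ (f g) - φ f φ g` satisfies `Δ_g = h_♮ [k, Δ_g]` and
`[k, Δ_g] f = (k + Q₁) Δ_g f - Δ_g (k + Q₂) f - Δ_{Q₂ g} (Pf)` with the parity operator `P`, so that
the order of all the `Δ_g` is arbitrarily high. -/
theorem map_mul_of_intertwines (he : φ * Q₂ = Q₁ * φ) (f g : FormalFun R L B) :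
    φ (mul f g) = mul (φ f) (φ g) := by
  have hφ := isShift_of_sub_one hν
  have he' : ∀ f, φ (Q₂ f) = Q₁ (φ f) := fun f => DFunLike.congr_fun he f
  have hP := hφ.parity_comm hfr hd
  let Δ : FormalFun R L B → FormalFun R L B → FormalFun R L B :=
    fun f g => φ (mul f g) - mul (φ f) (φ g)
  have key : ∀ (n : ℕ) (m : ℤ) (f g : FormalFun R L B), f ∈ adic R L B m →
      Δ f g ∈ adic R L B (m + n) := by
    intro n
    induction n with
    | zero =>
      intro m f g hf
      exact sub_mem (hφ.2 _ _ (mul_mem_adic_left hf)) (mul_mem_adic_left (hφ.2 m f hf))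
    | succ n ih =>
      have h3 : ∀ g, HasFormDegree 0 g →
          IsShift (n + 1) (φ * mulRight g - mulRight (φ g) * φ) := by
        intro g hg
        set T := φ * mulRight g - mulRight (φ g) * φ with hTdef
        have hTΔ : ∀ f, T f = Δ f g := fun f => rfl
        have hT0 : IsShift 0 T := by
          have h4 := hφ.comp (isShift_mulRight hg)
          have h5 := (isShift_mulRight (hd 0 g hg)).comp hφ
          rw [add_zero] at h4 h5
          exact h4.sub h5
        have hTn : IsShift n T := ⟨hT0.1, fun m f hf => ih m f g hf⟩
        have hTd : ∀ p f, HasFormDegree p f → HasFormDegree p (T f) := fun p f hf =>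
          (hd _ _ (mul_formDegree hf hg)).sub (mul_formDegree (hd p f hf) (hd 0 g hg))
        have hT1 : ∀ f, T f ∈ adic R L B 1 := fun f => by
          have h4 : T f = (φ - 1) (mul f g) - mul ((φ - 1) f) (φ g) - mul f ((φ - 1) g) := by
            change φ (mul f g) - mul (φ f) (φ g) =
              φ (mul f g) - mul f g - mul (φ f - f) (φ g) - mul f (φ g - g)
            rw [mul_sub_left, mul_sub_right]
            abel
          rw [h4]
          exact sub_mem (sub_mem (hν.mem_adic _) (mul_mem_adic_left (hν.mem_adic f)))
            (mul_mem_adic_right (hν.mem_adic g))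
        have hTh := homotopyNat_gradedComm_of_formDegree (π := π) hfr hib hT0 hTd fun q β => hT1 _
        have h4 : ∀ f, gradedComm (koszul π) T f =
            (koszul π + Q₁) (Δ f g) - Δ ((koszul π + Q₂) f) g - Δ (parity f) (Q₂ g) := by
          intro f
          rw [gradedComm_of_parity (hT0.parity_conj_eq hfr hTd)]
          have h5 : Q₁ (Δ f g) = Δ (Q₂ f) g + Δ (parity f) (Q₂ g) := by
            change Q₁ (φ (mul f g) - mul (φ f) (φ g)) =
              (φ (mul (Q₂ f) g) - mul (φ (Q₂ f)) (φ g)) +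
              (φ (mul (parity f) (Q₂ g)) - mul (φ (parity f)) (φ (Q₂ g)))
            rw [map_sub, ← he', h₂.map_mul, map_add, h₁.map_mul, he', he', hP]
            abel
          have h6 : Δ ((koszul π + Q₂) f) g = T (koszul π f) + Δ (Q₂ f) g :=
            map_add T (koszul π f) (Q₂ f)
          rw [h6]
          change koszul π (Δ f g) - T (koszul π f) = koszul π (Δ f g) + Q₁ (Δ f g) - _ - _
          rw [h5]
          abel
        have h5 : IsShift n (gradedComm (koszul π) T) := by
          refine ⟨((isOddDerivation_koszul π).gradedComm (fun m f hf => koszul_mem_adic π hf) hT0).1,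
            fun m f hf => ?_⟩
          rw [h4]
          exact sub_mem (sub_mem (h₁.koszul_add _ _ (ih m f g hf))
            (ih m _ g (h₂.koszul_add m f hf))) (ih m _ _ (parity_mem_adic hf))
        have h6 := h5.homotopyNat (π := π) (ib := ib) hfr
        rwa [hTh] at h6
      intro m f g hf
      have h4 : IsVertical (φ * mulLeft f - mulLeft (φ f) * φ) :=
        ((hφ.comp (isShift_mulLeft f)).sub ((isShift_mulLeft (φ f)).comp hφ)).1
      have h6 : ∀ g, (φ * mulLeft f - mulLeft (φ f) * φ) g = Δ f g := fun g => rfl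
      rw [← h6]
      refine h4.mem_adic hfr (fun k β => ?_) g
      rw [h6, Nat.cast_add, Nat.cast_one]
      exact (h3 (incl k β) (incl_formDegree β)).2 m f hf
  exact sub_eq_zero.1 (eq_zero_of_mem_adic fun n => by
    simpa using key n 0 f g (mem_adic_of_nonpos le_rfl f))

omit [IsReduced R] in
include hν in
/-- Operators `1 + ν` with `ν` of positive order are inverted by the Neumann series. -/
theorem bijective_of_sub_one : Function.Bijective φ := by
  have hφ := isShift_of_sub_one hν
  have hpow : ∀ n : ℕ, IsShift n ((1 - φ) ^ n) := by
    intro n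
    induction n with
    | zero => exact IsShift.one
    | succ n ih =>
      rw [pow_succ]
      have h1 := ih.comp hν.neg
      rw [neg_sub] at h1
      exact_mod_cast h1
  constructor
  · rw [injective_iff_map_eq_zero]
    intro f hf
    have h1 : ∀ n : ℕ, ((1 - φ) ^ n) f = f := by
      intro n
      induction n with
      | zero => rfl
      | succ n ih =>
        rw [pow_succ]
        change ((1 - φ) ^ n) (f - φ f) = f
        rw [hf, sub_zero, ih]
    exact eq_zero_of_mem_adic fun n => by
      rw [← h1 n]
      exact (hpow n).mem_adic f
  · intro g
    have hs := hasUniformSum_opSum (N := 0) (u := fun n => (1 - φ) ^ n) fun i f => by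
      rw [add_zero]
      exact (hpow i).mem_adic f
    refine ⟨opSum 0 (fun n => (1 - φ) ^ n) g, sub_eq_zero.1 (eq_zero_of_mem_adic fun n => ?_)⟩
    obtain ⟨N₀, hN⟩ := hs n
    have h1 := hφ.2 _ _ (hN (N₀ + n) (Nat.le_add_right _ _) g)
    rw [add_zero, map_sub] at h1
    have h2 : φ (∑ i ∈ Finset.range (N₀ + n), ((1 - φ) ^ i) g) = g - ((1 - φ) ^ (N₀ + n)) g := by
      have h3 := mul_neg_geom_sum (1 - φ) (N₀ + n)
      rw [sub_sub_cancel] at h3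
      have h4 := DFunLike.congr_fun h3 g
      change φ ((∑ i ∈ Finset.range (N₀ + n), (1 - φ) ^ i) g) = g - ((1 - φ) ^ (N₀ + n)) g at h4
      rw [← h4]
      congr 1
      exact (AddMonoidHom.finsetSum_apply (fun i => (1 - φ) ^ i) (Finset.range (N₀ + n)) g).symm
    rw [h2, sub_sub_eq_add_sub, add_sub_right_comm] at h1
    have h5 := adic_mono (m := n) (by push_cast; omega) ((hpow (N₀ + n)).mem_adic g)
    have h6 := sub_mem h1 h5
    rwa [add_sub_cancel_right] at h6

include h₁ h₂ hfr hib hν hd in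
theorem isVerticalAutomorphism_of_intertwines (he : φ * Q₂ = Q₁ * φ) :
    IsVerticalAutomorphism φ where
  vertical := (isShift_of_sub_one hν).1
  bijective := bijective_of_sub_one hν
  map_mul := map_mul_of_intertwines h₁ h₂ hfr hib hν hd he
  map_one := by
    obtain ⟨e, he1⟩ := (bijective_of_sub_one hν).2 (one R L B)
    have h := map_mul_of_intertwines h₁ h₂ hfr hib hν hd he e (one R L B)
    rw [mul_one', he1, one_mul'] at h
    exact h.symm
  map_degree := hd

end

/-! ### Uniqueness of intertwining automorphisms -/

/-- Powers in the function algebra. -/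
def npow (f : FormalFun R L B) : ℕ → FormalFun R L B
  | 0 => one R L B
  | n + 1 => mul f (npow f n)

omit [IsReduced R] in
theorem npow_mem_adic {f : FormalFun R L B} (hf : f ∈ adic R L B 1) (n : ℕ) :
    npow f n ∈ adic R L B n := by
  induction n with
  | zero => exact mem_adic_of_nonpos le_rfl _
  | succ n ih =>
    have h := mul_mem_adic hf ih
    rw [add_comm] at h
    exact_mod_cast h

omit [IsReduced R] in
theorem c0_npow (f : FormalFun R L B) (n : ℕ) : c0 (npow f n) = c0 f ^ n := by
  induction n with
  | zero => rw [npow, c0_one, pow_zero]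
  | succ n ih => rw [npow, c0_mul, ih, pow_succ']

omit [Algebra ℚ R] [IsReduced R] in
theorem mem_adic_one_of_c0 {f : FormalFun R L B} (hf : HasFormDegree 0 f) (h : c0 f = 0) :
    f ∈ adic R L B 1 := by
  intro p k hk
  obtain rfl : k = 0 := by omega
  by_cases hp : p = 0
  · subst hp
    refine AlternatingMap.ext fun v => SymForm.ext fun w => ?_
    rw [Subsingleton.elim v ![], Subsingleton.elim w ![]]
    exact h
  · exact hf p 0 hp

omit [Algebra ℚ R] [IsReduced R] in
theorem incl_zero (β : SymForm R B 0) : (incl 0 β : FormalFun R L B) = β ![] • one R L B := by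
  refine formalFun_ext fun p k v w => ?_
  change (incl 0 β : FormalFun R L B) p k v w = β ![] * one R L B p k v w
  match p, k, v, w with
  | 0, 0, v, w =>
    rw [incl_apply, Subsingleton.elim w ![]]
    exact (mul_one _).symm
  | 0, k + 1, v, w =>
    rw [incl_symDegree β 0 (k + 1) (by omega)]
    exact (mul_zero _).symm
  | _ + 1, _, _, _ => exact (mul_zero _).symm

omit [Algebra ℚ R] [IsReduced R] in
theorem HasSymDegree.iB {k : ℕ} {f : FormalFun R L B} (hf : HasSymDegree (k + 1) f) (b : B) :
    HasSymDegree k (iB b f) := by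
  intro p k' h
  change (insertB k' b).compAlternatingMap (f p (k' + 1)) = 0
  rw [hf p (k' + 1) (by omega)]
  exact AlternatingMap.ext fun v => map_zero (insertB k' b)

/-- Vertical automorphisms map linear functions to functions without constant term. -/
theorem IsVerticalAutomorphism.linForm_mem_adic {ψ : Op R L B} (hψ : IsVerticalAutomorphism ψ)
    (β : SymForm R B 1) : ψ (incl 1 β) ∈ adic R L B 1 := by
  refine mem_adic_one_of_c0 (hψ.map_degree 0 _ (incl_formDegree β)) ?_
  -- `ψ` is continuous, so that the constant term of a power of `ψ (incl 1 β)` vanishes.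
  obtain ⟨m, hm⟩ := hψ.vertical.exists_adic 1
  have h1 : ∀ n, ψ (npow (incl 1 β) n) = npow (ψ (incl 1 β)) n := by
    intro n
    induction n with
    | zero => exact hψ.map_one
    | succ n ih => rw [npow, hψ.map_mul, ih]; rfl
  have h2 := hm _ (npow_mem_adic (incl_symDegree β).mem_adic m)
  rw [h1] at h2
  refine IsReduced.eq_zero _ ⟨m, ?_⟩
  rw [← c0_npow, c0_apply, h2 0 0 (by norm_num)]
  rfl

/-- Vertical automorphisms preserve the filtration. -/
theorem IsVerticalAutomorphism.isShift (hfr : HasLocalFrames R L) (hfB : HasLocalFrames R B)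
    {ψ : Op R L B} (hψ : IsVerticalAutomorphism ψ) : IsShift 0 ψ := by
  have key : ∀ k (β : SymForm R B k), ψ (incl k β) ∈ adic R L B k := by
    intro k
    induction k with
    | zero => exact fun β => mem_adic_of_nonpos le_rfl _
    | succ k ih =>
      intro β a m hm
      obtain ⟨S, hS, hfB⟩ := hfB
      refine AlternatingMap.ext fun v => SymForm.ext fun w => hS _ fun χ hχ => ?_
      obtain ⟨n, e, ε, he⟩ := hfB χ hχ
      have h1 : ψ (χ • symEuler (incl (k + 1) β)) ∈ adic R L B (k + 1) := by
        rw [← sum_linForm_mul_iB he, map_sum]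
        refine sum_mem fun i _ => ?_
        rw [hψ.map_mul, ← incl_comp0 ((incl_formDegree β).iB (e i)) ((incl_symDegree β).iB (e i)),
          add_comm]
        exact mul_mem_adic (hψ.linForm_mem_adic _) (ih _)
      rw [(incl_symDegree β).symEuler, map_smul_of_mul hψ.vertical.2,
        map_smul_of_mul hψ.vertical.2] at h1
      have h2 : χ * (((k + 1 : ℕ) : R) * ψ (incl (k + 1) β) a m v w) = 0 :=
        congrArg (fun x => SymForm.toMulti x w)
          (AlternatingMap.congr_fun (h1 a m (by push_cast at hm; exact hm)) v)
      refine eq_of_nsmul_eq R (Nat.succ_ne_zero k) ?_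
      rw [nsmul_eq_mul, mul_left_comm]
      exact h2.trans (smul_zero _).symm
  exact IsShift.of_incl hfr hψ.vertical fun k β => by
    rw [add_zero]
    exact key k β

/-- Intertwining automorphisms solve the fixed point equation. -/
theorem IsVerticalAutomorphism.fixedPoint (hfr : HasLocalFrames R L) (hib : ∀ b, π (ib b) = b)
    {ψ : Op R L B} (hψ : IsVerticalAutomorphism ψ) (he : ψ * Q₂ = Q₁ * ψ) :
    ψ = 1 + homotopyNat π ib (eth π Q₁ Q₂ ψ) := by
  have hs := hψ.isShift hfr (hfr.of_splitting hib)
  have hd := hψ.map_degree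
  rw [eth_eq (hs.parity_conj_eq hfr hd), he, sub_self, zero_add,
    homotopyNat_gradedComm_of_formDegree hfr hib (hs.sub IsShift.one)
      (fun p f hf => (hd p f hf).sub hf) fun q β => ?_, add_sub_cancel]
  change ψ (incl q β) - incl q β ∈ _
  cases q with
  | zero =>
    rw [incl_zero, map_smul_of_mul hψ.vertical.2, hψ.map_one, sub_self]
    exact zero_mem _
  | succ q =>
    have h1 : incl (q + 1) β ∈ adic R L B 1 :=
      adic_mono (by push_cast; omega) (incl_symDegree β).mem_adic
    refine sub_mem ?_ h1
    have h2 := hs.2 _ _ h1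
    rwa [add_zero] at h2

/-! ### The comparison of Fedosov vector fields -/

/-- The comparison of two Fedosov vector fields, for modules with local frames over a reduced ring. -/
theorem exists_unique_intertwining (h₁ : IsFlat π Q₁) (h₂ : IsFlat π Q₂)
    (h₁₂ : ∀ f, HasSymDegree 0 f → Q₁ f = Q₂ f) (hfr : HasLocalFrames R L)
    (hib : ∀ b, π (ib b) = b) :
    ∃ φ : Op R L B,
      (IsVerticalAutomorphism φ ∧ φ * Q₂ = Q₁ * φ) ∧
      (∀ ψ, IsVerticalAutomorphism ψ → ψ * Q₂ = Q₁ * ψ → ψ = φ) ∧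
      (IsFiltrationShifting φ ∧ φ = 1 + homotopyNat π ib (eth π Q₁ Q₂ φ)) ∧
      (∀ ψ, IsFiltrationShifting ψ → ψ = 1 + homotopyNat π ib (eth π Q₁ Q₂ ψ) → ψ = φ) ∧
      HasUniformSum (fun n => (fun ψ => homotopyNat π ib (eth π Q₁ Q₂ ψ))^[n] 1) φ ∧
      HasUniformSum (fun n =>
        (fun ψ => homotopyNat π ib (eth π Q₁ Q₂ ψ))^[n] (homotopyNat π ib (Q₁ - Q₂)))
        (φ - 1 : Op R L B) := by
  obtain ⟨φ, hsum, hφ, hd, e⟩ := exists_fixedPoint h₁ h₂ h₁₂ hfr ib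
  have he := intertwines_of_fixedPoint h₁ h₂ h₁₂ hfr hib hφ hd e
  have hν : IsShift 1 (φ - 1) := by
    have h3 := isShift_homotopyNat_eth h₁ h₂ h₁₂ hfr ib hφ
    rw [zero_add] at h3
    nth_rewrite 1 [e]
    rwa [add_sub_cancel_left]
  have huniq : ∀ ψ, IsFiltrationShifting ψ → ψ = 1 + homotopyNat π ib (eth π Q₁ Q₂ ψ) → ψ = φ :=
    fun ψ hψ eψ => eq_of_fixedPoint h₁ h₂ h₁₂ hfr ib hφ.isFiltrationShifting hψ e eψ
  refine ⟨φ, ⟨isVerticalAutomorphism_of_intertwines h₁ h₂ hfr hib hν hd he, he⟩,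
    fun ψ hψ heψ => huniq ψ (hψ.isShift hfr (hfr.of_splitting hib)).isFiltrationShifting
      (hψ.fixedPoint hfr hib heψ), ⟨hφ.isFiltrationShifting, e⟩, huniq, hsum, fun n => ?_⟩
  obtain ⟨N₀, hN⟩ := hsum n
  refine ⟨N₀, fun N hle f => ?_⟩
  have h1 := hN (N + 1) (by omega) f
  rw [Finset.sum_range_succ'] at h1
  have h2 : ∀ i, (fun ψ => homotopyNat π ib (eth π Q₁ Q₂ ψ))^[i] (homotopyNat π ib (Q₁ - Q₂)) =
      (fun ψ => homotopyNat π ib (eth π Q₁ Q₂ ψ))^[i + 1] 1 := fun i => by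
    rw [Function.iterate_succ_apply, eth_one]
  simp only [h2]
  rw [add_comm, ← sub_sub] at h1
  exact h1

end
end
end Fedosov

namespace Fedosov
noncomputable section

/-! ### Smooth functions and sections -/

section
open Bundle

variable {𝕜 E M F : Type*} [RCLike 𝕜] [NormedAddCommGroup E] [NormedSpace ℝ E]
  [TopologicalSpace M] [ChartedSpace E M]

instance : IsReduced (SmoothFun 𝕜 E M) where
  eq_zero f := by
    rintro ⟨n, hn⟩
    refine Subtype.ext (funext fun x => ?_)
    exact eq_zero_of_pow_eq_zero (congrFun (congrArg Subtype.val hn) x)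

variable [NormedAddCommGroup F] [NormedSpace 𝕜 F] [NormedSpace ℝ F] [IsScalarTower ℝ 𝕜 F]
  {V : M → Type*} [TopologicalSpace (TotalSpace F V)] [∀ x, AddCommGroup (V x)]
  [∀ x, Module 𝕜 (V x)] [∀ x, Module ℝ (V x)] [∀ x, TopologicalSpace (V x)] [FiberBundle F V]
  [VectorBundle 𝕜 F V] [VectorBundle ℝ F V]

section
variable [IsManifold 𝓘(ℝ, E) ∞ M] [ContMDiffVectorBundle ∞ F V 𝓘(ℝ, E)]
  (e : Trivialization F (TotalSpace.proj : TotalSpace F V → M)) [MemTrivializationAtlas e]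
  (ρ : SmoothFun 𝕜 E M) (hρ : tsupport ρ.1 ⊆ e.baseSet)

/-- The product of `ρ` with the section that is constantly `v` in the trivialization `e`. -/
def cutoffSection (v : F) : SmoothSec E F V :=
  ⟨fun x => ρ.1 x • e.symm x v, by
    intro x
    by_cases hx : x ∈ e.baseSet
    · rw [Trivialization.contMDiffAt_section_iff e hx]
      have h : ContMDiffAt 𝓘(ℝ, E) 𝓘(ℝ, F) ∞ (fun y => ρ.1 y • v) x :=
        ((contDiff_smul (𝕜 := ℝ) (𝕜' := 𝕜) (F := F)).contMDiff.contMDiffAt).comp x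
          ((ρ.2 x).prodMk_space contMDiffAt_const)
      refine h.congr_of_eventuallyEq ?_
      filter_upwards [e.open_baseSet.mem_nhds hx] with y hy
      refine ((e.linear 𝕜 hy).map_smul (ρ.1 y) (e.symm y v)).trans ?_
      rw [e.apply_mk_symm hy]
    · refine (contMDiff_zeroSection ℝ V x).congr_of_eventuallyEq ?_
      filter_upwards [notMem_tsupport_iff_eventuallyEq.1 fun h => hx (hρ h)] with y hy
      rw [hy]
      exact congrArg (TotalSpace.mk' F y) (zero_smul 𝕜 _)⟩

variable [FiniteDimensional 𝕜 F]

/-- The product of `ρ` with a linear form on the fibres that is constant in the trivialization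
`e`. -/
def cutoffForm (a : F →ₗ[𝕜] 𝕜) : SmoothSec E F V →ₗ[SmoothFun 𝕜 E M] SmoothFun 𝕜 E M where
  toFun s := ⟨fun x => ρ.1 x * a (e ⟨x, s.1 x⟩).2, by
    intro x
    by_cases hx : x ∈ e.baseSet
    · have h1 := (Trivialization.contMDiffAt_section_iff e hx).1 (s.2 x)
      have h2 : ContMDiffAt 𝓘(ℝ, E) 𝓘(ℝ, 𝕜) ∞ (fun y => a (e ⟨y, s.1 y⟩).2) x :=
        ((LinearMap.toContinuousLinearMap a).restrictScalars ℝ).contDiff.contMDiff.contMDiffAt.comp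
          x h1
      exact ((contDiff_mul (𝕜 := ℝ) (𝔸 := 𝕜)).contMDiff.contMDiffAt).comp x
        ((ρ.2 x).prodMk_space h2)
    · refine contMDiffAt_const (c := (0 : 𝕜)).congr_of_eventuallyEq ?_
      filter_upwards [notMem_tsupport_iff_eventuallyEq.1 fun h => hx (hρ h)] with y hy
      rw [hy]
      exact zero_mul _⟩
  map_add' s t := by
    refine Subtype.ext (funext fun x => ?_)
    change ρ.1 x * a (e ⟨x, s.1 x + t.1 x⟩).2 =
      ρ.1 x * a (e ⟨x, s.1 x⟩).2 + ρ.1 x * a (e ⟨x, t.1 x⟩).2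
    by_cases hx : x ∈ e.baseSet
    · rw [(e.linear 𝕜 hx).map_add, map_add, mul_add]
    · have h : ρ.1 x = 0 := image_eq_zero_of_notMem_tsupport fun h => hx (hρ h)
      rw [h, zero_mul, zero_mul, zero_mul, add_zero]
  map_smul' f s := by
    refine Subtype.ext (funext fun x => ?_)
    change ρ.1 x * a (e ⟨x, f.1 x • s.1 x⟩).2 = f.1 x * (ρ.1 x * a (e ⟨x, s.1 x⟩).2)
    by_cases hx : x ∈ e.baseSet
    · rw [(e.linear 𝕜 hx).map_smul, map_smul, smul_eq_mul, mul_left_comm]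
    · have h : ρ.1 x = 0 := image_eq_zero_of_notMem_tsupport fun h => hx (hρ h)
      rw [h, zero_mul, zero_mul, mul_zero]

omit [IsManifold 𝓘(ℝ, E) ∞ M] in
/-- The sections constant in the trivialization, cut off by `ρ`, generate the multiples of `ρ²`. -/
theorem mul_self_smul_eq_sum {n : ℕ} (b : Module.Basis (Fin n) 𝕜 F) (s : SmoothSec E F V) :
    (ρ * ρ) • s = ∑ i, cutoffForm e ρ hρ (b.coord i) s • cutoffSection e ρ hρ (b i) := by
  refine Subtype.ext (funext fun x => ?_)
  let ev : SmoothSec E F V →+ V x :=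
    { toFun := fun s => s.1 x, map_zero' := rfl, map_add' := fun _ _ => rfl }
  change (ρ.1 x * ρ.1 x) • s.1 x = ev (∑ i, _)
  rw [map_sum]
  change _ = ∑ i, (ρ.1 x * b.coord i (e ⟨x, s.1 x⟩).2) • ρ.1 x • e.symm x (b i)
  by_cases hx : x ∈ e.baseSet
  · have h1 : s.1 x = ∑ i, b.coord i (e ⟨x, s.1 x⟩).2 • e.symm x (b i) := by
      have h2 : ∀ v, e.symm x v = e.symmₗ 𝕜 x v := fun v => by rw [e.coe_symmₗ hx]
      simp only [h2, ← map_smul, ← map_sum]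
      rw [← h2]
      have h3 : ∑ i, b.coord i (e ⟨x, s.1 x⟩).2 • b i = (e ⟨x, s.1 x⟩).2 := b.sum_repr _
      rw [h3]
      exact (e.symm_apply_apply_mk hx (s.1 x)).symm
    conv_lhs => rw [h1]
    rw [Finset.smul_sum]
    refine Finset.sum_congr rfl fun i _ => ?_
    rw [smul_smul, smul_smul]
    congr 1
    ring
  · have h : ρ.1 x = 0 := image_eq_zero_of_notMem_tsupport fun h => hx (hρ h)
    simp only [h, zero_mul, zero_smul, Finset.sum_const_zero]

end

variable (𝕜 E F V) in
/-- Smooth sections of a vector bundle have local frames: bump functions cut off the frames of the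
trivializations. -/
theorem hasLocalFrames_smoothSec [FiniteDimensional ℝ E] [IsManifold 𝓘(ℝ, E) ∞ M] [T2Space M]
    [ContMDiffVectorBundle ∞ F V 𝓘(ℝ, E)] [FiniteDimensional 𝕜 F] :
    HasLocalFrames (SmoothFun 𝕜 E M) (SmoothSec E F V) := by
  refine ⟨{χ | ∃ (n : ℕ) (e : Fin n → SmoothSec E F V)
    (ε : Fin n → SmoothSec E F V →ₗ[SmoothFun 𝕜 E M] SmoothFun 𝕜 E M),
      ∀ l, χ • l = ∑ i, ε i l • e i}, fun r hr => ?_, fun χ hχ => hχ⟩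
  refine Subtype.ext (funext fun x => ?_)
  obtain ⟨ρ, -, hρ⟩ := (SmoothBumpFunction.nhds_basis_tsupport (I := 𝓘(ℝ, E)) x).mem_iff.1
    ((trivializationAt F V x).open_baseSet.mem_nhds (mem_baseSet_trivializationAt F V x))
  let ρ' : SmoothFun 𝕜 E M := ⟨fun y => (ρ y : 𝕜),
    (RCLike.ofRealCLM (K := 𝕜)).contDiff.contMDiff.comp ρ.contMDiff⟩
  have hρ' : tsupport ρ'.1 ⊆ (trivializationAt F V x).baseSet := by
    refine (closure_mono fun y hy => ?_).trans hρ
    intro h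
    apply hy
    change ((ρ y : ℝ) : 𝕜) = 0
    rw [h, RCLike.ofReal_zero]
  have h1 := hr (ρ' * ρ') ⟨_, _, _, mul_self_smul_eq_sum (trivializationAt F V x) ρ' hρ'
    (Module.finBasis 𝕜 F)⟩
  have h2 : ((ρ x : ℝ) : 𝕜) * ((ρ x : ℝ) : 𝕜) * r.1 x = 0 :=
    congrFun (congrArg Subtype.val h1) x
  rw [ρ.eq_one, RCLike.ofReal_one, one_mul, one_mul] at h2
  exact h2

end
end
end Fedosov

open Bundle Fedosov in
theorem theorem3p1 {𝕜 E M F : Type*} [RCLike 𝕜]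
    [NormedAddCommGroup E] [NormedSpace ℝ E] [FiniteDimensional ℝ E]
    [TopologicalSpace M] [ChartedSpace E M] [IsManifold 𝓘(ℝ, E) ∞ M] [T2Space M]
    [SigmaCompactSpace M]
    [NormedAddCommGroup F] [NormedSpace 𝕜 F] [NormedSpace ℝ F] [IsScalarTower ℝ 𝕜 F]
    [FiniteDimensional 𝕜 F]
    {V : M → Type*} [TopologicalSpace (TotalSpace F V)] [∀ x, AddCommGroup (V x)]
    [∀ x, Module 𝕜 (V x)] [∀ x, Module ℝ (V x)] [∀ x, IsScalarTower ℝ 𝕜 (V x)]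
    [∀ x, TopologicalSpace (V x)] [FiberBundle F V] [VectorBundle 𝕜 F V] [VectorBundle ℝ F V]
    [ContMDiffVectorBundle ∞ F V 𝓘(ℝ, E)]
    (Λ : LieAlgebroidStructure 𝕜 (SmoothFun 𝕜 E M) (SmoothSec E F V))
    (A : ∀ x, Submodule 𝕜 (V x)) (hA : IsLieSubalgebroid E F Λ A)
    (ib₁ ib₂ ib : QuotSec E F A →ₗ[SmoothFun 𝕜 E M] SmoothSec E F V)
    (hib₁ : ∀ b, quotProj E F A (ib₁ b) = b)
    (hib₂ : ∀ b, quotProj E F A (ib₂ b) = b)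
    (hib : ∀ b, quotProj E F A (ib b) = b)
    (D₁ D₂ : LConnection Λ (QuotSec E F A))
    (hD₁ : D₁.IsTorsionFree (quotProj E F A)) (hD₂ : D₂.IsTorsionFree (quotProj E F A))
    (Q₁ Q₂ : Op (SmoothFun 𝕜 E M) (SmoothSec E F V) (QuotSec E F A))
    (hQ₁ : IsFedosov (quotProj E F A) ib₁ D₁ Q₁)
    (hQ₂ : IsFedosov (quotProj E F A) ib₂ D₂ Q₂) :
    ∃ φ : Op (SmoothFun 𝕜 E M) (SmoothSec E F V) (QuotSec E F A),
      (IsVerticalAutomorphism φ ∧ φ * Q₂ = Q₁ * φ) ∧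
      (∀ ψ, IsVerticalAutomorphism ψ → ψ * Q₂ = Q₁ * ψ → ψ = φ) ∧
      (IsFiltrationShifting φ ∧
        φ = 1 + homotopyNat (quotProj E F A) ib (eth (quotProj E F A) Q₁ Q₂ φ)) ∧
      (∀ ψ, IsFiltrationShifting ψ →
        ψ = 1 + homotopyNat (quotProj E F A) ib (eth (quotProj E F A) Q₁ Q₂ ψ) → ψ = φ) ∧
      HasUniformSum (fun n =>
        (fun ψ => homotopyNat (quotProj E F A) ib (eth (quotProj E F A) Q₁ Q₂ ψ))^[n] 1) φ ∧
      HasUniformSum (fun n =>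
        (fun ψ => homotopyNat (quotProj E F A) ib (eth (quotProj E F A) Q₁ Q₂ ψ))^[n]
          (homotopyNat (quotProj E F A) ib (Q₁ - Q₂)))
        (φ - 1 : Op (SmoothFun 𝕜 E M) (SmoothSec E F V) (QuotSec E F A)) := by
  exact exists_unique_intertwining hQ₁.isFlat hQ₂.isFlat
    (fun f hf => hQ₁.eq_of_symDegree_zero hQ₂ hf) (hasLocalFrames_smoothSec 𝕜 E F V) hib
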